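/- **Setting.** Let $(X_t,\epsilon_t)_{t\ge 0}$ be a strictly stationary sequence of pairs of real random variables on one probability space with $\mathsf E[\epsilon_t\mid X_t]=0$. A sample of size $n$ consists of $(X_t,Y_t)$, $1\le t\le n$. If $l=0$ (no change), $Y_t=\varphi(X_t)+\epsilon_t$. If $l=1$ (one change), $Y_t=\varphi_1(X_t)+\epsilon_t$ for $t\le k$ and $Y_t=\varphi_2(X_t)+\epsilon_t$ for $k<t\le n$, where $k=\lfloor\theta n\rfloor$. *Statistics.* Fix grid points $x_1,\dots,x_m$ and $\delta\in(0,1/2]$, and let $h_n$ be a bandwidth, $K_{h}(u)=h^{-1}K(u/h)$, $$\widehat\varphi_{s,u}(x)=\frac{\sum_{t=s}^uY_tK_{h_n}(X_t-x)}{\sum_{t=s}^uK_{h_n}(X_t-x)},\qquad W_{1,n}(t)=\frac{t(n-t)}{n^2}\sum_{i=1}^m\bigl|\widehat\varphi_{1,t}(x_i)-\widehat\varphi_{t+1,n}(x_i)\bigr|^2,\qquad \Delta_n=\lfloor n\delta\rfloor .$$ For a threshold $\xi_n$ put $\widehat l=0$ if $\max_{\Delta_n\le t\le n-\Delta_n}W_{1,n}(t)\le\xi_n$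 and $\widehat l=1$ otherwise. Let $\widehat k$ be any maximizer of $W_{1,n}$ over $\Delta_n\le t\le n-\Delta_n$, and $\widehat\theta=\widehat k/n$. When $l=1$ put $$\Lambda_{h_n}(x)=\frac{\mathsf E[Y_kK_{h_n}(X_k-x)]}{\mathsf E[K_{h_n}(X_k-x)]}-\frac{\mathsf E[Y_{k+1}K_{h_n}(X_{k+1}-x)]}{\mathsf E[K_{h_n}(X_{k+1}-x)]} .$$ *Assumptions.* 1. (Mixing) The strong mixing coefficients of $\{X_t,Y_t\}_{t=1}^n$ satisfy, with $C_1>0$ independent of $n$, for all lags $\tau\ge1$, either $\alpha(\tau)\le C_1\tau^{-\gamma}$ with $\gamma>11/2$ (PSM), or $\alpha(\tau)\le C_1\rho^{\tau}$ with $0<\rho<1$ (GSM). 2. (Bandwidth) $h_n/n^{-\omega}$ converges to a positive constant, where $0<\omega<1-\frac{14}{2\gamma+3}$ for PSM and $0<\omega<1$ for GSM. 3. (Kernel) $K$ is symmetric and nonnegative with $0<\|K\|_1<\infty$ and $0<\|K\|_\infty<\infty$. 4. (Densities) The pairs $(X_t,Y_t)$ have a density $p(x,y)$, and $X_t$ has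 density $f$; $f$ and $g(x)=\int yp(x,y)\,dy$ are bounded. For every $t\ge1$ the vector $(Y_t,Y_0,X_t,X_0)$ has a joint density $p_t(y,y',x,x')$, and $(X_t,X_0)$ has a joint density $f^{(t)}$. For some $p_F,p_G>2$, with $F^{(t)}(x,x')=f^{(t)}(x,x')-f(x)f(x')$ and $G^{(t)}(x,x')=\int|yy'p_t(y,y',x,x')-yp(x,y)\,y'p(x',y')|\,dy\,dy'$, one has $\sup_{t\ge1}\|F^{(t)}\|_{p_F}<\infty$ and $\sup_{t\ge1}\|G^{(t)}\|_{p_G}<\infty$; for PSM also $(1-2/p_F)(\gamma-1)>1$ and $(1-2/p_G)(\gamma-1)>1$. 5. (Moments) $\mathsf E[Y_t^2\mid X_t]$ is bounded, and $\mathsf E[e^{C_5|Y_t|}]<\infty$ for some $C_5>0$. 6. (Grid) Every $x_i$ lies in $\mathcal X=(\operatorname{supp}[X_1])^\circ$, and $f$ is bounded away from zero on a neighbourhood of $x_i$. 7. (Only for $l=1$) $\delta\le\theta\le1-\delta$, $\varphi_1$ and $\varphi_2$ are bounded and do not depend on $n$, and at least one $x_i$ lies in $\mathcal Y=\{x:\varphi_1(x)\ne\varphi_2(x)\}^\circ$.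 When $l=1$, assumptions 4 and 5 are required separately for each of the two stationary regimes $Y_t=\varphi_j(X_t)+\epsilon_t$, $j=1,2$. **Theorem 3.** (a) Let $l=0$ and let 1–6 hold. There is a constant $M>0$ such that, for every sequence $\xi_n$ with $\xi_n\ge M\frac{\log^4n}{nh_n}$ for all large $n$, almost surely $\widehat l=l$ for all large $n$. (b) Let $l=1$ and let 1–7 hold. There is a constant $M>0$ such that, for every sequence $\xi_n$ with $$M\frac{\log^4n}{nh_n}\le\xi_n\le\theta(1-\theta)\sum_{i=1}^m\Lambda_{h_n}^2(x_i)-M\frac{\log^2n}{\sqrt{nh_n}}\quad\text{for all large }n,$$ (i) almost surely $\widehat l=l$ for all large $n$, and (ii) $|\widehat\theta-\theta|\to0$ almost surely, whichever maximizers $\widehat k$ are chosen. (c) Let $l=1$ and let 1–7 hold. If, near some grid point, $\varphi_1-\varphi_2$ is bounded away from zero with constant sign, then (ii) holds with no condition on a threshold. -/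

import Mathlib

open Filter Topology MeasureTheory ProbabilityTheory

noncomputable section

namespace NWChange

variable {Ω : Type*} [MeasurableSpace Ω]

/-! ### Estimators and the CUSUM statistic -/

/-- The rescaled kernel `K_h(u) = h⁻¹ K(u / h)`. -/
def scaledKernel (K : ℝ → ℝ) (h u : ℝ) : ℝ := 1 / h * K (u / h)

/-- `ĝ_{s,u}(x; h)`: kernel average of the responses over the times `s, …, u`. -/
def gHat (K : ℝ → ℝ) (h : ℝ) (X Y : ℕ → Ω → ℝ) (s u : ℕ) (x : ℝ) (ω : Ω) : ℝ :=
  1 / ((u : ℝ) - s + 1) * ∑ t ∈ Finset.Icc s u, Y t ω * scaledKernel K h (X t ω - x)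

/-- `f̂_{s,u}(x; h)`: kernel density estimator over the times `s, …, u`. -/
def fHat (K : ℝ → ℝ) (h : ℝ) (X : ℕ → Ω → ℝ) (s u : ℕ) (x : ℝ) (ω : Ω) : ℝ :=
  1 / ((u : ℝ) - s + 1) * ∑ t ∈ Finset.Icc s u, scaledKernel K h (X t ω - x)

/-- The Nadaraya-Watson estimator `φ̂_{s,u}(x; h)`. -/
def phiHat (K : ℝ → ℝ) (h : ℝ) (X Y : ℕ → Ω → ℝ) (s u : ℕ) (x : ℝ) (ω : Ω) : ℝ :=
  gHat K h X Y s u x ω / fHat K h X s u x ω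

/-- The sum-of-squares CUSUM statistic `W_{1,n}(t)` of the sample at times `1, …, n`. -/
def cusum (K : ℝ → ℝ) (h : ℝ) {m : ℕ} (x : Fin m → ℝ) (X Y : ℕ → Ω → ℝ) (n t : ℕ) (ω : Ω) : ℝ :=
  (t : ℝ) * ((n : ℝ) - t) / (n : ℝ) ^ 2 *
    ∑ i, |phiHat K h X Y 1 t (x i) ω - phiHat K h X Y (t + 1) n (x i) ω| ^ 2

/-- The candidate times `Δ_n ≤ t ≤ n - Δ_n`, where `Δ_n = ⌊n δ⌋`. -/
def candidates (δ : ℝ) (n : ℕ) : Set ℕ := Set.Icc ⌊(n : ℝ) * δ⌋₊ (n - ⌊(n : ℝ) * δ⌋₊)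

/-- The maximum of `W_{1,n}` over the candidate times. -/
def maxCusum (K : ℝ → ℝ) (h : ℝ) {m : ℕ} (x : Fin m → ℝ) (X Y : ℕ → Ω → ℝ) (δ : ℝ) (n : ℕ)
    (ω : Ω) : ℝ :=
  sSup ((fun t => cusum K h x X Y n t ω) '' candidates δ n)

/-- The estimated number of change points for the threshold `ξ`. -/
def lHat (K : ℝ → ℝ) (h : ℝ) {m : ℕ} (x : Fin m → ℝ) (X Y : ℕ → Ω → ℝ) (δ ξ : ℝ) (n : ℕ)
    (ω : Ω) : ℕ :=
  if maxCusum K h x X Y δ n ω ≤ ξ then 0 else 1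

/-- `kHat` picks, for every sample size `n`, a maximizer of `W_{1,n}` over the candidate times.
The responses `Y n t` may depend on the sample size `n`. -/
def IsArgmaxCusum (K : ℝ → ℝ) (h : ℕ → ℝ) {m : ℕ} (x : Fin m → ℝ) (X : ℕ → Ω → ℝ)
    (Y : ℕ → ℕ → Ω → ℝ) (δ : ℝ) (kHat : ℕ → Ω → ℕ) : Prop :=
  ∀ n ω, kHat n ω ∈ candidates δ n ∧
    IsMaxOn (fun t => cusum K (h n) x X (Y n) n t ω) (candidates δ n) (kHat n ω)

/-- Strong consistency of `θ̂ = k̂ / n`, for every choice of the maximizer `k̂`. -/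
def StronglyConsistent (μ : Measure Ω) (K : ℝ → ℝ) (h : ℕ → ℝ) {m : ℕ} (x : Fin m → ℝ)
    (X : ℕ → Ω → ℝ) (Y : ℕ → ℕ → Ω → ℝ) (δ θ : ℝ) : Prop :=
  ∀ kHat : ℕ → Ω → ℕ, IsArgmaxCusum K h x X Y δ kHat →
    ∀ᵐ ω ∂μ, Tendsto (fun n : ℕ => |(kHat n ω : ℝ) / n - θ|) atTop (𝓝 0)

/-! ### The regression models -/

/-- Responses without a change: `Y_t = φ(X_t) + ε_t`. -/
def response (φ : ℝ → ℝ) (X ε : ℕ → Ω → ℝ) (t : ℕ) (ω : Ω) : ℝ := φ (X t ω) + ε t ω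

/-- Responses with one change after time `k`. -/
def responseChange (φ₁ φ₂ : ℝ → ℝ) (X ε : ℕ → Ω → ℝ) (k t : ℕ) (ω : Ω) : ℝ :=
  if t ≤ k then response φ₁ X ε t ω else response φ₂ X ε t ω

/-- The change point `k = ⌊θ n⌋`. -/
def changeTime (θ : ℝ) (n : ℕ) : ℕ := ⌊θ * n⌋₊

/-- The responses `Y n t` in a sample of size `n` with the change point `⌊θ n⌋`. -/
def changeArray (φ₁ φ₂ : ℝ → ℝ) (X ε : ℕ → Ω → ℝ) (θ : ℝ) (n t : ℕ) (ω : Ω) : ℝ :=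
  responseChange φ₁ φ₂ X ε (changeTime θ n) t ω

/-- The smoothed jump `Λ_h(x)` at the change point `k`. -/
def smoothedJump (μ : Measure Ω) (K : ℝ → ℝ) (h : ℝ) (X Y : ℕ → Ω → ℝ) (k : ℕ) (x : ℝ) : ℝ :=
  (∫ ω, Y k ω * scaledKernel K h (X k ω - x) ∂μ) / (∫ ω, scaledKernel K h (X k ω - x) ∂μ) -
    (∫ ω, Y (k + 1) ω * scaledKernel K h (X (k + 1) ω - x) ∂μ) /
      (∫ ω, scaledKernel K h (X (k + 1) ω - x) ∂μ)

/-- The signal `θ (1 - θ) ∑ᵢ Λ_{h_n}(x_i)²` at sample size `n`. -/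
def signal (μ : Measure Ω) (K : ℝ → ℝ) (h : ℕ → ℝ) {m : ℕ} (x : Fin m → ℝ) (X : ℕ → Ω → ℝ)
    (Y : ℕ → ℕ → Ω → ℝ) (θ : ℝ) (n : ℕ) : ℝ :=
  θ * (1 - θ) * ∑ i, smoothedJump μ K (h n) X (Y n) (changeTime θ n) (x i) ^ 2

/-! ### Dependence -/

/-- Strict stationarity: every time shift preserves the law of the whole sequence. -/
def StrictlyStationary {E : Type*} [MeasurableSpace E] (μ : Measure Ω) (Z : ℕ → Ω → E) : Prop :=
  ∀ s : ℕ, IdentDistrib (fun ω t => Z (t + s) ω) (fun ω t => Z t ω) μ μ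

/-- The σ-algebra generated by `Z_s`, `s ∈ I`. -/
abbrev sigmaOf {E : Type*} [MeasurableSpace E] (Z : ℕ → Ω → E) (I : Set ℕ) : MeasurableSpace Ω :=
  ⨆ s ∈ I, MeasurableSpace.comap (Z s) inferInstance

/-- The strong mixing coefficient `α(τ)` of the stretch `Z_1, …, Z_n`: the supremum of
`|P(A ∩ B) - P(A) P(B)|` over `A ∈ σ(Z_1, …, Z_j)`, `B ∈ σ(Z_{j+τ}, …, Z_n)` and `j`. -/
def mixingCoeff {E : Type*} [MeasurableSpace E] (μ : Measure Ω) (Z : ℕ → Ω → E) (n τ : ℕ) : ℝ :=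
  sSup {a : ℝ | ∃ j : ℕ, 1 ≤ j ∧ j + τ ≤ n ∧ ∃ A B : Set Ω,
    MeasurableSet[sigmaOf Z (Set.Icc 1 j)] A ∧ MeasurableSet[sigmaOf Z (Set.Icc (j + τ) n)] B ∧
      a = |μ.real (A ∩ B) - μ.real A * μ.real B|}

/-- The two mixing regimes: polynomial decay with exponent `γ`, geometric decay with ratio `ρ`. -/
inductive MixingRegime where
  | poly (γ : ℝ)
  | geom (ρ : ℝ)

namespace MixingRegime

/-- The admissible parameters of the regime. -/
def Admissible : MixingRegime → Prop
  | poly γ => 11 / 2 < γ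
  | geom ρ => 0 < ρ ∧ ρ < 1

/-- The decay of the mixing coefficients, up to a constant. -/
def rate : MixingRegime → ℕ → ℝ
  | poly γ, τ => (τ : ℝ) ^ (-γ)
  | geom ρ, τ => ρ ^ τ

/-- The strict upper bound for the bandwidth exponent. -/
def maxExponent : MixingRegime → ℝ
  | poly γ => 1 - 14 / (2 * γ + 3)
  | geom _ => 1

/-- The condition `(1 - 2 / p) (γ - 1) > 1`, required only for polynomial mixing. -/
def ExponentCondition : MixingRegime → ℝ → Prop
  | poly γ, p => 1 < (1 - 2 / p) * (γ - 1)
  | geom _, _ => True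

end MixingRegime

/-- `(X_t, Y_t)`, `1 ≤ t ≤ n`, is strongly mixing at the rate of the regime `R`, with a constant
that does not depend on the sample size `n`. -/
def MixesAtRate (μ : Measure Ω) (X : ℕ → Ω → ℝ) (Y : ℕ → ℕ → Ω → ℝ) (R : MixingRegime) : Prop :=
  ∃ C₁ : ℝ, 0 < C₁ ∧ ∀ n τ : ℕ, 1 ≤ τ →
    mixingCoeff μ (fun t ω => (X t ω, Y n t ω)) n τ ≤ C₁ * R.rate τ

/-! ### Bandwidth, kernel, densities, moments, grid -/

/-- `h_n ≃ n^{-w}` with an exponent `w` admissible for the mixing regime. -/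
def BandwidthCondition (h : ℕ → ℝ) (R : MixingRegime) : Prop :=
  ∃ w c : ℝ, 0 < w ∧ w < R.maxExponent ∧ 0 < c ∧
    Tendsto (fun n : ℕ => h n / (n : ℝ) ^ (-w)) atTop (𝓝 c)

/-- Symmetric nonnegative kernels with `0 < ‖K‖₁ < ∞` and `0 < ‖K‖_∞ < ∞`. -/
structure KernelCondition (K : ℝ → ℝ) : Prop where
  measurable : Measurable K
  symmetric : ∀ u, K (-u) = K u
  nonneg : ∀ u, 0 ≤ K u
  norm_one_pos : 0 < eLpNorm K 1 volume
  norm_one_lt_top : eLpNorm K 1 volume < ⊤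
  norm_top_pos : 0 < eLpNorm K ⊤ volume
  norm_top_lt_top : eLpNorm K ⊤ volume < ⊤

/-- The density `f` of `X_t` (for a stationary sequence, of `X_0`). -/
def densX (μ : Measure Ω) (X : ℕ → Ω → ℝ) (u : ℝ) : ℝ := (pdf (X 0) μ volume u).toReal

/-- The joint density `p(x, y)` of `(X_t, Y_t)`. -/
def densXY (μ : Measure Ω) (X Y : ℕ → Ω → ℝ) (u y : ℝ) : ℝ :=
  (pdf (fun ω => (X 0 ω, Y 0 ω)) μ volume (u, y)).toReal

/-- The function `g(x) = ∫ y p(x, y) dy`. -/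
def gFun (μ : Measure Ω) (X Y : ℕ → Ω → ℝ) (u : ℝ) : ℝ := ∫ y : ℝ, y * densXY μ X Y u y

/-- The function `F^{(t)} = f^{(t)} - f ⊗ f`, with `f^{(t)}` the joint density of `(X_t, X_0)`. -/
def lagF (μ : Measure Ω) (X : ℕ → Ω → ℝ) (t : ℕ) (z : ℝ × ℝ) : ℝ :=
  (pdf (fun ω => (X t ω, X 0 ω)) μ volume z).toReal - densX μ X z.1 * densX μ X z.2

/-- The joint density of `(Y_t, Y_0, X_t, X_0)`. -/
def densFour (μ : Measure Ω) (X Y : ℕ → Ω → ℝ) (t : ℕ) (y z : ℝ × ℝ) : ℝ :=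
  (pdf (fun ω => ((Y t ω, Y 0 ω), (X t ω, X 0 ω))) μ volume (y, z)).toReal

/-- The function `G^{(t)}(x_t, x_0) =
∫ |y_t y_0 p(y_t, y_0, x_t, x_0) - y_t p(y_t, x_t) y_0 p(y_0, x_0)| dy_t dy_0`. -/
def lagG (μ : Measure Ω) (X Y : ℕ → Ω → ℝ) (t : ℕ) (z : ℝ × ℝ) : ENNReal :=
  ∫⁻ y : ℝ × ℝ, ENNReal.ofReal |y.1 * y.2 * densFour μ X Y t y z -
    y.1 * densXY μ X Y z.1 y.1 * (y.2 * densXY μ X Y z.2 y.2)|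

/-- Conditions on the marginal and joint densities of a stationary sequence `(X_t, Y_t)`. -/
structure DensityCondition (μ : Measure Ω) (X Y : ℕ → Ω → ℝ) (R : MixingRegime) : Prop where
  hasPDF_X : HasPDF (X 0) μ volume
  hasPDF_XY : HasPDF (fun ω => (X 0 ω, Y 0 ω)) μ volume
  hasPDF_lag : ∀ t : ℕ, 1 ≤ t → HasPDF (fun ω => (X t ω, X 0 ω)) μ volume
  hasPDF_four : ∀ t : ℕ, 1 ≤ t →
    HasPDF (fun ω => ((Y t ω, Y 0 ω), (X t ω, X 0 ω))) μ volume
  f_bounded : ∃ C : ℝ, ∀ᵐ u ∂(volume : Measure ℝ), densX μ X u ≤ C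
  g_bounded : ∃ C : ℝ, ∀ᵐ u ∂(volume : Measure ℝ), |gFun μ X Y u| ≤ C
  lagF_bounded : ∃ p C₂ : ℝ, 2 < p ∧ R.ExponentCondition p ∧
    ∀ t : ℕ, 1 ≤ t → eLpNorm (lagF μ X t) (ENNReal.ofReal p) volume ≤ ENNReal.ofReal C₂
  lagG_bounded : ∃ p C₃ : ℝ, 2 < p ∧ R.ExponentCondition p ∧
    ∀ t : ℕ, 1 ≤ t → eLpNorm (lagG μ X Y t) (ENNReal.ofReal p) volume ≤ ENNReal.ofReal C₃

/-- Bounded conditional second moment and a finite exponential moment, for a stationary sequence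
`(X_t, Y_t)`. -/
structure MomentCondition (μ : Measure Ω) (X Y : ℕ → Ω → ℝ) : Prop where
  condSecondMoment : ∃ C₄ : ℝ,
    ∀ᵐ ω ∂μ, (μ[fun ω => Y 0 ω ^ 2 | MeasurableSpace.comap (X 0) inferInstance]) ω ≤ C₄
  expMoment : ∃ C₅ : ℝ, 0 < C₅ ∧ Integrable (fun ω => Real.exp (C₅ * |Y 0 ω|)) μ

/-- The set `𝒳 = (supp X_1)°`. -/
def interiorSupport (μ : Measure Ω) (X : ℕ → Ω → ℝ) : Set ℝ := interior (μ.map (X 1)).support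

/-- The density of `X_t` is bounded away from zero on a neighbourhood of `u₀`. -/
def DensityPositiveNear (μ : Measure Ω) (X : ℕ → Ω → ℝ) (u₀ : ℝ) : Prop :=
  ∃ c r : ℝ, 0 < c ∧ 0 < r ∧ ∀ᵐ u ∂(volume.restrict (Metric.ball u₀ r)), c ≤ densX μ X u

/-- The set `𝒴 = {x : φ₁(x) ≠ φ₂(x)}°`. -/
def changeRegion (φ₁ φ₂ : ℝ → ℝ) : Set ℝ := interior {u | φ₁ u ≠ φ₂ u}

/-- `φ₁ - φ₂` is bounded away from zero, with one sign, on a neighbourhood of `u₀`. -/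
def SeparatedNear (φ₁ φ₂ : ℝ → ℝ) (u₀ : ℝ) : Prop :=
  ∃ c : ℝ, 0 < c ∧ ((∀ᶠ u in 𝓝 u₀, c ≤ φ₁ u - φ₂ u) ∨ (∀ᶠ u in 𝓝 u₀, c ≤ φ₂ u - φ₁ u))

/-! ### The standing assumptions in the two cases -/

/-- What is assumed whether or not there is a change: covariates and errors are jointly strictly
stationary, `E[ε_t | X_t] = 0`, and the regime, bandwidth, kernel and grid are as required. -/
structure CommonAssumptions (μ : Measure Ω) (X ε : ℕ → Ω → ℝ) (K : ℝ → ℝ) (h : ℕ → ℝ)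
    (R : MixingRegime) {m : ℕ} (x : Fin m → ℝ) : Prop where
  measurable_X : ∀ t, Measurable (X t)
  measurable_ε : ∀ t, Measurable (ε t)
  stationary : StrictlyStationary μ (fun t ω => (X t ω, ε t ω))
  integrable_ε : ∀ t, Integrable (ε t) μ
  condExp_ε : ∀ t, μ[ε t | MeasurableSpace.comap (X t) inferInstance] =ᵐ[μ] 0
  regime : R.Admissible
  bandwidth : BandwidthCondition h R
  kernel : KernelCondition K
  grid : ∀ i, x i ∈ interiorSupport μ X
  density_pos : ∀ i, DensityPositiveNear μ X (x i)

/-- The case `l = 0`: one regression function `φ`. -/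
structure NoChange (μ : Measure Ω) (X ε : ℕ → Ω → ℝ) (K : ℝ → ℝ) (h : ℕ → ℝ)
    (R : MixingRegime) {m : ℕ} (x : Fin m → ℝ) (φ : ℝ → ℝ) : Prop where
  common : CommonAssumptions μ X ε K h R x
  measurable_φ : Measurable φ
  mixing : MixesAtRate μ X (fun _ => response φ X ε) R
  density : DensityCondition μ X (response φ X ε) R
  moment : MomentCondition μ X (response φ X ε)

/-- The case `l = 1`: the regression function changes from `φ₁` to `φ₂` after time `⌊θ n⌋`.
The density and moment conditions hold for each of the two stationary regimes. -/
structure OneChange (μ : Measure Ω) (X ε : ℕ → Ω → ℝ) (K : ℝ → ℝ) (h : ℕ → ℝ)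
    (R : MixingRegime) {m : ℕ} (x : Fin m → ℝ) (δ : ℝ) (φ₁ φ₂ : ℝ → ℝ) (θ : ℝ) : Prop where
  common : CommonAssumptions μ X ε K h R x
  measurable_φ₁ : Measurable φ₁
  measurable_φ₂ : Measurable φ₂
  bounded_φ₁ : ∃ C : ℝ, ∀ u, |φ₁ u| ≤ C
  bounded_φ₂ : ∃ C : ℝ, ∀ u, |φ₂ u| ≤ C
  mixing : MixesAtRate μ X (changeArray φ₁ φ₂ X ε θ) R
  density₁ : DensityCondition μ X (response φ₁ X ε) R
  density₂ : DensityCondition μ X (response φ₂ X ε) R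
  moment₁ : MomentCondition μ X (response φ₁ X ε)
  moment₂ : MomentCondition μ X (response φ₂ X ε)
  le_θ : δ ≤ θ
  θ_le : θ ≤ 1 - δ
  grid_change : ∃ i, x i ∈ changeRegion φ₁ φ₂

end NWChange

end

open NWChange

/-! Everything rests on one probabilistic fact. At a grid point, the sums of K_h(X_s - x) and of Y_s
K_h(X_s - x) over stretches beginning right after time 0 or right after the change time k stay
within a constant times n r_n of their means, where r_n = log² n / √(n h_n) is `devRate`. This holds
almost surely for all large n, simultaneously for all end times t.

The fact is proved without coupling to independent blocks. Strong mixing makes the conditional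
expectation of a bounded future variable L¹-close to its mean
(`AlphaBound.integral_abs_condExp_sub_le`). An exponential supermartingale whose compensator is
built from such conditional expectations (`integral_exp_sum_sub_condExp_le_one`) then gives a
Bernstein-type tail, with the compensator replaced by means and variances at a cost of order `J *
a`. It is applied to every second block of length p of order √(n h_n), so that the blocks used
together are separated by a gap of length p. The variance of a block needs summable covariances.
Hölder's inequality against F^(t) or G^(t) bounds the covariances by a power of h alone, mixing
bounds them by h⁻² log² n times a decaying function of the lag, and a geometric mean of the two
(`le_interpolation`) is of the order of the variance log² n / h times a summable function of the
lag. A union bound over t and Borel-Cantelli finish the argument (`ae_eventually_abs_sum_Ioc_le`).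
Unbounded responses are truncated at a multiple of log n, which eventually changes no observation
and shifts the means negligibly.

The rest is deterministic. The densities in the denominators are bounded below, so the difference of
the two estimators at time t is Λ_h(x_i) times an explicit factor `jumpFactor`, up to O(r_n). Hence
the CUSUM statistic is t(n-t)/n² times `jumpFactor`² times S_n = ∑ Λ_h(x_i)², up to O(r_n √S_n +
r_n²) (`abs_cusum_sub_le`). Without a change S_n = 0, and only r_n² = log⁴ n / (n h_n) remains. With
a change, the value at k is θ(1-θ) S_n up to O(r_n), which exceeds the threshold. The population
curve falls off at least linearly from its peak at k (`mul_abs_sub_le_popCusum`), so a maximizer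
satisfies |k̂ - k|/n = O(r_n/√S_n + r_n²/S_n). Consistency thus needs only r_n²/S_n → 0. This
follows from a nonempty threshold window, which forces S_n to be at least a multiple of r_n, and
from a separated change, which keeps S_n away from zero. -/

namespace NWChange

section

variable {Ω : Type*} {m0 : MeasurableSpace Ω} {μ : Measure Ω}

/-! ### Strong mixing of two σ-algebras -/

/-- The strong mixing coefficient of the σ-algebras `m₁` and `m₂` is at most `a`. -/
def AlphaBound (μ : Measure Ω) (m₁ m₂ : MeasurableSpace Ω) (a : ℝ) : Prop :=
  ∀ A B : Set Ω, MeasurableSet[m₁] A → MeasurableSet[m₂] B →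
    |μ.real (A ∩ B) - μ.real A * μ.real B| ≤ a

lemma AlphaBound.mono {m₁ m₂ m₁' m₂' : MeasurableSpace Ω} {a a' : ℝ} (H : AlphaBound μ m₁ m₂ a)
    (h₁ : m₁' ≤ m₁) (h₂ : m₂' ≤ m₂) (h : a ≤ a') : AlphaBound μ m₁' m₂' a' :=
  fun A B hA hB => (H A B (h₁ _ hA) (h₂ _ hB)).trans h

/-- The variable E[V|m] - EV is centred, so its positive and negative parts have equal integrals and
its L¹ norm is twice the integral over the set where it is nonnegative. On that set the conditional
expectation may be replaced by V. -/
lemma exists_integral_abs_condExp_sub_le [IsProbabilityMeasure μ] {m : MeasurableSpace Ω}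
    (hm : m ≤ m0) {V : Ω → ℝ} (hV : Integrable V μ) :
    ∃ A, MeasurableSet[m] A ∧
      ∫ ω, |(μ[V|m]) ω - ∫ ω, V ω ∂μ| ∂μ ≤ 2 * |∫ ω in A, V ω ∂μ - μ.real A * ∫ ω, V ω ∂μ| := by
  set c := ∫ ω, V ω ∂μ with hc
  set η : Ω → ℝ := fun ω => (μ[V|m]) ω - c with hη
  have hηm : StronglyMeasurable[m] η := stronglyMeasurable_condExp.sub stronglyMeasurable_const
  have hηi : Integrable η μ := integrable_condExp.sub (integrable_const c)
  have h0 : ∫ ω, η ω ∂μ = 0 := by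
    simp only [hη]
    rw [integral_sub integrable_condExp (integrable_const c), integral_condExp hm]
    simp [hc]
  set A : Set Ω := {ω | 0 ≤ η ω} with hA
  have hAm : MeasurableSet[m] A := hηm.measurable measurableSet_Ici
  have hAm0 : MeasurableSet[m0] A := hm _ hAm
  refine ⟨A, hAm, ?_⟩
  have h1 : ∫ ω in A, η ω ∂μ + ∫ ω in Aᶜ, η ω ∂μ = 0 := by
    rw [integral_add_compl hAm0 hηi, h0]
  have h2 : ∫ ω, |η ω| ∂μ = ∫ ω in A, η ω ∂μ - ∫ ω in Aᶜ, η ω ∂μ := by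
    rw [← integral_add_compl hAm0 hηi.abs, sub_eq_add_neg, ← integral_neg]
    congr 1
    · exact setIntegral_congr_fun hAm0 fun ω hω => abs_of_nonneg hω
    · exact setIntegral_congr_fun hAm0.compl fun ω hω =>
        abs_of_nonpos (le_of_lt (not_le.mp hω))
  have h3 : ∫ ω in A, η ω ∂μ = ∫ ω in A, V ω ∂μ - μ.real A * c := by
    simp only [hη]
    rw [integral_sub integrable_condExp.integrableOn (integrable_const c).integrableOn,
      setIntegral_condExp hm hV hAm]
    simp
  rw [h2, show ∫ ω in Aᶜ, η ω ∂μ = -∫ ω in A, η ω ∂μ by linarith, h3]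
  have := le_abs_self (∫ ω in A, V ω ∂μ - μ.real A * c)
  linarith

lemma integral_mul_eq_integral_mul_condExp {m : MeasurableSpace Ω} [IsFiniteMeasure μ]
    (hm : m ≤ m0) {G V : Ω → ℝ} {c : ℝ} (hG : StronglyMeasurable[m] G) (hGc : ∀ᵐ ω ∂μ, |G ω| ≤ c)
    (hV : Integrable V μ) : ∫ ω, G ω * V ω ∂μ = ∫ ω, G ω * (μ[V|m]) ω ∂μ := by
  have hGV : Integrable (G * V) μ :=
    hV.bdd_mul (hG.mono hm).aestronglyMeasurable hGc
  have := condExp_mul_of_stronglyMeasurable_left hG hGV hV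
  calc ∫ ω, G ω * V ω ∂μ = ∫ ω, (μ[G * V|m]) ω ∂μ := (integral_condExp hm).symm
    _ = _ := integral_congr_ae this

/-- Two uses of `exists_integral_abs_condExp_sub_le` turn functions into sets. The first replaces
the conditional expectation of V by an event A of `m₁`, the second replaces the indicator of A,
conditioned on `m₂`, by an event B of `m₂`. Each costs a factor 2. -/
lemma AlphaBound.integral_abs_condExp_sub_le [IsProbabilityMeasure μ] {m₁ m₂ : MeasurableSpace Ω}
    (hm₁ : m₁ ≤ m0) (hm₂ : m₂ ≤ m0) {a c : ℝ} (H : AlphaBound μ m₁ m₂ a) {V : Ω → ℝ}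
    (hV : StronglyMeasurable[m₂] V) (hVc : ∀ ω, |V ω| ≤ c) :
    ∫ ω, |(μ[V|m₁]) ω - ∫ ω, V ω ∂μ| ∂μ ≤ 4 * c * a := by
  have hVi : Integrable V μ :=
    .of_bound (hV.mono hm₂).aestronglyMeasurable c (ae_of_all _ hVc)
  obtain ⟨ω₀⟩ : Nonempty Ω := μ.nonempty_of_neZero
  have hc : 0 ≤ c := (abs_nonneg _).trans (hVc ω₀)
  obtain ⟨A, hA, h1⟩ := exists_integral_abs_condExp_sub_le hm₁ hVi
  set U : Ω → ℝ := A.indicator fun _ => (1 : ℝ) with hU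
  have hUi : Integrable U μ := (integrable_const 1).indicator (hm₁ _ hA)
  have hUint : ∫ ω, U ω ∂μ = μ.real A := by
    simp [hU, integral_indicator (hm₁ _ hA)]
  obtain ⟨B, hB, h2⟩ := exists_integral_abs_condExp_sub_le hm₂ hUi
  rw [hUint] at h2
  have h3 : ∫ ω in B, U ω ∂μ = μ.real (A ∩ B) := by
    rw [hU, integral_indicator (hm₁ _ hA), Measure.restrict_restrict (hm₁ _ hA)]
    simp
  have h4 : ∫ ω, |(μ[U|m₂]) ω - μ.real A| ∂μ ≤ 2 * a := by
    refine h2.trans ?_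
    rw [h3, mul_comm (μ.real B)]
    linarith [H A B hA hB]
  have h5 : ∫ ω in A, V ω ∂μ = ∫ ω, V ω * (μ[U|m₂]) ω ∂μ := by
    rw [← integral_mul_eq_integral_mul_condExp hm₂ hV (ae_of_all _ hVc) hUi,
      ← integral_indicator (hm₁ _ hA)]
    congr 1; ext ω; by_cases h : ω ∈ A <;> simp [hU, h]
  have h6 : ∫ ω in A, V ω ∂μ - μ.real A * ∫ ω, V ω ∂μ
      = ∫ ω, V ω * ((μ[U|m₂]) ω - μ.real A) ∂μ := by
    rw [h5, ← integral_const_mul, ← integral_sub]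
    · congr 1; ext ω; ring
    · exact integrable_condExp.bdd_mul (hV.mono hm₂).aestronglyMeasurable (ae_of_all _ hVc)
    · exact hVi.const_mul _
  have h7 : |∫ ω in A, V ω ∂μ - μ.real A * ∫ ω, V ω ∂μ| ≤ c * (2 * a) := by
    rw [h6]
    calc |∫ ω, V ω * ((μ[U|m₂]) ω - μ.real A) ∂μ|
        ≤ ∫ ω, |V ω * ((μ[U|m₂]) ω - μ.real A)| ∂μ := abs_integral_le_integral_abs
      _ ≤ ∫ ω, c * |(μ[U|m₂]) ω - μ.real A| ∂μ := by
          refine integral_mono_of_nonneg (ae_of_all _ fun _ => abs_nonneg _)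
            ((integrable_condExp.sub (integrable_const _)).abs.const_mul c) (ae_of_all _ fun ω => ?_)
          simp only [abs_mul]
          exact mul_le_mul_of_nonneg_right (hVc ω) (abs_nonneg _)
      _ = c * ∫ ω, |(μ[U|m₂]) ω - μ.real A| ∂μ := integral_const_mul _ _
      _ ≤ _ := mul_le_mul_of_nonneg_left h4 hc
  linarith

lemma AlphaBound.abs_integral_mul_sub_le [IsProbabilityMeasure μ] {m₁ m₂ : MeasurableSpace Ω}
    (hm₁ : m₁ ≤ m0) (hm₂ : m₂ ≤ m0) {a c₁ c₂ : ℝ} (H : AlphaBound μ m₁ m₂ a) {U V : Ω → ℝ}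
    (hU : StronglyMeasurable[m₁] U) (hUc : ∀ ω, |U ω| ≤ c₁)
    (hV : StronglyMeasurable[m₂] V) (hVc : ∀ ω, |V ω| ≤ c₂) :
    |∫ ω, U ω * V ω ∂μ - (∫ ω, U ω ∂μ) * ∫ ω, V ω ∂μ| ≤ 4 * c₁ * c₂ * a := by
  obtain ⟨ω₀⟩ : Nonempty Ω := μ.nonempty_of_neZero
  have hc : 0 ≤ c₁ := (abs_nonneg _).trans (hUc ω₀)
  have hVi : Integrable V μ :=
    .of_bound (hV.mono hm₂).aestronglyMeasurable c₂ (ae_of_all _ hVc)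
  have hUi : Integrable U μ :=
    .of_bound (hU.mono hm₁).aestronglyMeasurable c₁ (ae_of_all _ hUc)
  have h6 : ∫ ω, U ω * V ω ∂μ - (∫ ω, U ω ∂μ) * ∫ ω, V ω ∂μ
      = ∫ ω, U ω * ((μ[V|m₁]) ω - ∫ ω, V ω ∂μ) ∂μ := by
    rw [integral_mul_eq_integral_mul_condExp hm₁ hU (ae_of_all _ hUc) hVi, ← integral_mul_const,
      ← integral_sub]
    · congr 1; ext ω; ring
    · exact integrable_condExp.bdd_mul (hU.mono hm₁).aestronglyMeasurable (ae_of_all _ hUc)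
    · exact hUi.mul_const _
  rw [h6]
  calc |∫ ω, U ω * ((μ[V|m₁]) ω - ∫ ω, V ω ∂μ) ∂μ|
      ≤ ∫ ω, |U ω * ((μ[V|m₁]) ω - ∫ ω, V ω ∂μ)| ∂μ := abs_integral_le_integral_abs
    _ ≤ ∫ ω, c₁ * |(μ[V|m₁]) ω - ∫ ω, V ω ∂μ| ∂μ := by
        refine integral_mono_of_nonneg (ae_of_all _ fun _ => abs_nonneg _)
          ((integrable_condExp.sub (integrable_const _)).abs.const_mul c₁) (ae_of_all _ fun ω => ?_)
        simp only [abs_mul]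
        exact mul_le_mul_of_nonneg_right (hUc ω) (abs_nonneg _)
    _ = c₁ * ∫ ω, |(μ[V|m₁]) ω - ∫ ω, V ω ∂μ| ∂μ := integral_const_mul _ _
    _ ≤ c₁ * (4 * c₂ * a) :=
        mul_le_mul_of_nonneg_left (H.integral_abs_condExp_sub_le hm₁ hm₂ hV hVc) hc
    _ = _ := by ring

/-! ### An exponential inequality for adapted sequences -/

lemma exp_le_one_add_add_sq {v : ℝ} (hv : |v| ≤ 1) : Real.exp v ≤ 1 + v + v ^ 2 := by
  have := (abs_le.mp (Real.abs_exp_sub_one_sub_id_le hv)).2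
  linarith

/-- Since |V| ≤ 1, E[e^V | m] ≤ 1 + E[V|m] + E[V²|m] ≤ exp(E[V|m] + E[V²|m]). Subtracting both
conditional expectations in the exponent therefore produces a supermartingale, whatever the
dependence. -/
lemma integral_exp_sum_sub_condExp_le_one [IsProbabilityMeasure μ] {m : ℕ → MeasurableSpace Ω}
    (hm : ∀ i, m i ≤ m0) (hmono : Monotone m) {V : ℕ → Ω → ℝ}
    (hV : ∀ i, StronglyMeasurable[m (i + 1)] (V i)) (hV1 : ∀ i ω, |V i ω| ≤ 1) (J : ℕ) :
    ∫ ω, Real.exp (∑ i ∈ Finset.range J,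
      (V i ω - (μ[V i|m i]) ω - (μ[fun ω => V i ω ^ 2|m i]) ω)) ∂μ ≤ 1 := by
  set D : ℕ → Ω → ℝ := fun i ω => V i ω - (μ[V i|m i]) ω - (μ[fun ω => V i ω ^ 2|m i]) ω with hD
  have hDm : ∀ i, StronglyMeasurable[m (i + 1)] (D i) := fun i =>
    ((hV i).sub (stronglyMeasurable_condExp.mono (hmono i.le_succ))).sub
      (stronglyMeasurable_condExp.mono (hmono i.le_succ))
  have hVi : ∀ i, Integrable (V i) μ := fun i =>
    .of_bound ((hV i).mono (hm _)).aestronglyMeasurable 1 (ae_of_all _ (hV1 i))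
  have hV2m : ∀ i, StronglyMeasurable[m (i + 1)] (fun ω => V i ω ^ 2) := fun i => (hV i).pow 2
  have hV2b : ∀ i ω, |V i ω ^ 2| ≤ 1 := fun i ω => by
    rw [abs_pow]; exact pow_le_one₀ (abs_nonneg _) (hV1 i ω)
  have hV2i : ∀ i, Integrable (fun ω => V i ω ^ 2) μ := fun i =>
    .of_bound ((hV2m i).mono (hm _)).aestronglyMeasurable 1 (ae_of_all _ (hV2b i))
  have hA : ∀ i, ∀ᵐ ω ∂μ, |(μ[V i|m i]) ω| ≤ 1 := fun i => by
    exact ae_bdd_abs_condExp_of_ae_bdd_abs (m := m i) (R := (1 : ℝ)) (μ := μ) (f := V i)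
      (ae_of_all _ (hV1 i))
  have hB : ∀ i, ∀ᵐ ω ∂μ, |(μ[fun ω => V i ω ^ 2|m i]) ω| ≤ 1 := fun i => by
    exact ae_bdd_abs_condExp_of_ae_bdd_abs (m := m i) (R := (1 : ℝ)) (μ := μ)
      (f := fun ω => V i ω ^ 2) (ae_of_all _ (hV2b i))
  have hDb : ∀ᵐ ω ∂μ, ∀ i, |D i ω| ≤ 3 := by
    rw [ae_all_iff]; intro i
    filter_upwards [hA i, hB i] with ω h1 h2
    have h3 := hV1 i ω
    rw [abs_le] at h1 h2 h3 ⊢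
    simp only [hD]
    constructor <;> linarith [h1.1, h1.2, h2.1, h2.2, h3.1, h3.2]
  have hsm : ∀ J, StronglyMeasurable[m J] (fun ω => ∑ i ∈ Finset.range J, D i ω) := fun J =>
    Finset.stronglyMeasurable_fun_sum _ fun i hi =>
      (hDm i).mono (hmono (Finset.mem_range.mp hi))
  have hsb : ∀ J, ∀ᵐ ω ∂μ, |∑ i ∈ Finset.range J, D i ω| ≤ 3 * J := fun J => by
    filter_upwards [hDb] with ω h
    calc |∑ i ∈ Finset.range J, D i ω| ≤ ∑ i ∈ Finset.range J, |D i ω| :=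
          Finset.abs_sum_le_sum_abs _ _
      _ ≤ ∑ i ∈ Finset.range J, 3 := Finset.sum_le_sum fun i _ => h i
      _ = 3 * J := by simp [mul_comm]
  induction J with
  | zero => simp
  | succ J ih =>
    refine le_trans ?_ ih
    set W : Ω → ℝ := fun ω => Real.exp (∑ i ∈ Finset.range J, D i ω) with hW
    have hWm : StronglyMeasurable[m J] W :=
      Real.continuous_exp.comp_stronglyMeasurable (hsm J)
    set A := μ[V J|m J] with hAdef
    set B := μ[fun ω => V J ω ^ 2|m J] with hBdef
    -- The factor of the new exponential that is already known at stage J. It is bounded and `m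
    -- J`-measurable, so V and V² next to it may be replaced by their conditional expectations.
    set G : Ω → ℝ := fun ω => W ω * Real.exp (-(A ω + B ω)) with hG
    have hGm : StronglyMeasurable[m J] G :=
      hWm.mul (Real.continuous_exp.comp_stronglyMeasurable
        (stronglyMeasurable_condExp.add stronglyMeasurable_condExp).neg)
    have hGb : ∀ᵐ ω ∂μ, |G ω| ≤ Real.exp (3 * J) * Real.exp 2 := by
      filter_upwards [hsb J, hA J, hB J] with ω h1 h2 h3
      simp only [hG, hW, abs_mul, Real.abs_exp]
      have h1' := (abs_le.mp h1).2
      have h2' := (abs_le.mp h2).1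
      have h3' := (abs_le.mp h3).1
      gcongr
      linarith
    have hGi : Integrable G μ := .of_bound (hGm.mono (hm _)).aestronglyMeasurable _ hGb
    have hGV : Integrable (fun ω => G ω * V J ω) μ :=
      (hVi J).bdd_mul (hGm.mono (hm _)).aestronglyMeasurable hGb
    have hGV2 : Integrable (fun ω => G ω * V J ω ^ 2) μ :=
      (hV2i J).bdd_mul (hGm.mono (hm _)).aestronglyMeasurable hGb
    have hGA : Integrable (fun ω => G ω * A ω) μ :=
      integrable_condExp.bdd_mul (hGm.mono (hm _)).aestronglyMeasurable hGb
    have hGB : Integrable (fun ω => G ω * B ω) μ :=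
      integrable_condExp.bdd_mul (hGm.mono (hm _)).aestronglyMeasurable hGb
    have hWi : Integrable W μ := by
      refine .of_bound (hWm.mono (hm _)).aestronglyMeasurable (Real.exp (3 * J)) ?_
      filter_upwards [hsb J] with ω h1
      simp only [hW, Real.norm_eq_abs, Real.abs_exp]
      exact Real.exp_le_exp.mpr (abs_le.mp h1).2
    have hs1 : Integrable (fun ω => G ω + G ω * V J ω) μ := hGi.add hGV
    have hs2 : Integrable (fun ω => G ω + G ω * A ω) μ := hGi.add hGA
    calc ∫ ω, Real.exp (∑ i ∈ Finset.range (J + 1), D i ω) ∂μ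
        ≤ ∫ ω, (G ω + G ω * V J ω + G ω * V J ω ^ 2) ∂μ := by
          refine integral_mono_of_nonneg (ae_of_all _ fun _ => (Real.exp_pos _).le)
            ((hGi.add hGV).add hGV2) (ae_of_all _ fun ω => ?_)
          have hGpos : 0 ≤ G ω := (mul_pos (Real.exp_pos _) (Real.exp_pos _)).le
          have : Real.exp (∑ i ∈ Finset.range (J + 1), D i ω) = G ω * Real.exp (V J ω) := by
            simp only [hG, hW, ← Real.exp_add, Finset.sum_range_succ]
            congr 1; simp only [hD]; ring
          simp only [this]
          calc G ω * Real.exp (V J ω) ≤ G ω * (1 + V J ω + V J ω ^ 2) :=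
                mul_le_mul_of_nonneg_left (exp_le_one_add_add_sq (hV1 J ω)) hGpos
            _ = _ := by ring
      _ = ∫ ω, (G ω + G ω * A ω + G ω * B ω) ∂μ := by
          rw [integral_add hs1 hGV2, integral_add hGi hGV,
            integral_add hs2 hGB, integral_add hGi hGA,
            integral_mul_eq_integral_mul_condExp (hm J) hGm hGb (hVi J),
            integral_mul_eq_integral_mul_condExp (hm J) hGm hGb (hV2i J)]
      _ ≤ ∫ ω, W ω ∂μ := by
          refine integral_mono ((hGi.add hGA).add hGB) hWi fun ω => ?_
          have hWpos : 0 < W ω := Real.exp_pos _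
          have h1 := Real.add_one_le_exp (A ω + B ω)
          calc G ω + G ω * A ω + G ω * B ω = G ω * (A ω + B ω + 1) := by ring
            _ ≤ G ω * Real.exp (A ω + B ω) :=
                mul_le_mul_of_nonneg_left h1 (mul_pos (Real.exp_pos _) (Real.exp_pos _)).le
            _ = W ω := by
                simp only [hG]
                rw [mul_assoc, ← Real.exp_add, neg_add_cancel, Real.exp_zero, mul_one]

end

section

variable {Ω : Type*} {m0 : MeasurableSpace Ω} {μ : Measure Ω}

/-- Markov's inequality is used three times: for the supermartingale at level e^x, and for the total
L¹ deviations of the two compensators from their means at level 1. Off these events the compensators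
contribute at most 2 + Jv. Mixing enters only through the compensators, at most 4a for each one and
each step. -/
lemma measureReal_sum_gt_le [IsProbabilityMeasure μ] {m m' : ℕ → MeasurableSpace Ω}
    (hm : ∀ i, m i ≤ m0) (hm' : ∀ i, m' i ≤ m0) (hmono : Monotone m) {V : ℕ → Ω → ℝ}
    (hV : ∀ i, StronglyMeasurable[m (i + 1)] (V i)) (hV' : ∀ i, StronglyMeasurable[m' i] (V i))
    (hV1 : ∀ i ω, |V i ω| ≤ 1) {a v : ℝ} (hα : ∀ i, AlphaBound μ (m i) (m' i) a)
    (hV0 : ∀ i, ∫ ω, V i ω ∂μ = 0) (hv : ∀ i, ∫ ω, V i ω ^ 2 ∂μ ≤ v) (J : ℕ) (x : ℝ) :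
    μ.real {ω | x + 2 + J * v < ∑ i ∈ Finset.range J, V i ω} ≤ Real.exp (-x) + 8 * (J * a) := by
  set A : ℕ → Ω → ℝ := fun i => μ[V i|m i] with hA
  set B : ℕ → Ω → ℝ := fun i => μ[fun ω => V i ω ^ 2|m i] with hB
  set E := fun ω => Real.exp (∑ i ∈ Finset.range J, (V i ω - A i ω - B i ω)) with hE
  set SA := fun ω => ∑ i ∈ Finset.range J, |A i ω - ∫ ω, V i ω ∂μ| with hSA
  set SB := fun ω => ∑ i ∈ Finset.range J, |B i ω - ∫ ω, V i ω ^ 2 ∂μ| with hSB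
  have hAi : ∀ i, Integrable (fun ω => |A i ω - ∫ ω, V i ω ∂μ|) μ := fun i =>
    (integrable_condExp.sub (integrable_const _)).abs
  have hBi : ∀ i, Integrable (fun ω => |B i ω - ∫ ω, V i ω ^ 2 ∂μ|) μ := fun i =>
    (integrable_condExp.sub (integrable_const _)).abs
  have hSAi : ∫ ω, SA ω ∂μ ≤ 4 * (J * a) := by
    simp only [hSA]
    rw [integral_finsetSum _ fun i _ => hAi i]
    calc _ ≤ ∑ i ∈ Finset.range J, 4 * 1 * a := Finset.sum_le_sum fun i _ =>
          (hα i).integral_abs_condExp_sub_le (hm i) (hm' i) (hV' i) (hV1 i)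
      _ = _ := by simp; ring
  have hSBi : ∫ ω, SB ω ∂μ ≤ 4 * (J * a) := by
    simp only [hSB]
    rw [integral_finsetSum _ fun i _ => hBi i]
    calc _ ≤ ∑ i ∈ Finset.range J, 4 * 1 * a := Finset.sum_le_sum fun i _ =>
          (hα i).integral_abs_condExp_sub_le (hm i) (hm' i) ((hV' i).pow 2) fun ω => by
            rw [Pi.pow_apply, abs_pow]; exact pow_le_one₀ (abs_nonneg _) (hV1 i ω)
      _ = _ := by simp; ring
  have hEint : ∫ ω, E ω ∂μ ≤ 1 := integral_exp_sum_sub_condExp_le_one hm hmono hV hV1 J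
  have hEi : Integrable E μ := by
    by_contra hcon
    have hEm : AEStronglyMeasurable E μ := by
      refine Real.continuous_exp.comp_aestronglyMeasurable ?_
      refine Finset.aestronglyMeasurable_fun_sum _ fun i _ => ?_
      exact (((hV i).mono (hm _)).aestronglyMeasurable.sub
        integrable_condExp.aestronglyMeasurable).sub integrable_condExp.aestronglyMeasurable
    refine hcon (.of_bound hEm (Real.exp (3 * J)) ?_)
    have hAb : ∀ᵐ ω ∂μ, ∀ i, |A i ω| ≤ 1 := ae_all_iff.mpr fun i =>
      ae_bdd_abs_condExp_of_ae_bdd_abs (ae_of_all _ (hV1 i))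
    have hBb : ∀ᵐ ω ∂μ, ∀ i, |B i ω| ≤ 1 := ae_all_iff.mpr fun i =>
      ae_bdd_abs_condExp_of_ae_bdd_abs (ae_of_all _ fun ω => by
        rw [abs_pow]; exact pow_le_one₀ (abs_nonneg _) (hV1 i ω))
    filter_upwards [hAb, hBb] with ω h1 h2
    simp only [hE, Real.norm_eq_abs, Real.abs_exp]
    refine Real.exp_le_exp.mpr ?_
    calc _ ≤ ∑ i ∈ Finset.range J, (3 : ℝ) := Finset.sum_le_sum fun i _ => by
          linarith [(abs_le.mp (h1 i)).1, (abs_le.mp (h2 i)).1, (abs_le.mp (hV1 i ω)).2]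
      _ = 3 * J := by simp [mul_comm]
  have t1 : μ.real {ω | Real.exp x ≤ E ω} ≤ Real.exp (-x) := by
    have := mul_meas_ge_le_integral_of_nonneg (ae_of_all μ fun ω => (Real.exp_pos _).le) hEi
      (Real.exp x)
    rw [Real.exp_neg, ← one_div, le_div_iff₀ (Real.exp_pos _), mul_comm]
    exact this.trans hEint
  have t2 : μ.real {ω | 1 ≤ SA ω} ≤ 4 * (J * a) := by
    have := mul_meas_ge_le_integral_of_nonneg
      (ae_of_all μ fun ω => Finset.sum_nonneg fun i _ => abs_nonneg _)
      (integrable_finsetSum (Finset.range J) fun i _ => hAi i) 1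
    rw [one_mul] at this
    exact this.trans hSAi
  have t3 : μ.real {ω | 1 ≤ SB ω} ≤ 4 * (J * a) := by
    have := mul_meas_ge_le_integral_of_nonneg
      (ae_of_all μ fun ω => Finset.sum_nonneg fun i _ => abs_nonneg _)
      (integrable_finsetSum (Finset.range J) fun i _ => hBi i) 1
    rw [one_mul] at this
    exact this.trans hSBi
  have hsub : {ω | x + 2 + J * v < ∑ i ∈ Finset.range J, V i ω} ⊆
      {ω | Real.exp x ≤ E ω} ∪ ({ω | 1 ≤ SA ω} ∪ {ω | 1 ≤ SB ω}) := by
    intro ω hω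
    by_contra hcon
    simp only [Set.mem_union, Set.mem_ofPred_eq, not_or, not_le, hE, Real.exp_lt_exp] at hcon hω
    obtain ⟨h1, h2, h3⟩ := hcon
    rw [Finset.sum_sub_distrib, Finset.sum_sub_distrib] at h1
    have hA' : ∑ i ∈ Finset.range J, A i ω ≤ SA ω := Finset.sum_le_sum fun i _ => by
      rw [hV0, sub_zero]; exact le_abs_self _
    have hB' : ∑ i ∈ Finset.range J, B i ω ≤ SB ω + J * v := by
      calc _ ≤ ∑ i ∈ Finset.range J, (|B i ω - ∫ ω, V i ω ^ 2 ∂μ| + v) :=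
            Finset.sum_le_sum fun i _ => by
              linarith [le_abs_self (B i ω - ∫ ω, V i ω ^ 2 ∂μ), hv i]
        _ = _ := by rw [Finset.sum_add_distrib]; simp [hSB]
    linarith
  calc _ ≤ μ.real ({ω | Real.exp x ≤ E ω} ∪ ({ω | 1 ≤ SA ω} ∪ {ω | 1 ≤ SB ω})) :=
        measureReal_mono hsub
    _ ≤ _ := (measureReal_union_le _ _).trans (add_le_add_right (measureReal_union_le _ _) _)
    _ ≤ _ := by linarith

/-! ### A deviation inequality for sums over alternating blocks -/

/-- The sum over the `k`-th block of length `p`, covering the times `k p + 1, …, k p + p`. -/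
def blockSum (ζ : ℕ → Ω → ℝ) (p k : ℕ) (ω : Ω) : ℝ := ∑ r ∈ Finset.range p, ζ (k * p + r + 1) ω

/-- With an odd number of blocks and block 0 set aside, the remaining blocks split into two classes
of equal size, in each of which neighbours are separated by a full block. -/
lemma sum_range_eq_sum_blockSum (ζ : ℕ → Ω → ℝ) (p J : ℕ) (ω : Ω) :
    ∑ s ∈ Finset.range ((2 * J + 1) * p), ζ (s + 1) ω = blockSum ζ p 0 ω +
      (∑ i ∈ Finset.range J, blockSum ζ p (2 * i + 1) ω +
        ∑ i ∈ Finset.range J, blockSum ζ p (2 * i + 2) ω) := by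
  induction J with
  | zero => simp [blockSum]
  | succ J ih =>
    rw [show (2 * (J + 1) + 1) * p = (2 * J + 1) * p + p + p by ring, Finset.sum_range_add,
      Finset.sum_range_add, ih, Finset.sum_range_succ _ J, Finset.sum_range_succ _ J]
    have : (2 * J + 2) * p = (2 * J + 1) * p + p := by ring
    simp only [blockSum, this]
    ring

lemma abs_blockSum_le {ζ : ℕ → Ω → ℝ} {b : ℝ} (hb : ∀ s ω, |ζ s ω| ≤ b) (p k : ℕ) (ω : Ω) :
    |blockSum ζ p k ω| ≤ p * b := by
  calc |blockSum ζ p k ω| ≤ ∑ r ∈ Finset.range p, |ζ (k * p + r + 1) ω| :=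
        Finset.abs_sum_le_sum_abs _ _
    _ ≤ ∑ r ∈ Finset.range p, b := Finset.sum_le_sum fun _ _ => hb _ _
    _ = p * b := by simp

/-- Each class of blocks, normalised by its sup bound `p * b`, falls under `measureReal_sum_gt_le`.
The constant 5 is 2 for each class plus 1 for block 0, which is bounded trivially. -/
lemma measureReal_sum_gt_le_of_blocks [IsProbabilityMeasure μ] {past future : ℕ → MeasurableSpace Ω}
    (hpast : ∀ i, past i ≤ m0) (hfuture : ∀ i, future i ≤ m0) (hpm : Monotone past)
    (hfm : Antitone future) {ζ : ℕ → Ω → ℝ} (hζp : ∀ s, StronglyMeasurable[past s] (ζ s))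
    (hζf : ∀ s, StronglyMeasurable[future s] (ζ s)) {b : ℝ} (hb0 : 0 < b)
    (hb : ∀ s ω, |ζ s ω| ≤ b) (h0 : ∀ s, ∫ ω, ζ s ω ∂μ = 0) {p : ℕ} (hp : 0 < p) {a v : ℝ}
    (hα : ∀ j, AlphaBound μ (past j) (future (j + p + 1)) a)
    (hv : ∀ k, ∫ ω, blockSum ζ p k ω ^ 2 ∂μ ≤ v) (J : ℕ) (x : ℝ) :
    μ.real {ω | p * b * (2 * x + 5 + 2 * (J * (v / (p * b) ^ 2))) <
      ∑ s ∈ Finset.range ((2 * J + 1) * p), ζ (s + 1) ω} ≤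
        2 * (Real.exp (-x) + 8 * (J * a)) := by
  have hpb : 0 < p * b := by positivity
  have hζi : ∀ s, Integrable (ζ s) μ := fun s =>
    .of_bound ((hζp s).mono (hpast s)).aestronglyMeasurable b (ae_of_all _ (hb s))
  -- The offsets o = 0 and o = 1 give the two classes. The preceding block of a class ends at time
  -- (2i+o)p and the next one starts at (2i+o)p + p + 1, so the relevant lag is p + 1.
  have key : ∀ o : ℕ, μ.real {ω | x + 2 + J * (v / (p * b) ^ 2) <
      ∑ i ∈ Finset.range J, blockSum ζ p (2 * i + o + 1) ω / (p * b)} ≤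
        Real.exp (-x) + 8 * (J * a) := by
    intro o
    refine measureReal_sum_gt_le (m := fun i => past ((2 * i + o) * p))
      (m' := fun i => future ((2 * i + o) * p + p + 1)) (fun _ => hpast _) (fun _ => hfuture _)
      (fun i j hij => hpm (by gcongr)) (fun i => ?_) (fun i => ?_) (fun i ω => ?_)
      (fun i => hα _) (fun i => ?_) (fun i => ?_) J x
    · simp only [div_eq_mul_inv]
      refine StronglyMeasurable.mul_const (Finset.stronglyMeasurable_fun_sum _ fun r hr => ?_) _
      refine (hζp _).mono (hpm ?_)
      have := Finset.mem_range.mp hr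
      have e : (2 * (i + 1) + o) * p = (2 * i + o + 1) * p + p := by ring
      omega
    · simp only [div_eq_mul_inv]
      refine StronglyMeasurable.mul_const (Finset.stronglyMeasurable_fun_sum _ fun r hr => ?_) _
      refine (hζf _).mono (hfm ?_)
      have e : (2 * i + o + 1) * p = (2 * i + o) * p + p := by ring
      omega
    · rw [abs_div, abs_of_pos hpb, div_le_one hpb]
      exact abs_blockSum_le hb _ _ _
    · rw [integral_div]
      simp only [blockSum]
      rw [integral_finsetSum _ fun s _ => hζi _]
      simp [h0]
    · simp only [div_pow]
      rw [integral_div]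
      exact div_le_div_of_nonneg_right (hv _) (by positivity)
  have hsub : {ω | p * b * (2 * x + 5 + 2 * (J * (v / (p * b) ^ 2))) <
      ∑ s ∈ Finset.range ((2 * J + 1) * p), ζ (s + 1) ω} ⊆
      {ω | x + 2 + J * (v / (p * b) ^ 2) <
        ∑ i ∈ Finset.range J, blockSum ζ p (2 * i + 0 + 1) ω / (p * b)} ∪
      {ω | x + 2 + J * (v / (p * b) ^ 2) <
        ∑ i ∈ Finset.range J, blockSum ζ p (2 * i + 1 + 1) ω / (p * b)} := by
    intro ω hω
    by_contra hcon
    simp only [Set.mem_union, Set.mem_ofPred_eq, not_or, not_lt, ← Finset.sum_div] at hcon hω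
    obtain ⟨h1, h2⟩ := hcon
    rw [div_le_iff₀ hpb] at h1 h2
    rw [sum_range_eq_sum_blockSum] at hω
    have h3 := (abs_le.mp (abs_blockSum_le hb p 0 ω)).2
    simp only [add_zero, add_assoc, one_add_one_eq_two] at h1 h2 hω
    linarith
  calc _ ≤ _ := measureReal_mono hsub
    _ ≤ _ := measureReal_union_le _ _
    _ ≤ _ := by linarith [key 0, key 1]

lemma measureReal_abs_sum_gt_le_of_blocks [IsProbabilityMeasure μ]
    {past future : ℕ → MeasurableSpace Ω}
    (hpast : ∀ i, past i ≤ m0) (hfuture : ∀ i, future i ≤ m0) (hpm : Monotone past)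
    (hfm : Antitone future) {ζ : ℕ → Ω → ℝ} (hζp : ∀ s, StronglyMeasurable[past s] (ζ s))
    (hζf : ∀ s, StronglyMeasurable[future s] (ζ s)) {b : ℝ} (hb0 : 0 < b)
    (hb : ∀ s ω, |ζ s ω| ≤ b) (h0 : ∀ s, ∫ ω, ζ s ω ∂μ = 0) {p : ℕ} (hp : 0 < p) {a v : ℝ}
    (hα : ∀ j, AlphaBound μ (past j) (future (j + p + 1)) a)
    (hv : ∀ k, ∫ ω, blockSum ζ p k ω ^ 2 ∂μ ≤ v) (J : ℕ) (x : ℝ) :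
    μ.real {ω | p * b * (2 * x + 5 + 2 * (J * (v / (p * b) ^ 2))) <
      |∑ s ∈ Finset.range ((2 * J + 1) * p), ζ (s + 1) ω|} ≤
        4 * (Real.exp (-x) + 8 * (J * a)) := by
  have k1 := measureReal_sum_gt_le_of_blocks hpast hfuture hpm hfm hζp hζf hb0 hb h0 hp hα hv J x
  have k2 := measureReal_sum_gt_le_of_blocks hpast hfuture hpm hfm (ζ := fun s ω => -ζ s ω)
    (fun s => (hζp s).neg) (fun s => (hζf s).neg) hb0 (fun s ω => by simpa using hb s ω)
    (fun s => by rw [integral_neg, h0, neg_zero]) hp hα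
    (fun k => by simpa [blockSum, Finset.sum_neg_distrib] using hv k) J x
  have hsub : {ω | p * b * (2 * x + 5 + 2 * (J * (v / (p * b) ^ 2))) <
      |∑ s ∈ Finset.range ((2 * J + 1) * p), ζ (s + 1) ω|} ⊆
      {ω | p * b * (2 * x + 5 + 2 * (J * (v / (p * b) ^ 2))) <
      ∑ s ∈ Finset.range ((2 * J + 1) * p), ζ (s + 1) ω} ∪
      {ω | p * b * (2 * x + 5 + 2 * (J * (v / (p * b) ^ 2))) <
      ∑ s ∈ Finset.range ((2 * J + 1) * p), -ζ (s + 1) ω} := by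
    intro ω hω
    simpa only [Set.mem_union, Set.mem_ofPred_eq, Finset.sum_neg_distrib, ← lt_abs] using hω
  calc _ ≤ _ := measureReal_mono hsub
    _ ≤ _ := measureReal_union_le _ _
    _ ≤ _ := by linarith

/-! ### The variance of a block -/

/-- In the expanded square, each row of covariances consists of the lags to the left and those to
the right of the diagonal, and each of the two families sums to at most D. -/
lemma integral_sq_sum_le {ζ : ℕ → Ω → ℝ} {c : ℕ → ℝ} (hc0 : ∀ d, 0 ≤ c d) {D : ℝ} {p : ℕ}
    (hD : ∑ d ∈ Finset.range p, c d ≤ D) {a : ℕ}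
    (hi : ∀ s t, Integrable (fun ω => ζ s ω * ζ t ω) μ)
    (hc : ∀ s d, |∫ ω, ζ s ω * ζ (s + d) ω ∂μ| ≤ c d) :
    ∫ ω, (∑ r ∈ Finset.range p, ζ (a + r) ω) ^ 2 ∂μ ≤ 2 * p * D := by
  -- In truncated subtraction one of the two differences vanishes, so their sum is the distance of s
  -- and t.
  have hc' : ∀ s t, ∫ ω, ζ s ω * ζ t ω ∂μ ≤ c ((t - s) + (s - t)) := by
    intro s t
    refine (le_abs_self _).trans ?_
    rcases le_total s t with h | h
    · obtain ⟨d, rfl⟩ := Nat.exists_eq_add_of_le h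
      simpa using hc s d
    · obtain ⟨d, rfl⟩ := Nat.exists_eq_add_of_le h
      simpa [mul_comm (ζ (t + d) _)] using hc t d
  have hsub : ∀ q ≤ p, ∑ d ∈ Finset.range q, c d ≤ D := fun q hq =>
    (Finset.sum_le_sum_of_subset_of_nonneg (Finset.range_subset_range.mpr hq)
      fun _ _ _ => hc0 _).trans hD
  have e1 : ∀ r ∈ Finset.range p, ∑ r' ∈ Finset.range p, c ((r' - r) + (r - r')) ≤ 2 * D := by
    intro r hr
    obtain ⟨q, hq⟩ := Nat.exists_eq_add_of_le (Nat.succ_le_of_lt (Finset.mem_range.mp hr))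
    rw [hq, Finset.sum_range_add]
    have h1 : ∑ r' ∈ Finset.range (r + 1), c ((r' - r) + (r - r')) ≤ D := by
      rw [← Finset.sum_range_reflect]
      refine le_trans (Finset.sum_le_sum fun j hj => ?_) (hsub (r + 1) (by omega))
      have := Finset.mem_range.mp hj
      exact le_of_eq (congrArg c (by omega))
    have h2 : ∑ r' ∈ Finset.range q, c ((r + 1 + r' - r) + (r - (r + 1 + r'))) ≤ D := by
      refine le_trans ?_ (hsub (q + 1) (by omega))
      rw [Finset.sum_range_succ']
      refine le_add_of_le_of_nonneg (Finset.sum_le_sum fun j hj => ?_) (hc0 _)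
      exact le_of_eq (congrArg c (by omega))
    simp only [Nat.succ_eq_add_one] at *
    linarith
  calc ∫ ω, (∑ r ∈ Finset.range p, ζ (a + r) ω) ^ 2 ∂μ
      = ∑ r ∈ Finset.range p, ∑ r' ∈ Finset.range p, ∫ ω, ζ (a + r) ω * ζ (a + r') ω ∂μ := by
        simp only [sq, Finset.sum_mul_sum]
        rw [integral_finsetSum _ fun i _ => integrable_finsetSum _ fun j _ => hi _ _]
        exact Finset.sum_congr rfl fun i _ => integral_finsetSum _ fun j _ => hi _ _
    _ ≤ ∑ r ∈ Finset.range p, ∑ r' ∈ Finset.range p, c ((r' - r) + (r - r')) :=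
        Finset.sum_le_sum fun i _ => Finset.sum_le_sum fun j _ =>
          (hc' _ _).trans (le_of_eq (congrArg c (by omega)))
    _ ≤ ∑ r ∈ Finset.range p, 2 * D := Finset.sum_le_sum e1
    _ = 2 * p * D := by simp; ring

end

section

variable {Ω : Type*} [m0 : MeasurableSpace Ω] {μ : Measure Ω} {E : Type*} [MeasurableSpace E]

/-! ### Mixing coefficients of a stretch of variables -/

lemma sigmaOf_le {W : ℕ → Ω → E} (hW : ∀ s, Measurable (W s)) (I : Set ℕ) : sigmaOf W I ≤ m0 :=
  iSup₂_le fun s _ => (hW s).comap_le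

lemma sigmaOf_mono {Ω : Type*} (W : ℕ → Ω → E) {I I' : Set ℕ} (h : I ⊆ I') : sigmaOf W I ≤ sigmaOf W I' :=
  biSup_mono fun _ hs => h hs

lemma measurable_sigmaOf {Ω : Type*} (W : ℕ → Ω → E) {I : Set ℕ} {s : ℕ} (hs : s ∈ I) :
    Measurable[sigmaOf W I] (W s) :=
  measurable_iff_comap_le.mpr (le_iSup₂ (f := fun s (_ : s ∈ I) =>
    MeasurableSpace.comap (W s) inferInstance) s hs)

lemma mixingCoeff_nonneg (W : ℕ → Ω → E) (n τ : ℕ) : 0 ≤ mixingCoeff μ W n τ :=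
  Real.sSup_nonneg (by rintro _ ⟨_, _, _, _, _, _, _, rfl⟩; exact abs_nonneg _)

lemma abs_measureReal_inter_sub_le_one [IsProbabilityMeasure μ] (A B : Set Ω) :
    |μ.real (A ∩ B) - μ.real A * μ.real B| ≤ 1 := by
  have h1 : μ.real (A ∩ B) ≤ 1 := measureReal_le_one
  have h2 : μ.real A * μ.real B ≤ 1 :=
    mul_le_one₀ measureReal_le_one measureReal_nonneg measureReal_le_one
  have h3 : 0 ≤ μ.real A * μ.real B := mul_nonneg measureReal_nonneg measureReal_nonneg
  have h4 : 0 ≤ μ.real (A ∩ B) := measureReal_nonneg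
  rw [abs_le]; constructor <;> linarith

/-- The supremum in `mixingCoeff` runs only over 1 ≤ j with j + τ ≤ n. For every other j one of the
two σ-algebras is trivial and the difference is zero. -/
lemma alphaBound_mixingCoeff [IsProbabilityMeasure μ] (W : ℕ → Ω → E) (n j τ : ℕ) :
    AlphaBound μ (sigmaOf W (Set.Icc 1 j)) (sigmaOf W (Set.Icc (j + τ) n))
      (mixingCoeff μ W n τ) := by
  intro A B hA hB
  by_cases hj : 1 ≤ j
  · by_cases hn : j + τ ≤ n
    -- Boundedness must be supplied, since the real `sSup` of an unbounded set would be the default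
    -- value 0.
    · refine le_csSup ⟨1, ?_⟩ ⟨j, hj, hn, A, B, hA, hB, rfl⟩
      rintro _ ⟨_, _, _, _, _, _, _, rfl⟩
      exact abs_measureReal_inter_sub_le_one _ _
    · rw [sigmaOf, Set.Icc_eq_empty hn, iSup_emptyset, MeasurableSpace.measurableSet_bot_iff] at hB
      rcases hB with rfl | rfl <;> simpa using mixingCoeff_nonneg W n τ
  · rw [sigmaOf, Set.Icc_eq_empty (by omega), iSup_emptyset,
      MeasurableSpace.measurableSet_bot_iff] at hA
    rcases hA with rfl | rfl <;> simpa using mixingCoeff_nonneg W n τ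

/-! ### Deviations of a stretch of a stationary sequence -/

lemma abs_integral_centered_le [IsProbabilityMeasure μ] {W : ℕ → Ω → E}
    (hW : ∀ s, Measurable (W s)) {n : ℕ} {q : E → ℝ} (hq : Measurable q) {B mq : ℝ}
    (hB : ∀ z, |q z - mq| ≤ B) {s d : ℕ} (hs : 1 ≤ s) (hn : s + d ≤ n)
    (hms : ∫ ω, q (W s ω) ∂μ = mq) :
    |∫ ω, (q (W s ω) - mq) * (q (W (s + d) ω) - mq) ∂μ| ≤ 4 * B * B * mixingCoeff μ W n d := by
  have hqm : Measurable fun z => q z - mq := hq.sub_const _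
  have h1 : Measurable[sigmaOf W (Set.Icc 1 s)] (fun ω => q (W s ω) - mq) :=
    hqm.comp (measurable_sigmaOf W ⟨hs, le_rfl⟩)
  have h2 : Measurable[sigmaOf W (Set.Icc (s + d) n)] (fun ω => q (W (s + d) ω) - mq) :=
    hqm.comp (measurable_sigmaOf W ⟨le_rfl, hn⟩)
  have h := (alphaBound_mixingCoeff (μ := μ) W n s d).abs_integral_mul_sub_le
    (sigmaOf_le hW _) (sigmaOf_le hW _) h1.stronglyMeasurable (fun ω => hB _)
    h2.stronglyMeasurable (fun ω => hB _)
  have hi : Integrable (fun ω => q (W s ω)) μ := by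
    have : Integrable (fun ω => q (W s ω) - mq) μ :=
      .of_bound (hqm.comp (hW s)).aestronglyMeasurable B (ae_of_all _ fun ω => hB _)
    exact (this.add (integrable_const mq)).congr (ae_of_all _ fun ω => sub_add_cancel _ _)
  have h3 : ∫ ω, (q (W s ω) - mq) ∂μ = 0 := by
    rw [integral_sub hi (integrable_const _), hms]; simp
  rwa [h3, zero_mul, sub_zero] at h

lemma sum_range_ite_mem_Ioc (f : ℕ → ℝ) {a t N : ℕ} (h : t ≤ N) :
    ∑ s ∈ Finset.range N, (if s + 1 ∈ Finset.Ioc a t then f (s + 1) else 0) =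
      ∑ s ∈ Finset.Ioc a t, f s := by
  rw [← Finset.sum_filter]
  refine Finset.sum_nbij (· + 1) (fun s hs => (Finset.mem_filter.mp hs).2)
    (fun s _ t _ hst => Nat.succ_injective hst) (fun s hs => ?_) (fun _ _ => rfl)
  have h1 := Finset.mem_Ioc.mp (Finset.mem_coe.mp hs)
  refine ⟨s - 1, ?_, by simp only []; omega⟩
  simp only [Finset.coe_filter, Finset.mem_range, Finset.mem_Ioc, Set.mem_ofPred_eq]
  omega

/-- Mixing is known for the row W of the triangular array, expectations for the stationary sequence
Z, and the two agree on (a, t]. Setting the summands to zero elsewhere keeps them centred, bounded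
and measurable, so one block layout of the whole sample serves every stretch. -/
lemma measureReal_abs_sum_Ioc_gt_le [IsProbabilityMeasure μ] {Z W : ℕ → Ω → E}
    (hZ : ∀ s, Measurable (Z s)) (hW : ∀ s, Measurable (W s)) {n a t : ℕ} (htn : t ≤ n)
    (hWZ : ∀ s ∈ Finset.Ioc a t, W s = Z s) {q : E → ℝ} (hq : Measurable q) {B mq : ℝ}
    (hB0 : 0 < B) (hB : ∀ z, |q z - mq| ≤ B) (hmq : ∀ s, ∫ ω, q (Z s ω) ∂μ = mq)
    {p J : ℕ} (hp : 0 < p) (hJ : n ≤ (2 * J + 1) * p) {c : ℕ → ℝ} (hc0 : ∀ d, 0 ≤ c d) {D α : ℝ}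
    (hD : ∑ d ∈ Finset.range p, c d ≤ D) (hα : mixingCoeff μ W n (p + 1) ≤ α)
    (hc : ∀ s d, a < s → s + d ≤ t →
      |∫ ω, (q (Z s ω) - mq) * (q (Z (s + d) ω) - mq) ∂μ| ≤ c d) (x : ℝ) :
    μ.real {ω | p * B * (2 * x + 5 + 2 * (J * (2 * p * D / (p * B) ^ 2))) <
      |∑ s ∈ Finset.Ioc a t, (q (Z s ω) - mq)|} ≤ 4 * (Real.exp (-x) + 8 * (J * α)) := by
  set ζ : ℕ → Ω → ℝ := fun s ω => if s ∈ Finset.Ioc a t then q (Z s ω) - mq else 0 with hζ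
  have hqm : Measurable fun z => q z - mq := hq.sub_const _
  have hζm : ∀ (m : MeasurableSpace Ω) (s : ℕ), (s ∈ Finset.Ioc a t → Measurable[m] (W s)) →
      StronglyMeasurable[m] (ζ s) := by
    intro m s hs
    by_cases h : s ∈ Finset.Ioc a t
    · simp only [hζ, if_pos h, ← hWZ s h]
      exact (hqm.comp (hs h)).stronglyMeasurable
    · simp only [hζ, if_neg h]
      exact stronglyMeasurable_const
  have hζb : ∀ s ω, |ζ s ω| ≤ B := by
    intro s ω
    by_cases h : s ∈ Finset.Ioc a t
    · simp only [hζ, if_pos h]; exact hB _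
    · simp only [hζ, if_neg h, abs_zero]; exact hB0.le
  have hζ0 : ∀ s, ∫ ω, ζ s ω ∂μ = 0 := by
    intro s
    by_cases h : s ∈ Finset.Ioc a t
    · simp only [hζ, if_pos h]
      have hi : Integrable (fun ω => q (Z s ω)) μ := by
        have : Integrable (fun ω => q (Z s ω) - mq) μ :=
          .of_bound (hqm.comp (hZ s)).aestronglyMeasurable B (ae_of_all _ fun ω => hB _)
        exact (this.add (integrable_const mq)).congr (ae_of_all _ fun ω => sub_add_cancel _ _)
      rw [integral_sub hi (integrable_const _), hmq]; simp
    · simp only [hζ, if_neg h, integral_zero]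
  have hζi : ∀ s t, Integrable (fun ω => ζ s ω * ζ t ω) μ := by
    intro s t
    have h1 := (hζm m0 s fun _ => hW s).aestronglyMeasurable (μ := μ)
    have h2 := (hζm m0 t fun _ => hW t).aestronglyMeasurable (μ := μ)
    exact (Integrable.of_bound h2 B (ae_of_all _ (hζb t))).bdd_mul h1 (ae_of_all _ (hζb s))
  have hζc : ∀ s d, |∫ ω, ζ s ω * ζ (s + d) ω ∂μ| ≤ c d := by
    intro s d
    by_cases h : s ∈ Finset.Ioc a t ∧ s + d ∈ Finset.Ioc a t
    · simp only [hζ, if_pos h.1, if_pos h.2]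
      exact hc s d (Finset.mem_Ioc.mp h.1).1 (Finset.mem_Ioc.mp h.2).2
    · have : ∀ ω, ζ s ω * ζ (s + d) ω = 0 := fun ω => by
        rcases not_and_or.mp h with h | h <;> simp only [hζ, if_neg h, zero_mul, mul_zero]
      simpa [this] using hc0 d
  have hmem : ∀ {s : ℕ}, s ∈ Finset.Ioc a t → a < s ∧ s ≤ t := Finset.mem_Ioc.mp
  have main := measureReal_abs_sum_gt_le_of_blocks (μ := μ)
    (past := fun j => sigmaOf W (Set.Icc 1 j)) (future := fun j => sigmaOf W (Set.Icc j n))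
    (fun _ => sigmaOf_le hW _) (fun _ => sigmaOf_le hW _)
    (fun i j hij => sigmaOf_mono W (Set.Icc_subset_Icc_right hij))
    (fun i j hij => sigmaOf_mono W (Set.Icc_subset_Icc_left hij)) (ζ := ζ)
    (fun s => hζm _ s fun hs => measurable_sigmaOf W ⟨by have := hmem hs; omega, le_rfl⟩)
    (fun s => hζm _ s fun hs => measurable_sigmaOf W ⟨le_rfl, (hmem hs).2.trans htn⟩)
    hB0 hζb hζ0 hp (fun j => (alphaBound_mixingCoeff W n j (p + 1)).mono le_rfl le_rfl hα)
    (v := 2 * p * D) (fun k => ?_) J x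
  · have e : ∀ ω, ∑ s ∈ Finset.range ((2 * J + 1) * p), ζ (s + 1) ω =
        ∑ s ∈ Finset.Ioc a t, (q (Z s ω) - mq) := fun ω =>
      sum_range_ite_mem_Ioc (fun s => q (Z s ω) - mq) (htn.trans hJ)
    simpa only [e] using main
  · have := integral_sq_sum_le (μ := μ) hc0 hD (a := k * p + 1) hζi hζc
    simpa only [blockSum, add_right_comm] using this

end

section

variable {Ω : Type*} [m0 : MeasurableSpace Ω] {μ : Measure Ω} {E : Type*} [MeasurableSpace E]

/-! ### Almost sure uniform deviations of triangular arrays -/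

lemma ae_eventually_notMem_of_summable [IsFiniteMeasure μ] {s : ℕ → Set Ω} {b : ℕ → ℝ}
    (hb : Summable b) (hs : ∀ᶠ n in atTop, μ.real (s n) ≤ b n) :
    ∀ᵐ ω ∂μ, ∀ᶠ n in atTop, ω ∉ s n := by
  refine ae_eventually_notMem ?_
  have h1 : Summable fun n => μ.real (s n) :=
    Summable.of_norm_bounded_eventually_nat hb (by
      filter_upwards [hs] with n hn
      rwa [Real.norm_eq_abs, abs_of_nonneg measureReal_nonneg])
  have h2 : ∀ n, μ (s n) = ENNReal.ofReal (μ.real (s n)) := fun n => by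
    rw [ofReal_measureReal]
  simp only [h2]
  rw [← ENNReal.ofReal_tsum_of_nonneg (fun _ => measureReal_nonneg) h1]
  exact ENNReal.ofReal_ne_top

/-- Take the weighted geometric mean of the two bounds with weight κ = β/(1+β). This weight makes
the powers of h combine to (1-β)(1-κ) + 2κ = 1, the order of the variance. The lag exponent γκ
exceeds 1 exactly when β(γ-1) > 1. -/
lemma le_interpolation {x A h d β γ : ℝ} (hx : 0 ≤ x) (hA : 0 < A) (hh : 0 < h) (hd : 0 < d)
    (hβ : 0 < β) (h1 : x ≤ A * h ^ (-(1 - β))) (h2 : x ≤ A * h ^ (-2 : ℝ) * d ^ (-γ)) :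
    x ≤ A * h⁻¹ * d ^ (-(γ * (β / (1 + β)))) := by
  set κ := β / (1 + β) with hκ
  have hκ0 : 0 < κ := by positivity
  have hκ1 : κ < 1 := by rw [hκ, div_lt_one (by positivity)]; linarith
  rcases hx.eq_or_lt with rfl | hx
  · positivity
  calc x = x ^ (1 - κ) * x ^ κ := by rw [← Real.rpow_add hx]; simp
    _ ≤ (A * h ^ (-(1 - β))) ^ (1 - κ) * (A * h ^ (-2 : ℝ) * d ^ (-γ)) ^ κ := by
        gcongr
    _ = (A ^ (1 - κ) * A ^ κ) * (h ^ (-(1 - β) * (1 - κ)) * h ^ (-2 * κ)) * d ^ (-γ * κ) := by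
        rw [Real.mul_rpow hA.le (by positivity), Real.mul_rpow (by positivity) (by positivity),
          Real.mul_rpow hA.le (by positivity), ← Real.rpow_mul hh.le, ← Real.rpow_mul hh.le,
          ← Real.rpow_mul hd.le]
        ring
    _ = A * h⁻¹ * d ^ (-(γ * κ)) := by
        rw [← Real.rpow_add hA, ← Real.rpow_add hh, ← Real.rpow_neg_one h]
        congr 2
        · simp
        · congr 1
          rw [hκ]; field_simp; ring
        · ring

lemma summable_ite_rpow {r : ℝ} (hr : 1 < r) :
    Summable fun d : ℕ => if d = 0 then (1 : ℝ) else (d : ℝ) ^ (-r) := by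
  refine (Real.summable_nat_rpow.mpr (show -r < -1 by linarith)).congr_cofinite ?_
  rw [Filter.EventuallyEq, Nat.cofinite_eq_atTop]
  filter_upwards [eventually_gt_atTop 0] with d hd
  rw [if_neg hd.ne']

/-- The size of the deviations of the kernel sums over a sample of size `n`, divided by `n`. -/
noncomputable def devRate (h : ℕ → ℝ) (n : ℕ) : ℝ := Real.log n ^ 2 / Real.sqrt (n * h n)

/-- The constants of a polynomial mixing rate and a bandwidth `h_n ≃ n^{-w}` that are compatible. -/
structure RateSetup (h : ℕ → ℝ) (γ w c₁ c₂ : ℝ) : Prop where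
  w_pos : 0 < w
  w_lt_one : w < 1
  c₁_pos : 0 < c₁
  c₂_pos : 0 < c₂
  le_h : ∀ᶠ n : ℕ in atTop, c₁ * (n : ℝ) ^ (-w) ≤ h n
  h_le : ∀ᶠ n : ℕ in atTop, h n ≤ c₂ * (n : ℝ) ^ (-w)
  six_lt : 6 < (1 - w) * (γ + 1)

namespace RateSetup

variable {h : ℕ → ℝ} {γ w c₁ c₂ : ℝ}

lemma γ_pos (H : RateSetup h γ w c₁ c₂) : 0 < γ := by
  have := H.six_lt; have := H.w_pos; have := H.w_lt_one
  nlinarith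

lemma h_pos (H : RateSetup h γ w c₁ c₂) : ∀ᶠ n in atTop, 0 < h n := by
  filter_upwards [H.le_h, eventually_gt_atTop 0] with n h1 hn
  have := H.c₁_pos
  have hn' : (0 : ℝ) < n := by exact_mod_cast hn
  exact lt_of_lt_of_le (by positivity) h1

lemma tendsto_h (H : RateSetup h γ w c₁ c₂) : Tendsto h atTop (𝓝 0) := by
  have h1 : Tendsto (fun n : ℕ => c₂ * (n : ℝ) ^ (-w)) atTop (𝓝 0) := by
    simpa using ((tendsto_rpow_neg_atTop H.w_pos).comp tendsto_natCast_atTop_atTop).const_mul c₂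
  exact tendsto_of_tendsto_of_tendsto_of_le_of_le' tendsto_const_nhds h1
    (H.h_pos.mono fun _ h => h.le) H.h_le

lemma mul_h_bounds (H : RateSetup h γ w c₁ c₂) : ∀ᶠ n : ℕ in atTop,
    c₁ * (n : ℝ) ^ (1 - w) ≤ n * h n ∧ n * h n ≤ c₂ * (n : ℝ) ^ (1 - w) := by
  filter_upwards [H.le_h, H.h_le, eventually_gt_atTop 0] with n h1 h2 hn
  have hn' : (0 : ℝ) < n := by exact_mod_cast hn
  have e : (n : ℝ) ^ (1 - w) = n * (n : ℝ) ^ (-w) := by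
    rw [sub_eq_add_neg, Real.rpow_add hn', Real.rpow_one]
  rw [e]
  constructor <;> nlinarith

lemma tendsto_devRate (H : RateSetup h γ w c₁ c₂) : Tendsto (devRate h) atTop (𝓝 0) := by
  have hσ : 0 < (1 - w) / 2 := by linarith [H.w_lt_one]
  have h1 : Tendsto (fun n : ℕ => (1 / Real.sqrt c₁) * (Real.log n ^ (2 : ℝ) /
      (n : ℝ) ^ ((1 - w) / 2))) atTop (𝓝 0) := by
    have := (isLittleO_log_rpow_rpow_atTop 2 hσ).tendsto_div_nhds_zero
    simpa using (this.comp tendsto_natCast_atTop_atTop).const_mul (1 / Real.sqrt c₁)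
  refine tendsto_of_tendsto_of_tendsto_of_le_of_le' tendsto_const_nhds h1
    (Eventually.of_forall fun n => by unfold devRate; positivity) ?_
  filter_upwards [H.mul_h_bounds, eventually_gt_atTop 0] with n h2 hn
  have hn' : (0 : ℝ) < n := by exact_mod_cast hn
  have hc := H.c₁_pos
  have e : Real.sqrt c₁ * (n : ℝ) ^ ((1 - w) / 2) ≤ Real.sqrt (n * h n) := by
    refine le_trans (le_of_eq ?_) (Real.sqrt_le_sqrt h2.1)
    rw [Real.sqrt_mul hc.le, Real.sqrt_eq_rpow ((n : ℝ) ^ (1 - w)), ← Real.rpow_mul hn'.le]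
    ring_nf
  have : devRate h n ≤ Real.log n ^ 2 / (Real.sqrt c₁ * (n : ℝ) ^ ((1 - w) / 2)) := by
    unfold devRate; gcongr
  refine this.trans (le_of_eq ?_)
  rw [Real.rpow_two]; field_simp

end RateSetup

/-- With p of order √(nh), the total variance of the blocks is at most a constant times the square
of the bound pCL/h of a single block. The threshold is then of order (pL/h)·L, that is nL²/√(nh). -/
lemma blockThreshold_le {n h C T c₁ c₂ L P p J : ℝ} (hn : 0 < n) (hh : 0 < h) (hC : 0 < C)
    (hT : 0 ≤ T) (hc₁ : 0 < c₁) (hc₂ : 0 < c₂) (hL : 1 ≤ L) (hP : 0 < P)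
    (hPp : P ≤ p) (hpP : p ≤ 2 * P) (hJ : J ≤ n / p) (hnh₁ : c₁ * (P * P) ≤ n * h)
    (hnh₂ : n * h ≤ c₂ * (P * P)) :
    p * (C * (L / h)) * (2 * (3 * L) + 5 +
      2 * (J * (2 * p * (T * (L ^ 2 / h)) / (p * (C * (L / h))) ^ 2))) ≤
        C * (11 + 4 * T * c₂ / C ^ 2) * (2 / Real.sqrt c₁) *
          (n * (L ^ 2 / Real.sqrt (n * h))) := by
  have hp : 0 < p := hP.trans_le hPp
  have hsc : 0 < Real.sqrt c₁ := Real.sqrt_pos.mpr hc₁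
  have hsq : 0 < Real.sqrt (n * h) := Real.sqrt_pos.mpr (by positivity)
  have hsq2 : Real.sqrt (n * h) * Real.sqrt (n * h) = n * h := Real.mul_self_sqrt (by positivity)
  have e1 : J * (2 * p * (T * (L ^ 2 / h)) / (p * (C * (L / h))) ^ 2) ≤ 2 * T * c₂ / C ^ 2 := by
    have e2 : J * (2 * p * (T * (L ^ 2 / h)) / (p * (C * (L / h))) ^ 2) =
        2 * T / C ^ 2 * (J * h / p) := by
      have : L ≠ 0 := by positivity
      field_simp
    have e3 : J * h / p ≤ c₂ := by
      rw [div_le_iff₀ hp]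
      calc J * h ≤ n / p * h := by gcongr
        _ = n * h / p := by ring
        _ ≤ c₂ * (P * P) / p := by gcongr
        _ ≤ c₂ * (p * p) / p := by gcongr
        _ = c₂ * p := by field_simp
    rw [e2, mul_div_right_comm _ c₂]
    exact mul_le_mul_of_nonneg_left e3 (by positivity)
  have h0 : 0 ≤ 2 * T * c₂ / C ^ 2 := by positivity
  have e4 : P * Real.sqrt c₁ ≤ Real.sqrt (n * h) := by
    refine Real.le_sqrt_of_sq_le ?_
    rw [mul_pow, Real.sq_sqrt hc₁.le, sq, mul_comm]
    exact hnh₁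
  have e5 : p * L ^ 2 / h ≤ (2 / Real.sqrt c₁) * (n * (L ^ 2 / Real.sqrt (n * h))) := by
    calc p * L ^ 2 / h ≤ 2 * P * L ^ 2 / h := by gcongr
      _ = (2 / Real.sqrt c₁) * ((P * Real.sqrt c₁) * L ^ 2 / h) := by field_simp
      _ ≤ (2 / Real.sqrt c₁) * (Real.sqrt (n * h) * L ^ 2 / h) := by gcongr
      _ = _ := by
        congr 1
        rw [div_eq_iff hh.ne', mul_div_assoc', div_mul_eq_mul_div, eq_div_iff hsq.ne']
        linear_combination L ^ 2 * hsq2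
  -- The 6L is twice x = 3L; the constant terms are absorbed through L ≥ 1.
  calc _ ≤ p * (C * (L / h)) * (6 * L + 5 * L + 2 * (2 * T * c₂ / C ^ 2) * L) := by
        refine mul_le_mul_of_nonneg_left ?_ (by positivity)
        nlinarith
    _ = C * (11 + 4 * T * c₂ / C ^ 2) * (p * L ^ 2 / h) := by ring
    _ ≤ C * (11 + 4 * T * c₂ / C ^ 2) * ((2 / Real.sqrt c₁) *
          (n * (L ^ 2 / Real.sqrt (n * h)))) :=
        mul_le_mul_of_nonneg_left e5 (by positivity)
    _ = _ := by ring

lemma blockProbability_le {n γ w C₁ p J : ℝ} (hn : 0 < n) (hC₁ : 0 < C₁) (hγ : 0 < γ)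
    (hPp : n ^ ((1 - w) / 2) ≤ p) (hJ : J ≤ n / p) :
    J * (C₁ * (p + 1) ^ (-γ)) ≤ C₁ * n ^ (1 - (1 - w) / 2 * (γ + 1)) := by
  have hP : 0 < n ^ ((1 - w) / 2) := by positivity
  have hp : 0 < p := hP.trans_le hPp
  calc J * (C₁ * (p + 1) ^ (-γ)) ≤ n / p * (C₁ * p ^ (-γ)) := by
        have : (p + 1) ^ (-γ) ≤ p ^ (-γ) :=
          Real.rpow_le_rpow_of_nonpos hp (by linarith) (by linarith)
        gcongr
    _ = C₁ * (n * p ^ (-(γ + 1))) := by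
        rw [show -(γ + 1) = -γ - 1 by ring, Real.rpow_sub_one hp.ne']; ring
    _ ≤ C₁ * (n * (n ^ ((1 - w) / 2)) ^ (-(γ + 1))) := by
        have : p ^ (-(γ + 1)) ≤ (n ^ ((1 - w) / 2)) ^ (-(γ + 1)) :=
          Real.rpow_le_rpow_of_nonpos hP hPp (by linarith)
        gcongr
    _ = _ := by
        rw [← Real.rpow_mul hn.le, sub_eq_add_neg 1 ((1 - w) / 2 * (γ + 1)), Real.rpow_add hn,
          Real.rpow_one]
        ring_nf

/-- The variance at lag 0 and the interpolated bound at positive lags are brought to a common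
constant. The factor L² comes from the sup bound CL/h in the mixing estimate and is harmlessly
inserted in the other bounds. -/
lemma lagCovariance_le {x C C₁ A L h β γ : ℝ} {d : ℕ} (hC : 0 < C) (hC₁ : 0 < C₁)
    (hA : A = C + 4 * C * C * C₁) (hL : 1 ≤ L) (hh : 0 < h) (hβ : 0 < β) (hx : 0 ≤ x)
    (h0 : d = 0 → x ≤ C / h) (h1 : 1 ≤ d → x ≤ C * h ^ (-(1 - β)))
    (h2 : 1 ≤ d → x ≤ 4 * (C * (L / h)) * (C * (L / h)) * (C₁ * (d : ℝ) ^ (-γ))) :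
    x ≤ A * (L ^ 2 / h) * if d = 0 then 1 else (d : ℝ) ^ (-(γ * (β / (1 + β)))) := by
  have hL2 : 1 ≤ L ^ 2 := one_le_pow₀ hL
  have hCC : 0 < 4 * C * C * C₁ := by positivity
  have hA0 : 0 < A := by linarith
  have hCA : C ≤ A * L ^ 2 := by nlinarith
  split_ifs with hd
  · refine (h0 hd).trans ?_
    rw [mul_one, mul_div_assoc']
    gcongr
  · have hd1 : 1 ≤ d := Nat.one_le_iff_ne_zero.mpr hd
    have hd' : (0 : ℝ) < d := by exact_mod_cast hd1
    refine (le_interpolation (A := A * L ^ 2) (γ := γ) hx (by positivity) hh hd' hβ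
      ((h1 hd1).trans (by gcongr)) ((h2 hd1).trans ?_)).trans
        (le_of_eq (by rw [div_eq_mul_inv (L ^ 2)]; ring))
    calc 4 * (C * (L / h)) * (C * (L / h)) * (C₁ * (d : ℝ) ^ (-γ))
        = (4 * C * C * C₁) * L ^ 2 * h ^ (-2 : ℝ) * (d : ℝ) ^ (-γ) := by
          rw [Real.rpow_neg hh.le, Real.rpow_two]; field_simp
      _ ≤ A * L ^ 2 * h ^ (-2 : ℝ) * (d : ℝ) ^ (-γ) := by
          gcongr; rw [hA]; linarith

/-- For a fixed end time the bad event has probability of order n⁻³ + n^(1-η) with η = (1-w)(γ+1)/2.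
A union over at most n + 1 end times costs a factor of order n, and the result is summable because η
> 3. -/
theorem ae_eventually_abs_sum_Ioc_le [IsProbabilityMeasure μ] {Z : ℕ → Ω → E}
    (hZ : ∀ s, Measurable (Z s)) {W : ℕ → ℕ → Ω → E} (hW : ∀ n s, Measurable (W n s))
    {a e : ℕ → ℕ} (he : ∀ n, e n ≤ n) (hWZ : ∀ n, ∀ s ∈ Finset.Ioc (a n) (e n), W n s = Z s)
    {C₁ γ : ℝ} (hC₁ : 0 < C₁)
    (hmix : ∀ n τ : ℕ, 1 ≤ τ → mixingCoeff μ (W n) n τ ≤ C₁ * (τ : ℝ) ^ (-γ))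
    {h : ℕ → ℝ} {w c₁ c₂ : ℝ} (H : RateSetup h γ w c₁ c₂) {β : ℝ} (hβ : 0 < β) (hβ1 : β < 1)
    (hβγ : 1 < β * (γ - 1)) {q : ℕ → E → ℝ} (hq : ∀ n, Measurable (q n)) {mq : ℕ → ℝ} {C : ℝ}
    (hC : 0 < C) (hmq : ∀ n s, ∫ ω, q n (Z s ω) ∂μ = mq n)
    (hqB : ∀ᶠ n : ℕ in atTop, ∀ z, |q n z - mq n| ≤ C * (Real.log n / h n))
    (hq2 : ∀ᶠ n : ℕ in atTop, ∀ s, ∫ ω, (q n (Z s ω) - mq n) * (q n (Z s ω) - mq n) ∂μ ≤ C / h n)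
    (hqc : ∀ᶠ n : ℕ in atTop, ∀ s d, 1 ≤ d →
      |∫ ω, (q n (Z s ω) - mq n) * (q n (Z (s + d) ω) - mq n) ∂μ| ≤ C * (h n) ^ (-(1 - β))) :
    ∃ C' : ℝ, 0 < C' ∧ ∀ᵐ ω ∂μ, ∀ᶠ n : ℕ in atTop, ∀ t ≤ e n,
      |∑ s ∈ Finset.Ioc (a n) t, (q n (Z s ω) - mq n)| ≤ C' * (n * devRate h n) := by
  set κ := β / (1 + β) with hκ
  have hγ := H.γ_pos
  have hγκ : 1 < γ * κ := by
    rw [hκ, mul_div_assoc', lt_div_iff₀ (by positivity)]; linarith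
  -- Lag 0 carries the variance and is given the weight 1 by hand, since the real power of 0 to a
  -- negative exponent is 0.
  set g : ℕ → ℝ := fun d => if d = 0 then (1 : ℝ) else (d : ℝ) ^ (-(γ * κ)) with hg
  have hgs : Summable g := summable_ite_rpow hγκ
  have hg0 : ∀ d, 0 ≤ g d := fun d => by simp only [hg]; split_ifs <;> positivity
  set S := ∑' d, g d with hS
  have hS0 : 0 ≤ S := tsum_nonneg hg0
  set A := C + 4 * C * C * C₁ with hA
  have hA0 : 0 < A := by positivity
  set Q := C * (11 + 4 * (A * S) * c₂ / C ^ 2) with hQ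
  have hc₁ := H.c₁_pos
  have hc₂ := H.c₂_pos
  have hQ0 : 0 < Q := by positivity
  set C' := Q * (2 / Real.sqrt c₁) with hC'
  refine ⟨C', by positivity, ?_⟩
  set η := (1 - w) / 2 * (γ + 1) with hη
  have hη3 : 3 < η := by have := H.six_lt; rw [hη]; linarith
  set bad : ℕ → ℕ → Set Ω := fun n t =>
    {ω | C' * (n * devRate h n) < |∑ s ∈ Finset.Ioc (a n) t, (q n (Z s ω) - mq n)|} with hbad
  have key : ∀ᶠ n : ℕ in atTop, ∀ t ≤ e n,
      μ.real (bad n t) ≤ 4 * ((n : ℝ) ^ (-3 : ℝ) + 8 * (C₁ * (n : ℝ) ^ (1 - η))) := by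
    filter_upwards [hqB, hq2, hqc, H.h_pos, H.mul_h_bounds, eventually_ge_atTop 3] with
      n hB h2 hc hh0 hnh hn3 t ht
    have hn0 : (0 : ℝ) < n := by positivity
    set L := Real.log n with hL
    have hL1 : 1 ≤ L := by
      rw [hL, Real.le_log_iff_exp_le hn0]
      have : (3 : ℝ) ≤ n := by exact_mod_cast hn3
      linarith [Real.exp_one_lt_d9]
    set P := (n : ℝ) ^ ((1 - w) / 2) with hP
    have hP1 : 1 ≤ P := Real.one_le_rpow (by exact_mod_cast (by omega : 1 ≤ n))
      (by linarith [H.w_lt_one])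
    have hPP : P * P = (n : ℝ) ^ (1 - w) := by
      rw [hP, ← Real.rpow_add hn0]; ring_nf
    -- P = n^((1-w)/2) is of order √(n h_n). Rounding up at most doubles it, because P ≥ 1.
    set p := ⌈P⌉₊ with hp
    have hPp : P ≤ p := Nat.le_ceil _
    have hpP : (p : ℝ) ≤ 2 * P := by
      have := (Nat.ceil_lt_add_one (by linarith : 0 ≤ P)).le
      linarith
    have hp0 : 0 < p := Nat.ceil_pos.mpr (by linarith)
    have hp0' : (0 : ℝ) < p := by exact_mod_cast hp0
    -- The 2J + 1 blocks may overshoot n by about a factor 2. This costs nothing, as the summands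
    -- beyond the stretch are zero.
    set J := n / p with hJ
    have hJn : n ≤ (2 * J + 1) * p := by
      have h1 := Nat.lt_div_mul_add (a := n) hp0
      have : n / p * p ≤ 2 * (n / p) * p := by gcongr; omega
      rw [hJ, add_mul, one_mul]; omega
    have hJle : (J : ℝ) ≤ n / p := Nat.cast_div_le
    have hBpos : 0 < C * (L / h n) := by positivity
    have main := measureReal_abs_sum_Ioc_gt_le (μ := μ) hZ (hW n) (ht.trans (he n))
      (fun s hs => hWZ n s (Finset.Ioc_subset_Ioc_right ht hs)) (hq n) hBpos hB (hmq n)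
      hp0 hJn (c := fun d => A * (L ^ 2 / h n) * g d) (fun d => by have := hg0 d; positivity)
      (D := A * S * (L ^ 2 / h n)) (α := C₁ * ((p + 1 : ℕ) : ℝ) ^ (-γ)) ?_
      (hmix n (p + 1) (by omega)) ?_ (3 * L)
    · refine le_trans (measureReal_mono ?_) (main.trans ?_)
      · intro ω hω
        refine lt_of_le_of_lt ?_ (show C' * (n * devRate h n) < _ from hω)
        exact blockThreshold_le hn0 hh0 hC (by positivity) hc₁ hc₂ hL1 (by linarith) hPp hpP hJle
          (by rw [hPP]; exact hnh.1) (by rw [hPP]; exact hnh.2)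
      · have e5 : Real.exp (-(3 * L)) = (n : ℝ) ^ (-3 : ℝ) := by
          rw [Real.rpow_def_of_pos hn0, ← hL]; ring_nf
        have e6 := blockProbability_le hn0 hC₁ hγ hPp hJle
        push_cast
        rw [e5]
        linarith
    · rw [← Finset.mul_sum]
      have : ∑ d ∈ Finset.range p, g d ≤ S := hgs.sum_le_tsum _ fun d _ => hg0 d
      calc A * (L ^ 2 / h n) * ∑ d ∈ Finset.range p, g d ≤ A * (L ^ 2 / h n) * S := by gcongr
        _ = _ := by ring
    · intro s d has hsd
      refine lagCovariance_le hC hC₁ hA hL1 hh0 hβ (abs_nonneg _) (fun hd => ?_) (hc s d)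
        (fun hd => ?_)
      · subst hd
        exact (abs_of_nonneg (integral_nonneg fun ω => mul_self_nonneg _)).trans_le (h2 s)
      · have h3 := abs_integral_centered_le (μ := μ) (hW n) (hq n) (mq := mq n) hB
          (s := s) (d := d) (n := n) (by omega) ((hsd.trans ht).trans (he n))
          (by rw [hWZ n s (Finset.mem_Ioc.mpr ⟨has, by omega⟩)]; exact hmq n s)
        rw [hWZ n s (Finset.mem_Ioc.mpr ⟨has, by omega⟩),
          hWZ n (s + d) (Finset.mem_Ioc.mpr ⟨by omega, by omega⟩)] at h3
        exact h3.trans (mul_le_mul_of_nonneg_left (hmix n d hd) (by positivity))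
  have hsum : Summable fun n : ℕ => 8 * (n : ℝ) ^ (-2 : ℝ) + 64 * C₁ * (n : ℝ) ^ (2 - η) :=
    ((Real.summable_nat_rpow.mpr (by norm_num)).mul_left _).add
      ((Real.summable_nat_rpow.mpr (by linarith)).mul_left _)
  have := ae_eventually_notMem_of_summable (μ := μ) (s := fun n =>
    ⋃ t ∈ Finset.range (e n + 1), bad n t) hsum (by
      filter_upwards [key, eventually_ge_atTop 1] with n hn hn1
      have hn0 : (0 : ℝ) < n := by positivity
      calc _ ≤ ∑ t ∈ Finset.range (e n + 1), μ.real (bad n t) := measureReal_biUnion_finset_le _ _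
        _ ≤ ∑ t ∈ Finset.range (e n + 1), 4 * ((n : ℝ) ^ (-3 : ℝ) + 8 * (C₁ * (n : ℝ) ^ (1 - η))) :=
            Finset.sum_le_sum fun t ht => hn t (by have := Finset.mem_range.mp ht; omega)
        _ = (e n + 1) * (4 * ((n : ℝ) ^ (-3 : ℝ) + 8 * (C₁ * (n : ℝ) ^ (1 - η)))) := by simp
        _ ≤ (2 * n) * (4 * ((n : ℝ) ^ (-3 : ℝ) + 8 * (C₁ * (n : ℝ) ^ (1 - η)))) := by
            have h1 : (e n : ℝ) ≤ n := by exact_mod_cast he n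
            have h2 : (1 : ℝ) ≤ n := by exact_mod_cast hn1
            gcongr
            linarith
        _ = 8 * ((n : ℝ) ^ (-3 : ℝ) * n) + 64 * C₁ * ((n : ℝ) ^ (1 - η) * n) := by ring
        _ = _ := by
            rw [← Real.rpow_add_one hn0.ne', ← Real.rpow_add_one hn0.ne']
            ring_nf)
  filter_upwards [this] with ω hω
  filter_upwards [hω] with n hn t ht
  simp only [Set.mem_iUnion, not_exists, hbad, Set.mem_ofPred_eq, not_lt] at hn
  exact hn t (Finset.mem_range.mpr (by omega))

end

section

/-! ### Bounded integrable kernels -/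

/-- Nonnegative integrable kernels that are bounded by `κ` everywhere. -/
structure BddKernel (K : ℝ → ℝ) (κ : ℝ) : Prop where
  measurable : Measurable K
  nonneg : ∀ u, 0 ≤ K u
  le : ∀ u, K u ≤ κ
  pos : 0 < κ
  integrable : Integrable K

/-- The kernel `K_h(· - x)`. -/
noncomputable def kernelAt (K : ℝ → ℝ) (h x u : ℝ) : ℝ := scaledKernel K h (u - x)

section kernel

variable {K : ℝ → ℝ} {κ h : ℝ}

lemma BddKernel.measurable_kernelAt (hK : BddKernel K κ) (h x : ℝ) :
    Measurable (kernelAt K h x) := by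
  unfold kernelAt scaledKernel
  exact (hK.measurable.comp ((measurable_id.sub_const x).div_const h)).const_mul _

lemma BddKernel.kernelAt_nonneg (hK : BddKernel K κ) (hh : 0 < h) (x u : ℝ) :
    0 ≤ kernelAt K h x u := by
  have := hK.nonneg ((u - x) / h)
  unfold kernelAt scaledKernel; positivity

lemma BddKernel.kernelAt_le (hK : BddKernel K κ) (hh : 0 < h) (x u : ℝ) :
    kernelAt K h x u ≤ κ / h := by
  unfold kernelAt scaledKernel
  rw [div_mul_eq_mul_div, one_mul]
  exact div_le_div_of_nonneg_right (hK.le _) hh.le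

lemma integral_kernelAt (K : ℝ → ℝ) (hh : 0 < h) (x : ℝ) :
    ∫ u, kernelAt K h x u = ∫ u, K u := by
  unfold kernelAt scaledKernel
  rw [integral_const_mul, integral_sub_right_eq_self (fun u => K (u / h)) x,
    Measure.integral_comp_div, abs_of_pos hh, smul_eq_mul]
  field_simp

lemma BddKernel.integrable_kernelAt (hK : BddKernel K κ) (hh : 0 < h) (x : ℝ) :
    Integrable (kernelAt K h x) := by
  unfold kernelAt scaledKernel
  exact ((hK.integrable.comp_div hh.ne').comp_sub_right x).const_mul _

lemma BddKernel.lintegral_kernelAt (hK : BddKernel K κ) (hh : 0 < h) (x : ℝ) :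
    ∫⁻ u, ENNReal.ofReal (kernelAt K h x u) = ENNReal.ofReal (∫ u, K u) := by
  rw [← ofReal_integral_eq_lintegral_ofReal (hK.integrable_kernelAt hh x)
    (ae_of_all _ fun u => hK.kernelAt_nonneg hh x u), integral_kernelAt K hh x]

/-- Hölder's inequality with P on G and the conjugate exponent Q on the kernels. From k ≤ κ/h one
has ∫ k^Q ≤ (κ/h)^(Q-1) ∫ k, so the Q-norm of k ⊗ k grows like h^(-2/P). This beats the trivial h⁻².
-/
lemma BddKernel.lintegral_kernelAt_mul_le (hK : BddKernel K κ) (hh : 0 < h) (x : ℝ) {P C : ℝ}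
    (hP : 1 < P) {G : ℝ × ℝ → ENNReal} (hG : Measurable G)
    (hGC : (∫⁻ z, G z ^ P) ^ (1 / P) ≤ ENNReal.ofReal C) :
    ∫⁻ z : ℝ × ℝ, ENNReal.ofReal (kernelAt K h x z.1 * kernelAt K h x z.2) * G z ≤
      ENNReal.ofReal (κ ^ (2 / P) * ((∫ u, K u) ^ 2) ^ (1 - 1 / P) * |C| * h ^ (-(2 / P))) := by
  set k := kernelAt K h x with hk
  set Q := P.conjExponent with hQ
  have hPQ : P.HolderConjugate Q := Real.HolderConjugate.conjExponent hP
  have hQ1 : 1 < Q := hPQ.symm.lt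
  have hQinv : 1 / Q = 1 - 1 / P := by
    have := hPQ.inv_add_inv_eq_one
    rw [one_div, one_div]; linarith
  have hI : 0 ≤ ∫ u, K u := integral_nonneg hK.nonneg
  have hk0 : ∀ u, 0 ≤ k u := hK.kernelAt_nonneg hh x
  have hkm : Measurable k := hK.measurable_kernelAt h x
  have hb : 0 < κ / h := div_pos hK.pos hh
  have hkQ : ∀ u, k u ^ Q ≤ (κ / h) ^ (Q - 1) * k u := by
    intro u
    rcases (hk0 u).eq_or_lt with h0 | h0
    · rw [← h0, Real.zero_rpow (by linarith)]; simp
    · calc k u ^ Q = k u ^ (Q - 1) * k u := by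
            rw [← Real.rpow_add_one h0.ne']; ring_nf
        _ ≤ _ := by
            gcongr
            exact hK.kernelAt_le hh x u
  have hfm : Measurable fun z : ℝ × ℝ => ENNReal.ofReal (k z.1 * k z.2) :=
    ((hkm.comp measurable_fst).mul (hkm.comp measurable_snd)).ennreal_ofReal
  have h1 : ∫⁻ z : ℝ × ℝ, ENNReal.ofReal (k z.1 * k z.2) ^ Q ≤
      ENNReal.ofReal ((κ / h) ^ (2 * (Q - 1)) * (∫ u, K u) ^ 2) := by
    calc ∫⁻ z : ℝ × ℝ, ENNReal.ofReal (k z.1 * k z.2) ^ Q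
        ≤ ∫⁻ z : ℝ × ℝ, ENNReal.ofReal ((κ / h) ^ (2 * (Q - 1))) *
            (ENNReal.ofReal (k z.1) * ENNReal.ofReal (k z.2)) := by
          refine lintegral_mono fun z => ?_
          rw [ENNReal.ofReal_rpow_of_nonneg (mul_nonneg (hk0 _) (hk0 _)) (by linarith),
            ← ENNReal.ofReal_mul (hk0 _), ← ENNReal.ofReal_mul (by positivity)]
          refine ENNReal.ofReal_le_ofReal ?_
          rw [Real.mul_rpow (hk0 _) (hk0 _), two_mul, Real.rpow_add hb]
          calc k z.1 ^ Q * k z.2 ^ Q ≤ ((κ / h) ^ (Q - 1) * k z.1) * ((κ / h) ^ (Q - 1) * k z.2) :=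
                mul_le_mul (hkQ _) (hkQ _) (Real.rpow_nonneg (hk0 _) _)
                  (mul_nonneg (by positivity) (hk0 _))
            _ = _ := by ring
      _ = ENNReal.ofReal ((κ / h) ^ (2 * (Q - 1))) *
            (ENNReal.ofReal (∫ u, K u) * ENNReal.ofReal (∫ u, K u)) := by
          rw [lintegral_const_mul _ (by fun_prop), Measure.volume_eq_prod,
            lintegral_prod_mul hkm.ennreal_ofReal.aemeasurable hkm.ennreal_ofReal.aemeasurable,
            hK.lintegral_kernelAt hh x]
      _ = _ := by
          rw [← ENNReal.ofReal_mul hI, ← ENNReal.ofReal_mul (by positivity), sq]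
  have h2 := ENNReal.lintegral_mul_le_Lp_mul_Lq (volume : Measure (ℝ × ℝ)) hPQ.symm
    hfm.aemeasurable hG.aemeasurable
  refine h2.trans ?_
  calc _ ≤ ENNReal.ofReal ((κ / h) ^ (2 * (Q - 1)) * (∫ u, K u) ^ 2) ^ (1 / Q) *
        ENNReal.ofReal |C| :=
        mul_le_mul' (ENNReal.rpow_le_rpow h1 (by positivity))
          (hGC.trans (ENNReal.ofReal_le_ofReal (le_abs_self C)))
    _ = _ := by
        rw [ENNReal.ofReal_rpow_of_nonneg (by positivity) (by positivity),
          ← ENNReal.ofReal_mul (by positivity)]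
        congr 1
        rw [Real.mul_rpow (by positivity) (by positivity), ← Real.rpow_mul hb.le, hQinv]
        -- Conjugacy gives 1 - 1/P = 1/Q and (Q-1)/Q = 1/P.
        have : 2 * (Q - 1) * (1 - 1 / P) = 2 / P := by
          rw [← hQinv]
          have : Q ≠ 0 := by linarith
          field_simp
          have h3 : Q / Q - 1 / Q = 1 / P := by rw [div_self this, hQinv]; ring
          have hP0 : P ≠ 0 := by linarith
          field_simp at h3
          linarith
        rw [this, Real.div_rpow hK.pos.le hh.le, Real.rpow_neg hh.le]
        ring

end kernel

/-! ### Covariances of kernel averages in terms of joint densities -/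

variable {Ω : Type*} [m0 : MeasurableSpace Ω] {μ : Measure Ω}

lemma ofReal_abs_integral_comp_sub_le {S : Type*} [MeasurableSpace S] {ν : Measure S}
    [IsProbabilityMeasure μ] {V : Ω → S} (hV : HasPDF V μ ν) (hVm : Measurable V) {Q r : S → ℝ}
    (hQ : Measurable Q) {B : ℝ} (hB : ∀ z, |Q z| ≤ B) (hr : Integrable (fun z => Q z * r z) ν) :
    ENNReal.ofReal |∫ ω, Q (V ω) ∂μ - ∫ z, Q z * r z ∂ν| ≤
      ∫⁻ z, ENNReal.ofReal |Q z * ((pdf V μ ν z).toReal - r z)| ∂ν := by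
  have h1 : Integrable (fun z => (pdf V μ ν z).toReal • Q z) ν :=
    (pdf.integrable_pdf_smul_iff hQ.aestronglyMeasurable).mpr
      (.of_bound (hQ.comp hVm).aestronglyMeasurable B (ae_of_all _ fun ω => hB _))
  rw [← pdf.integral_pdf_smul (μ := ν) hQ.aestronglyMeasurable, ← integral_sub h1 hr,
    ← Real.norm_eq_abs, ofReal_norm]
  refine (enorm_integral_le_lintegral_enorm _).trans (le_of_eq (lintegral_congr fun z => ?_))
  rw [← ofReal_norm, Real.norm_eq_abs]
  congr 2
  rw [smul_eq_mul]; ring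

lemma integrable_mul_toReal_pdf {S : Type*} [MeasurableSpace S] {ν : Measure S}
    [IsProbabilityMeasure μ] {V : Ω → S} (hV : HasPDF V μ ν) (hVm : Measurable V) {Q : S → ℝ}
    (hQ : Measurable Q) {B : ℝ} (hB : ∀ z, |Q z| ≤ B) :
    Integrable (fun z => Q z * (pdf V μ ν z).toReal) ν := by
  have h1 : Integrable (fun z => (pdf V μ ν z).toReal • Q z) ν :=
    (pdf.integrable_pdf_smul_iff hQ.aestronglyMeasurable).mpr
      (.of_bound (hQ.comp hVm).aestronglyMeasurable B (ae_of_all _ fun ω => hB _))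
  exact h1.congr (ae_of_all _ fun z => by simp only [smul_eq_mul]; ring)

lemma integral_mul_toReal_pdf {S : Type*} [MeasurableSpace S] {ν : Measure S}
    [IsProbabilityMeasure μ] {V : Ω → S} (hV : HasPDF V μ ν) {Q : S → ℝ} (hQ : Measurable Q) :
    ∫ z, Q z * (pdf V μ ν z).toReal ∂ν = ∫ ω, Q (V ω) ∂μ := by
  rw [← pdf.integral_pdf_smul (μ := ν) hQ.aestronglyMeasurable]
  exact integral_congr_ae (ae_of_all _ fun z => by simp only [smul_eq_mul]; ring)

/-- The product of the means is the integral of k ⊗ k against f ⊗ f, so the covariance is its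
integral against `lagF`. -/
lemma ofReal_abs_covariance_kernel_le [IsProbabilityMeasure μ] {X : ℕ → Ω → ℝ}
    (hXm : ∀ t, Measurable (X t)) (hX : HasPDF (X 0) μ volume) {t : ℕ}
    (hlag : HasPDF (fun ω => (X t ω, X 0 ω)) μ volume) {k : ℝ → ℝ} (hk : Measurable k)
    (hk0 : ∀ u, 0 ≤ k u) {b : ℝ} (hb : ∀ u, k u ≤ b) :
    ENNReal.ofReal |∫ ω, k (X t ω) * k (X 0 ω) ∂μ - (∫ ω, k (X 0 ω) ∂μ) * ∫ ω, k (X 0 ω) ∂μ| ≤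
      ∫⁻ z : ℝ × ℝ, ENNReal.ofReal (k z.1 * k z.2) * ‖lagF μ X t z‖ₑ := by
  have hkb : ∀ u, |k u| ≤ b := fun u => by rw [abs_of_nonneg (hk0 u)]; exact hb u
  have hki : Integrable (fun u => k u * densX μ X u) := integrable_mul_toReal_pdf hX (hXm 0) hk hkb
  have hkint : ∫ u, k u * densX μ X u = ∫ ω, k (X 0 ω) ∂μ := integral_mul_toReal_pdf hX hk
  have hQ : Measurable fun z : ℝ × ℝ => k z.1 * k z.2 :=
    (hk.comp measurable_fst).mul (hk.comp measurable_snd)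
  have e : ∀ z : ℝ × ℝ, (k z.1 * k z.2) * (densX μ X z.1 * densX μ X z.2) =
      (k z.1 * densX μ X z.1) * (k z.2 * densX μ X z.2) := fun z => by ring
  have hr : Integrable
      (fun z : ℝ × ℝ => (k z.1 * k z.2) * (densX μ X z.1 * densX μ X z.2)) := by
    simp only [e]
    exact hki.mul_prod hki
  have h := ofReal_abs_integral_comp_sub_le hlag ((hXm t).prodMk (hXm 0)) hQ (B := b * b)
    (fun z => by
      rw [abs_mul]
      exact mul_le_mul (hkb _) (hkb _) (abs_nonneg _) ((abs_nonneg _).trans (hkb z.1))) hr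
  have h2 : ∫ z : ℝ × ℝ, (k z.1 * k z.2) * (densX μ X z.1 * densX μ X z.2) =
      (∫ ω, k (X 0 ω) ∂μ) * ∫ ω, k (X 0 ω) ∂μ := by
    simp only [e]
    rw [Measure.volume_eq_prod, integral_prod_mul (fun u => k u * densX μ X u)
      (fun u => k u * densX μ X u), hkint]
  rw [h2] at h
  refine h.trans (le_of_eq (lintegral_congr fun z => ?_))
  rw [abs_mul, ENNReal.ofReal_mul (abs_nonneg _), abs_of_nonneg (mul_nonneg (hk0 _) (hk0 _)),
    ← ofReal_norm, Real.norm_eq_abs]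
  rfl

lemma measurable_densXY {X Y : ℕ → Ω → ℝ} :
    Measurable fun z : ℝ × ℝ => densXY μ X Y z.1 z.2 :=
  (measurable_pdf (fun ω => (X 0 ω, Y 0 ω)) μ volume).ennreal_toReal

lemma measurable_lagG_integrand {X Y : ℕ → Ω → ℝ} (t : ℕ) :
    Measurable fun v : (ℝ × ℝ) × (ℝ × ℝ) => ENNReal.ofReal |v.1.1 * v.1.2 * densFour μ X Y t v.1 v.2 -
      v.1.1 * densXY μ X Y v.2.1 v.1.1 * (v.1.2 * densXY μ X Y v.2.2 v.1.2)| := by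
  have h4 : Measurable fun v : (ℝ × ℝ) × (ℝ × ℝ) => densFour μ X Y t v.1 v.2 :=
    (measurable_pdf (fun ω => ((Y t ω, Y 0 ω), (X t ω, X 0 ω))) μ volume).ennreal_toReal
  have ha : Measurable fun v : (ℝ × ℝ) × (ℝ × ℝ) => densXY μ X Y v.2.1 v.1.1 :=
    measurable_densXY.comp (f := fun v : (ℝ × ℝ) × (ℝ × ℝ) => (v.2.1, v.1.1)) (by fun_prop)
  have hb : Measurable fun v : (ℝ × ℝ) × (ℝ × ℝ) => densXY μ X Y v.2.2 v.1.2 :=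
    measurable_densXY.comp (f := fun v : (ℝ × ℝ) × (ℝ × ℝ) => (v.2.2, v.1.2)) (by fun_prop)
  fun_prop

lemma measurable_lagG {X Y : ℕ → Ω → ℝ} (t : ℕ) : Measurable (lagG μ X Y t) :=
  (measurable_lagG_integrand t).lintegral_prod_left'

lemma measurable_lagF {X : ℕ → Ω → ℝ} (t : ℕ) : Measurable (lagF μ X t) := by
  have h1 : Measurable fun z : ℝ × ℝ => (pdf (fun ω => (X t ω, X 0 ω)) μ volume z).toReal :=
    (measurable_pdf _ μ volume).ennreal_toReal
  have h2 : Measurable (densX μ X) := (measurable_pdf _ μ volume).ennreal_toReal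
  unfold lagF
  fun_prop

/-- Fubini for a product of two functions of two variables, with the variables regrouped. -/
lemma integrable_and_integral_regroup {A : ℝ × ℝ → ℝ} (hA : Measurable A)
    (hAi : Integrable A) :
    Integrable (fun v : (ℝ × ℝ) × (ℝ × ℝ) => A (v.2.1, v.1.1) * A (v.2.2, v.1.2)) ∧
    ∫ v : (ℝ × ℝ) × (ℝ × ℝ), A (v.2.1, v.1.1) * A (v.2.2, v.1.2) = (∫ z, A z) * ∫ z, A z := by
  have hm : Measurable fun v : (ℝ × ℝ) × (ℝ × ℝ) => A (v.2.1, v.1.1) * A (v.2.2, v.1.2) := by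
    fun_prop
  have hi : Integrable (fun v : (ℝ × ℝ) × (ℝ × ℝ) => A (v.2.1, v.1.1) * A (v.2.2, v.1.2)) := by
    refine ⟨hm.aestronglyMeasurable, ?_⟩
    rw [hasFiniteIntegral_iff_enorm]
    have hm' : Measurable fun z : ℝ × ℝ => ‖A z‖ₑ := hA.enorm
    have hin : Measurable fun u : ℝ => ∫⁻ y : ℝ, ‖A (u, y)‖ₑ := hm'.lintegral_prod_right'
    calc ∫⁻ v : (ℝ × ℝ) × (ℝ × ℝ), ‖A (v.2.1, v.1.1) * A (v.2.2, v.1.2)‖ₑ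
        = ∫⁻ z : ℝ × ℝ, ∫⁻ y : ℝ × ℝ, ‖A (z.1, y.1)‖ₑ * ‖A (z.2, y.2)‖ₑ := by
          rw [Measure.volume_eq_prod (ℝ × ℝ) (ℝ × ℝ), lintegral_prod_symm _ hm.enorm.aemeasurable]
          simp only [enorm_mul]
      _ = ∫⁻ z : ℝ × ℝ, (∫⁻ y : ℝ, ‖A (z.1, y)‖ₑ) * ∫⁻ y : ℝ, ‖A (z.2, y)‖ₑ := by
          refine lintegral_congr fun z => ?_
          rw [Measure.volume_eq_prod, lintegral_prod_mul (f := fun y => ‖A (z.1, y)‖ₑ)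
            (g := fun y => ‖A (z.2, y)‖ₑ) (by fun_prop) (by fun_prop)]
      _ = (∫⁻ u : ℝ, ∫⁻ y : ℝ, ‖A (u, y)‖ₑ) * ∫⁻ u : ℝ, ∫⁻ y : ℝ, ‖A (u, y)‖ₑ := by
          rw [Measure.volume_eq_prod, lintegral_prod_mul hin.aemeasurable hin.aemeasurable]
      _ = (∫⁻ z : ℝ × ℝ, ‖A z‖ₑ) * ∫⁻ z : ℝ × ℝ, ‖A z‖ₑ := by
          rw [Measure.volume_eq_prod, lintegral_prod _ hm'.aemeasurable]
      _ < ⊤ := ENNReal.mul_lt_top hAi.2 hAi.2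
  refine ⟨hi, ?_⟩
  rw [Measure.volume_eq_prod (ℝ × ℝ) (ℝ × ℝ)] at hi ⊢
  rw [integral_prod_symm _ hi]
  calc ∫ z : ℝ × ℝ, ∫ y : ℝ × ℝ, A (z.1, y.1) * A (z.2, y.2)
      = ∫ z : ℝ × ℝ, (∫ y : ℝ, A (z.1, y)) * ∫ y : ℝ, A (z.2, y) := by
        congr 1; ext z
        rw [Measure.volume_eq_prod,
          integral_prod_mul (fun y => A (z.1, y)) (fun y => A (z.2, y))]
    _ = (∫ u : ℝ, ∫ y : ℝ, A (u, y)) * ∫ u : ℝ, ∫ y : ℝ, A (u, y) := by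
        rw [Measure.volume_eq_prod, integral_prod_mul (fun u => ∫ y : ℝ, A (u, y))
          (fun u => ∫ y : ℝ, A (u, y))]
    _ = _ := by
        rw [Measure.volume_eq_prod] at hAi ⊢
        rw [integral_prod _ hAi]

/-- The function ψ is meant for a truncation: boundedness supplies integrability, while |ψ(y)| ≤ |y|
allows the weight |y y'| of `lagG` to dominate. The resulting bound does not depend on the
truncation level. -/
lemma ofReal_abs_covariance_response_le [IsProbabilityMeasure μ] {X Y : ℕ → Ω → ℝ}
    (hXm : ∀ t, Measurable (X t)) (hYm : ∀ t, Measurable (Y t))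
    (hXY : HasPDF (fun ω => (X 0 ω, Y 0 ω)) μ volume) {t : ℕ}
    (h4 : HasPDF (fun ω => ((Y t ω, Y 0 ω), (X t ω, X 0 ω))) μ volume) {k ψ : ℝ → ℝ}
    (hk : Measurable k) (hk0 : ∀ u, 0 ≤ k u) {b c : ℝ} (hb : ∀ u, k u ≤ b) (hψ : Measurable ψ)
    (hψc : ∀ y, |ψ y| ≤ c) (hψ1 : ∀ y, |ψ y| ≤ |y|) :
    ENNReal.ofReal |∫ ω, (ψ (Y t ω) * k (X t ω)) * (ψ (Y 0 ω) * k (X 0 ω)) ∂μ -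
        (∫ ω, ψ (Y 0 ω) * k (X 0 ω) ∂μ) * ∫ ω, ψ (Y 0 ω) * k (X 0 ω) ∂μ| ≤
      ∫⁻ z : ℝ × ℝ, ENNReal.ofReal (k z.1 * k z.2) * lagG μ X Y t z := by
  have hkb : ∀ u, |k u| ≤ b := fun u => by rw [abs_of_nonneg (hk0 u)]; exact hb u
  set A : ℝ × ℝ → ℝ := fun z => (ψ z.2 * k z.1) * densXY μ X Y z.1 z.2 with hA
  have hqm : Measurable fun z : ℝ × ℝ => ψ z.2 * k z.1 := by fun_prop
  have hqb : ∀ u y, |ψ y * k u| ≤ c * b := fun u y => by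
    rw [abs_mul]
    exact mul_le_mul (hψc _) (hkb _) (abs_nonneg _) ((abs_nonneg _).trans (hψc y))
  have hAm : Measurable A := hqm.mul measurable_densXY
  have hAi : Integrable A :=
    integrable_mul_toReal_pdf hXY ((hXm 0).prodMk (hYm 0)) hqm (fun z => hqb z.1 z.2)
  have hAint : ∫ z, A z = ∫ ω, ψ (Y 0 ω) * k (X 0 ω) ∂μ := integral_mul_toReal_pdf hXY hqm
  obtain ⟨hi, hint⟩ := integrable_and_integral_regroup hAm hAi
  have e : ∀ v : (ℝ × ℝ) × (ℝ × ℝ), A (v.2.1, v.1.1) * A (v.2.2, v.1.2) =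
      ((ψ v.1.1 * k v.2.1) * (ψ v.1.2 * k v.2.2)) *
        (densXY μ X Y v.2.1 v.1.1 * densXY μ X Y v.2.2 v.1.2) := fun v => by
    simp only [hA]; ring
  simp only [e] at hi hint
  have hQ : Measurable fun v : (ℝ × ℝ) × (ℝ × ℝ) =>
      (ψ v.1.1 * k v.2.1) * (ψ v.1.2 * k v.2.2) := by fun_prop
  have h := ofReal_abs_integral_comp_sub_le h4
    (((hYm t).prodMk (hYm 0)).prodMk ((hXm t).prodMk (hXm 0))) hQ (B := (c * b) * (c * b))
    (fun v => by
      rw [abs_mul]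
      exact mul_le_mul (hqb _ _) (hqb _ _) (abs_nonneg _) ((abs_nonneg _).trans (hqb 0 0))) hi
  rw [hint, hAint] at h
  refine h.trans ?_
  have hGm := measurable_lagG_integrand (μ := μ) (X := X) (Y := Y) t
  have hkm : Measurable fun v : (ℝ × ℝ) × (ℝ × ℝ) => ENNReal.ofReal (k v.2.1 * k v.2.2) := by
    fun_prop
  have hkG : Measurable fun v : (ℝ × ℝ) × (ℝ × ℝ) => ENNReal.ofReal (k v.2.1 * k v.2.2) *
      ENNReal.ofReal |v.1.1 * v.1.2 * densFour μ X Y t v.1 v.2 -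
        v.1.1 * densXY μ X Y v.2.1 v.1.1 * (v.1.2 * densXY μ X Y v.2.2 v.1.2)| := hkm.mul hGm
  calc _ ≤ ∫⁻ v : (ℝ × ℝ) × (ℝ × ℝ), ENNReal.ofReal (k v.2.1 * k v.2.2) *
        ENNReal.ofReal |v.1.1 * v.1.2 * densFour μ X Y t v.1 v.2 -
      v.1.1 * densXY μ X Y v.2.1 v.1.1 * (v.1.2 * densXY μ X Y v.2.2 v.1.2)| := by
        refine lintegral_mono fun v => ?_
        have hkk := mul_nonneg (hk0 v.2.1) (hk0 v.2.2)
        rw [← ENNReal.ofReal_mul hkk]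
        refine ENNReal.ofReal_le_ofReal ?_
        set d : ℝ := densFour μ X Y t v.1 v.2 -
          densXY μ X Y v.2.1 v.1.1 * densXY μ X Y v.2.2 v.1.2 with hd
        calc _ = |(k v.2.1 * k v.2.2) * (ψ v.1.1 * ψ v.1.2 * d)| := by
              congr 1
              rw [hd, densFour]
              ring
          _ = (k v.2.1 * k v.2.2) * (|ψ v.1.1| * |ψ v.1.2| * |d|) := by
              rw [abs_mul, abs_of_nonneg hkk, abs_mul, abs_mul]
          _ ≤ (k v.2.1 * k v.2.2) * (|v.1.1| * |v.1.2| * |d|) :=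
              mul_le_mul_of_nonneg_left (mul_le_mul_of_nonneg_right
                (mul_le_mul (hψ1 _) (hψ1 _) (abs_nonneg _) (abs_nonneg _)) (abs_nonneg _)) hkk
          _ = _ := by
              rw [← abs_mul, ← abs_mul]
              congr 2
              rw [hd]; ring
    _ = _ := by
        rw [Measure.volume_eq_prod (ℝ × ℝ) (ℝ × ℝ),
          lintegral_prod_symm _ hkG.aemeasurable]
        refine lintegral_congr fun z => ?_
        exact lintegral_const_mul (ENNReal.ofReal (k z.1 * k z.2))
          (hGm.comp (measurable_prodMk_right (y := z)))

end

section

variable {Ω : Type*} [m0 : MeasurableSpace Ω] {μ : Measure Ω}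

/-! ### Reduction of the mixing regimes to polynomial decay -/

lemma exists_pow_le_rpow_neg {ρ : ℝ} (h0 : 0 < ρ) (h1 : ρ < 1) (γ : ℝ) :
    ∃ C : ℝ, 0 < C ∧ ∀ τ : ℕ, 1 ≤ τ → ρ ^ τ ≤ C * (τ : ℝ) ^ (-γ) := by
  obtain ⟨B, hB⟩ := (tendsto_pow_const_mul_const_pow_of_abs_lt_one ⌈γ⌉₊
    (show |ρ| < 1 by rwa [abs_of_pos h0])).bddAbove_range
  refine ⟨max B 1, by positivity, fun τ hτ => ?_⟩
  have hτ' : (1 : ℝ) ≤ τ := by exact_mod_cast hτ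
  have hτ0 : (0 : ℝ) < τ := by linarith
  have h2 : (τ : ℝ) ^ ⌈γ⌉₊ * ρ ^ τ ≤ B := hB ⟨τ, rfl⟩
  rw [Real.rpow_neg hτ0.le, ← div_eq_mul_inv, le_div_iff₀ (by positivity)]
  calc ρ ^ τ * (τ : ℝ) ^ γ ≤ ρ ^ τ * (τ : ℝ) ^ (⌈γ⌉₊ : ℝ) := by
        gcongr
        exact Nat.le_ceil γ
    _ = (τ : ℝ) ^ ⌈γ⌉₊ * ρ ^ τ := by rw [Real.rpow_natCast, mul_comm]
    _ ≤ max B 1 := h2.trans (le_max_left _ _)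

lemma BandwidthCondition.exists_bounds {h : ℕ → ℝ} {R : MixingRegime}
    (hb : BandwidthCondition h R) : ∃ w c₁ c₂ : ℝ, 0 < w ∧ w < R.maxExponent ∧ 0 < c₁ ∧ 0 < c₂ ∧
      (∀ᶠ n : ℕ in atTop, c₁ * (n : ℝ) ^ (-w) ≤ h n) ∧
      ∀ᶠ n : ℕ in atTop, h n ≤ c₂ * (n : ℝ) ^ (-w) := by
  obtain ⟨w, c, hw, hwR, hc, ht⟩ := hb
  refine ⟨w, c / 2, 2 * c, hw, hwR, by positivity, by positivity, ?_, ?_⟩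
  · filter_upwards [ht.eventually (lt_mem_nhds (show c / 2 < c by linarith)),
      eventually_gt_atTop 0] with n h1 hn
    have hn' : (0 : ℝ) < n := by exact_mod_cast hn
    exact ((lt_div_iff₀ (by positivity)).mp h1).le
  · filter_upwards [ht.eventually (gt_mem_nhds (show c < 2 * c by linarith)),
      eventually_gt_atTop 0] with n h1 hn
    have hn' : (0 : ℝ) < n := by exact_mod_cast hn
    exact ((div_lt_iff₀ (by positivity)).mp h1).le

/-- Geometric mixing implies polynomial mixing with any exponent, so both regimes reduce to a
polynomial rate. In the geometric regime γ may be chosen to suit both p and w. -/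
lemma exists_rateSetup {h : ℕ → ℝ} {R : MixingRegime} (hR : R.Admissible)
    (hb : BandwidthCondition h R) {p : ℝ} (hp : 2 < p) (hRp : R.ExponentCondition p) :
    ∃ γ w c₁ c₂ C : ℝ, RateSetup h γ w c₁ c₂ ∧ 0 < C ∧
      (∀ τ : ℕ, 1 ≤ τ → R.rate τ ≤ C * (τ : ℝ) ^ (-γ)) ∧ 1 < (1 - 2 / p) * (γ - 1) := by
  obtain ⟨w, c₁, c₂, hw, hwR, hc₁, hc₂, h1, h2⟩ := hb.exists_bounds
  have hp' : 0 < 1 - 2 / p := by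
    rw [sub_pos, div_lt_one (by linarith)]; exact hp
  cases R with
  | poly γ =>
    simp only [MixingRegime.Admissible] at hR
    simp only [MixingRegime.maxExponent] at hwR
    have hd : 0 < 2 * γ + 3 := by linarith
    have h14 : 14 / (2 * γ + 3) < 1 - w := by linarith
    have hpos : 0 < 14 / (2 * γ + 3) := by positivity
    refine ⟨γ, w, c₁, c₂, 1, ⟨hw, by linarith, hc₁, hc₂, h1, h2, ?_⟩, one_pos, fun τ _ => ?_, hRp⟩
    -- From 1 - w > 14/(2γ+3) one gets (1-w)(γ+1) > 14(γ+1)/(2γ+3), which is at least 6 as soon as γ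
    -- ≥ 2.
    · rw [div_lt_iff₀ hd] at h14
      nlinarith
    · simp [MixingRegime.rate]
  | geom ρ =>
    obtain ⟨hρ0, hρ1⟩ := hR
    simp only [MixingRegime.maxExponent] at hwR
    have hw1 : 0 < 1 - w := by linarith
    -- The first summand secures `six_lt`, the other two the exponent condition for p.
    set γ := 6 / (1 - w) + 1 / (1 - 2 / p) + 1 with hγ
    obtain ⟨C, hC, hCρ⟩ := exists_pow_le_rpow_neg hρ0 hρ1 γ
    refine ⟨γ, w, c₁, c₂, C, ⟨hw, hwR, hc₁, hc₂, h1, h2, ?_⟩, hC, hCρ, ?_⟩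
    · have e : (1 - w) * (γ + 1) = 6 + (1 - w) * (1 / (1 - 2 / p) + 2) := by
        rw [hγ]; field_simp; ring
      have : 0 < (1 - w) * (1 / (1 - 2 / p) + 2) := by positivity
      linarith
    · have e : (1 - 2 / p) * (γ - 1) = 1 + (1 - 2 / p) * (6 / (1 - w)) := by
        rw [hγ]
        generalize 1 - 2 / p = y at hp'
        field_simp; ring
      have : 0 < (1 - 2 / p) * (6 / (1 - w)) := by positivity
      linarith

/-! ### Kernels that are essentially bounded -/

/-- The kernel `K` cut off at the level `κ`. -/
noncomputable def cappedKernel (K : ℝ → ℝ) (κ u : ℝ) : ℝ := min (K u) κ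

lemma KernelCondition.integrable {K : ℝ → ℝ} (hK : KernelCondition K) : Integrable K :=
  memLp_one_iff_integrable.mp ⟨hK.measurable.aestronglyMeasurable, hK.norm_one_lt_top⟩

lemma KernelCondition.integral_pos {K : ℝ → ℝ} (hK : KernelCondition K) : 0 < ∫ u, K u := by
  have h0 : 0 ≤ ∫ u, K u := integral_nonneg hK.nonneg
  refine h0.lt_of_ne' fun h => ?_
  rw [integral_eq_zero_iff_of_nonneg hK.nonneg hK.integrable] at h
  have := hK.norm_one_pos
  rw [eLpNorm_congr_ae h, eLpNorm_zero] at this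
  exact lt_irrefl _ this

/-- Capping K at its essential supremum changes it on a null set only. The capped kernel is bounded
at every point, as the exponential inequality requires. -/
lemma KernelCondition.exists_bddKernel {K : ℝ → ℝ} (hK : KernelCondition K) :
    ∃ κ, BddKernel (cappedKernel K κ) κ ∧ K =ᵐ[volume] cappedKernel K κ ∧
      ∫ u, cappedKernel K κ u = ∫ u, K u := by
  set κ := (eLpNorm K ⊤ volume).toReal with hκ
  have hκ0 : 0 < κ := ENNReal.toReal_pos hK.norm_top_pos.ne' hK.norm_top_lt_top.ne
  have hae : K =ᵐ[volume] cappedKernel K κ := by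
    filter_upwards [ae_le_eLpNormEssSup (f := K) (μ := volume)] with u hu
    rw [← eLpNorm_exponent_top] at hu
    have h1 : K u ≤ κ := by
      have := ENNReal.toReal_mono hK.norm_top_lt_top.ne hu
      rw [toReal_enorm, Real.norm_eq_abs] at this
      exact (le_abs_self _).trans this
    simp [cappedKernel, h1]
  refine ⟨κ, ⟨hK.measurable.min measurable_const, fun u => le_min (hK.nonneg u) hκ0.le,
    fun u => min_le_right _ _, hκ0, hK.integrable.congr hae⟩, hae, (integral_congr_ae hae).symm⟩

lemma ae_kernelAt_eq {K K' : ℝ → ℝ} (hKK : K =ᵐ[volume] K') {h : ℝ} (hh : h ≠ 0) (x : ℝ) :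
    kernelAt K h x =ᵐ[volume] kernelAt K' h x := by
  have h1 : Measure.QuasiMeasurePreserving (fun u : ℝ => u * h⁻¹) volume volume :=
    ⟨by fun_prop, by
      rw [Real.map_volume_mul_right (inv_ne_zero hh)]
      exact Measure.smul_absolutelyContinuous⟩
  have h2 : Measure.QuasiMeasurePreserving (fun u : ℝ => u - x) volume volume :=
    (measurePreserving_sub_right volume x).quasiMeasurePreserving
  filter_upwards [(h1.comp h2).ae hKK] with u hu
  simp only [kernelAt, scaledKernel, div_eq_mul_inv]
  rw [show K ((u - x) * h⁻¹) = K' ((u - x) * h⁻¹) from hu]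

/-! ### Stationary pairs -/

/-- The joint laws of `(X_{s+d}, Y_{s+d})` and `(X_s, Y_s)` do not depend on `s`. -/
structure StationaryPair (μ : Measure Ω) (X Y : ℕ → Ω → ℝ) : Prop where
  measurable_X : ∀ t, Measurable (X t)
  measurable_Y : ∀ t, Measurable (Y t)
  identDistrib : ∀ s d, IdentDistrib
    (fun ω => ((X (s + d) ω, Y (s + d) ω), (X s ω, Y s ω)))
    (fun ω => ((X d ω, Y d ω), (X 0 ω, Y 0 ω))) μ μ

lemma measurable_response {X ε : ℕ → Ω → ℝ} {φ : ℝ → ℝ} (hX : ∀ t, Measurable (X t))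
    (hε : ∀ t, Measurable (ε t)) (hφ : Measurable φ) (t : ℕ) : Measurable (response φ X ε t) :=
  (hφ.comp (hX t)).add (hε t)

lemma StrictlyStationary.stationaryPair {X ε : ℕ → Ω → ℝ} {φ : ℝ → ℝ}
    (hs : StrictlyStationary μ (fun t ω => (X t ω, ε t ω))) (hX : ∀ t, Measurable (X t))
    (hε : ∀ t, Measurable (ε t)) (hφ : Measurable φ) :
    StationaryPair μ X (response φ X ε) where
  measurable_X := hX
  measurable_Y := measurable_response hX hε hφ
  identDistrib s d := by
    have hu : Measurable fun f : ℕ → ℝ × ℝ =>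
        (((f d).1, φ (f d).1 + (f d).2), ((f 0).1, φ (f 0).1 + (f 0).2)) := by fun_prop
    have := (hs s).comp hu
    simp only [Function.comp_def, zero_add, add_comm d s] at this
    exact this

namespace StationaryPair

variable {X Y : ℕ → Ω → ℝ}

lemma measurable_pair (H : StationaryPair μ X Y) (s : ℕ) : Measurable fun ω => (X s ω, Y s ω) :=
  (H.measurable_X s).prodMk (H.measurable_Y s)

lemma identDistrib_pair (H : StationaryPair μ X Y) (s : ℕ) :
    IdentDistrib (fun ω => (X s ω, Y s ω)) (fun ω => (X 0 ω, Y 0 ω)) μ μ :=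
  (H.identDistrib s 0).comp measurable_snd

lemma integral_comp (H : StationaryPair μ X Y) {q : ℝ × ℝ → ℝ} (hq : Measurable q) (s : ℕ) :
    ∫ ω, q (X s ω, Y s ω) ∂μ = ∫ ω, q (X 0 ω, Y 0 ω) ∂μ :=
  ((H.identDistrib_pair s).comp hq).integral_eq

lemma integral_comp_lag (H : StationaryPair μ X Y) {q : (ℝ × ℝ) × (ℝ × ℝ) → ℝ} (hq : Measurable q)
    (s d : ℕ) : ∫ ω, q ((X (s + d) ω, Y (s + d) ω), (X s ω, Y s ω)) ∂μ =
      ∫ ω, q ((X d ω, Y d ω), (X 0 ω, Y 0 ω)) ∂μ :=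
  ((H.identDistrib s d).comp hq).integral_eq

/-- Deviations of sums of functions of a stationary pair whose lagged covariances are small. -/
theorem ae_eventually_abs_sum_Ioc_le [IsProbabilityMeasure μ] (H : StationaryPair μ X Y)
    {W : ℕ → ℕ → Ω → ℝ × ℝ} (hW : ∀ n s, Measurable (W n s))
    {a e : ℕ → ℕ} (he : ∀ n, e n ≤ n)
    (hWZ : ∀ n, ∀ s ∈ Finset.Ioc (a n) (e n), W n s = fun ω => (X s ω, Y s ω))
    {C₁ γ : ℝ} (hC₁ : 0 < C₁)
    (hmix : ∀ n τ : ℕ, 1 ≤ τ → mixingCoeff μ (W n) n τ ≤ C₁ * (τ : ℝ) ^ (-γ))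
    {h : ℕ → ℝ} {w c₁ c₂ : ℝ} (hr : RateSetup h γ w c₁ c₂) {β : ℝ} (hβ : 0 < β) (hβ1 : β < 1)
    (hβγ : 1 < β * (γ - 1)) {q : ℕ → ℝ × ℝ → ℝ} (hq : ∀ n, Measurable (q n)) {C : ℝ} (hC : 0 < C)
    (hqB : ∀ᶠ n : ℕ in atTop, ∀ z, |q n z| ≤ C * (Real.log n / h n))
    (hq0 : ∀ n, ∃ B, ∀ z, |q n z| ≤ B)
    (hq2 : ∀ᶠ n : ℕ in atTop, ∫ ω, q n (X 0 ω, Y 0 ω) ^ 2 ∂μ ≤ C / h n)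
    (hqc : ∀ᶠ n : ℕ in atTop, ∀ d, 1 ≤ d →
      |∫ ω, q n (X d ω, Y d ω) * q n (X 0 ω, Y 0 ω) ∂μ -
        (∫ ω, q n (X 0 ω, Y 0 ω) ∂μ) * ∫ ω, q n (X 0 ω, Y 0 ω) ∂μ| ≤ C * (h n) ^ (-(1 - β))) :
    ∃ C' : ℝ, 0 < C' ∧ ∀ᵐ ω ∂μ, ∀ᶠ n : ℕ in atTop, ∀ t ≤ e n,
      |∑ s ∈ Finset.Ioc (a n) t, (q n (X s ω, Y s ω) - ∫ ω, q n (X 0 ω, Y 0 ω) ∂μ)| ≤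
        C' * (n * devRate h n) := by
  have hi : ∀ n s, Integrable (fun ω => q n (X s ω, Y s ω)) μ := fun n s => by
    obtain ⟨B, hB⟩ := hq0 n
    exact .of_bound ((hq n).comp (H.measurable_pair s)).aestronglyMeasurable B
      (ae_of_all _ fun ω => hB _)
  have hii : ∀ n s t, Integrable (fun ω => q n (X s ω, Y s ω) * q n (X t ω, Y t ω)) μ :=
    fun n s t => by
      obtain ⟨B, hB⟩ := hq0 n
      exact (hi n t).bdd_mul ((hq n).comp (H.measurable_pair s)).aestronglyMeasurable
        (ae_of_all _ fun ω => hB _)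
  have hexp : ∀ n s t, ∫ ω, (q n (X s ω, Y s ω) - ∫ ω, q n (X 0 ω, Y 0 ω) ∂μ) *
      (q n (X t ω, Y t ω) - ∫ ω, q n (X 0 ω, Y 0 ω) ∂μ) ∂μ =
      ∫ ω, q n (X s ω, Y s ω) * q n (X t ω, Y t ω) ∂μ -
        (∫ ω, q n (X 0 ω, Y 0 ω) ∂μ) * ∫ ω, q n (X 0 ω, Y 0 ω) ∂μ := by
    intro n s t
    set c := ∫ ω, q n (X 0 ω, Y 0 ω) ∂μ with hc
    have e1 : ∀ ω, (q n (X s ω, Y s ω) - c) * (q n (X t ω, Y t ω) - c) =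
        q n (X s ω, Y s ω) * q n (X t ω, Y t ω) -
          (c * q n (X s ω, Y s ω) + c * q n (X t ω, Y t ω) - c * c) := fun ω => by ring
    have i1 : Integrable (fun ω => c * q n (X s ω, Y s ω)) μ := (hi n s).const_mul c
    have i2 : Integrable (fun ω => c * q n (X t ω, Y t ω)) μ := (hi n t).const_mul c
    have i3 : Integrable (fun ω => c * q n (X s ω, Y s ω) + c * q n (X t ω, Y t ω)) μ := i1.add i2
    have i4 : Integrable (fun ω => c * q n (X s ω, Y s ω) + c * q n (X t ω, Y t ω) - c * c) μ :=
      i3.sub (integrable_const _)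
    simp only [e1]
    rw [integral_sub (hii n s t) i4, integral_sub i3 (integrable_const _), integral_add i1 i2,
      integral_const_mul, integral_const_mul, H.integral_comp (hq n) s, H.integral_comp (hq n) t,
      ← hc]
    simp
  -- The mean obeys the same bound as the function, so centring doubles the constant.
  refine NWChange.ae_eventually_abs_sum_Ioc_le (μ := μ) (fun s => H.measurable_pair s) hW he hWZ
    hC₁ hmix hr hβ hβ1 hβγ hq (mq := fun n => ∫ ω, q n (X 0 ω, Y 0 ω) ∂μ) (C := 2 * C)
    (by positivity) (fun n s => H.integral_comp (hq n) s) ?_ ?_ ?_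
  · filter_upwards [hqB] with n hn z
    have h1 : |∫ ω, q n (X 0 ω, Y 0 ω) ∂μ| ≤ C * (Real.log n / h n) := by
      have := norm_integral_le_of_norm_le_const (μ := μ) (f := fun ω => q n (X 0 ω, Y 0 ω))
        (ae_of_all _ fun ω => hn (X 0 ω, Y 0 ω))
      simpa using this
    calc _ ≤ |q n z| + |∫ ω, q n (X 0 ω, Y 0 ω) ∂μ| := abs_sub _ _
      _ ≤ _ := by linarith [hn z]
  · filter_upwards [hq2, hr.h_pos] with n hn hpos s
    rw [hexp]
    have h1 : ∫ ω, q n (X s ω, Y s ω) * q n (X s ω, Y s ω) ∂μ =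
        ∫ ω, q n (X 0 ω, Y 0 ω) ^ 2 ∂μ := by
      simp only [← sq]
      exact H.integral_comp ((hq n).pow_const 2) s
    have h2 := mul_self_nonneg (∫ ω, q n (X 0 ω, Y 0 ω) ∂μ)
    have h3 : C / h n ≤ 2 * C / h n := by gcongr; linarith
    linarith
  · filter_upwards [hqc, hr.h_pos] with n hn hpos s d hd
    rw [hexp]
    have h1 : ∫ ω, q n (X s ω, Y s ω) * q n (X (s + d) ω, Y (s + d) ω) ∂μ =
        ∫ ω, q n (X d ω, Y d ω) * q n (X 0 ω, Y 0 ω) ∂μ := by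
      simp only [mul_comm (q n (X s _, Y s _))]
      exact H.integral_comp_lag (q := fun z => q n z.1 * q n z.2)
        (((hq n).comp measurable_fst).mul ((hq n).comp measurable_snd)) s d
    rw [h1]
    refine (hn d hd).trans ?_
    have : 0 ≤ h n ^ (-(1 - β)) := by positivity
    nlinarith

end StationaryPair

end

section

variable {Ω : Type*} [m0 : MeasurableSpace Ω] {μ : Measure Ω}

/-! ### Moments of kernel averages -/

lemma integral_comp_le_of_densX_le [IsProbabilityMeasure μ] {X : ℕ → Ω → ℝ}
    (hXm : Measurable (X 0)) (hX : HasPDF (X 0) μ volume) {C : ℝ}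
    (hC : ∀ᵐ u ∂(volume : Measure ℝ), densX μ X u ≤ C) {g : ℝ → ℝ} (hg : Measurable g)
    (hg0 : ∀ u, 0 ≤ g u) {b : ℝ} (hb : ∀ u, g u ≤ b) (hgi : Integrable g) :
    ∫ ω, g (X 0 ω) ∂μ ≤ C * ∫ u, g u := by
  rw [← integral_mul_toReal_pdf hX hg, ← integral_const_mul]
  refine integral_mono_ae (integrable_mul_toReal_pdf hX hXm hg (B := b) fun u => by
    rw [abs_of_nonneg (hg0 u)]; exact hb u) (hgi.const_mul C) ?_
  filter_upwards [hC] with u hu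
  rw [mul_comm C]
  exact mul_le_mul_of_nonneg_left hu (hg0 u)

lemma integral_sq_mul_comp_le [IsProbabilityMeasure μ] {X Y : ℕ → Ω → ℝ} (hXm : Measurable (X 0))
    (hY2 : Integrable (fun ω => Y 0 ω ^ 2) μ) {C : ℝ}
    (hC : ∀ᵐ ω ∂μ, (μ[fun ω => Y 0 ω ^ 2 | MeasurableSpace.comap (X 0) inferInstance]) ω ≤ C)
    {g : ℝ → ℝ} (hg : Measurable g) (hg0 : ∀ u, 0 ≤ g u) {b : ℝ} (hb : ∀ u, g u ≤ b) :
    ∫ ω, Y 0 ω ^ 2 * g (X 0 ω) ∂μ ≤ C * ∫ ω, g (X 0 ω) ∂μ := by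
  have hm : MeasurableSpace.comap (X 0) inferInstance ≤ m0 := hXm.comap_le
  have hgm : StronglyMeasurable[MeasurableSpace.comap (X 0) inferInstance] fun ω => g (X 0 ω) :=
    (hg.comp (comap_measurable (X 0))).stronglyMeasurable
  have hgb : ∀ᵐ ω ∂μ, |g (X 0 ω)| ≤ b := ae_of_all _ fun ω => by
    rw [abs_of_nonneg (hg0 _)]; exact hb _
  have hgi : Integrable (fun ω => g (X 0 ω)) μ :=
    .of_bound (hg.comp hXm).aestronglyMeasurable b hgb
  simp only [mul_comm (Y 0 _ ^ 2)]
  rw [integral_mul_eq_integral_mul_condExp hm hgm hgb hY2, ← integral_const_mul]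
  refine integral_mono_ae (integrable_condExp.bdd_mul (hgm.mono hm).aestronglyMeasurable hgb)
    (hgi.const_mul C) ?_
  filter_upwards [hC] with ω hω
  rw [mul_comm C]
  exact mul_le_mul_of_nonneg_left hω (hg0 _)

lemma abs_rpow_le_exp {c y : ℝ} (hc : 0 < c) : |y| ≤ (1 / c) * Real.exp (c * |y|) := by
  have := Real.add_one_le_exp (c * |y|)
  rw [div_mul_eq_mul_div, one_mul, le_div_iff₀ hc]
  linarith

lemma MomentCondition.integrable_sq {X Y : ℕ → Ω → ℝ} (hYm : Measurable (Y 0))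
    (H : MomentCondition μ X Y) : Integrable (fun ω => Y 0 ω ^ 2) μ := by
  obtain ⟨c, hc, hi⟩ := H.expMoment
  refine (hi.const_mul ((2 / c) ^ 2)).mono' (hYm.pow_const 2).aestronglyMeasurable
    (ae_of_all _ fun ω => ?_)
  have h1 := abs_rpow_le_exp (y := Y 0 ω) (half_pos hc)
  rw [Real.norm_eq_abs, abs_pow]
  calc |Y 0 ω| ^ 2 ≤ ((1 / (c / 2)) * Real.exp (c / 2 * |Y 0 ω|)) ^ 2 := by gcongr
    _ = (2 / c) ^ 2 * Real.exp (c * |Y 0 ω|) := by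
      rw [mul_pow, ← Real.exp_nat_mul]
      congr 2
      · field_simp
      · push_cast; ring

lemma MomentCondition.integrable {X Y : ℕ → Ω → ℝ} [IsProbabilityMeasure μ]
    (hYm : Measurable (Y 0)) (H : MomentCondition μ X Y) : Integrable (Y 0) μ :=
  ((memLp_two_iff_integrable_sq hYm.aestronglyMeasurable).mpr
    (H.integrable_sq hYm)).integrable one_le_two

/-! ### Uniform deviations of the kernel sums -/

namespace RateSetup

variable {h : ℕ → ℝ} {γ w c₁ c₂ : ℝ}

lemma one_le_mul_h (H : RateSetup h γ w c₁ c₂) : ∀ᶠ n : ℕ in atTop, 1 ≤ n * h n := by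
  have h1 : Tendsto (fun n : ℕ => c₁ * (n : ℝ) ^ (1 - w)) atTop atTop :=
    ((tendsto_rpow_atTop (by linarith [H.w_lt_one])).comp
      tendsto_natCast_atTop_atTop).const_mul_atTop H.c₁_pos
  filter_upwards [H.mul_h_bounds, h1.eventually_ge_atTop 1] with n h2 h3
  exact h3.trans h2.1

/-- Eventually h_n < 1 and log n ≥ 1, whence √(n h_n) ≤ n. The bound allows bounded remainders, such
as truncation bias and the rounding in ⌊θn⌋, to be absorbed into n r_n. -/
lemma one_le_mul_devRate (H : RateSetup h γ w c₁ c₂) :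
    ∀ᶠ n : ℕ in atTop, 1 ≤ n * devRate h n := by
  filter_upwards [H.one_le_mul_h, H.tendsto_h.eventually (gt_mem_nhds one_pos), H.h_pos,
    eventually_ge_atTop 3] with n h1 h2 h0 hn3
  have hn : (3 : ℝ) ≤ n := by exact_mod_cast hn3
  have hL1 : 1 ≤ Real.log n := by
    rw [Real.le_log_iff_exp_le (by linarith)]
    linarith [Real.exp_one_lt_d9]
  have hs : Real.sqrt (n * h n) ≤ n := by
    rw [Real.sqrt_le_left (by linarith)]
    nlinarith
  have hs0 : 0 < Real.sqrt (n * h n) := Real.sqrt_pos.mpr (by linarith)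
  rw [devRate, mul_div_assoc', le_div_iff₀ hs0]
  nlinarith [one_le_pow₀ hL1 (n := 2)]

end RateSetup

lemma BddKernel.abs_kernelAt_le {K : ℝ → ℝ} {κ : ℝ} (hK : BddKernel K κ) (h x u : ℝ) :
    |kernelAt K h x u| ≤ |1 / h| * κ := by
  unfold kernelAt scaledKernel
  rw [abs_mul, abs_of_nonneg (hK.nonneg _)]
  exact mul_le_mul_of_nonneg_left (hK.le _) (abs_nonneg _)

lemma BddKernel.integral_sq_kernelAt_comp_le [IsProbabilityMeasure μ] {K : ℝ → ℝ} {κ : ℝ}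
    (hK : BddKernel K κ) {X : ℕ → Ω → ℝ}
    (hXm : Measurable (X 0)) (hX : HasPDF (X 0) μ volume) {C : ℝ}
    (hC : ∀ᵐ u ∂(volume : Measure ℝ), densX μ X u ≤ C) {h : ℝ} (hh : 0 < h) (x : ℝ) :
    ∫ ω, kernelAt K h x (X 0 ω) ^ 2 ∂μ ≤ (κ * (|C| * ∫ u, K u)) / h := by
  have h1 : ∫ ω, kernelAt K h x (X 0 ω) ∂μ ≤ |C| * ∫ u, K u := by
    have := integral_comp_le_of_densX_le hXm hX hC (hK.measurable_kernelAt h x)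
      (hK.kernelAt_nonneg hh x) (hK.kernelAt_le hh x) (hK.integrable_kernelAt hh x)
    rw [integral_kernelAt K hh x] at this
    exact this.trans (mul_le_mul_of_nonneg_right (le_abs_self C) (integral_nonneg hK.nonneg))
  have hi : Integrable (fun ω => kernelAt K h x (X 0 ω)) μ :=
    .of_bound ((hK.measurable_kernelAt h x).comp hXm).aestronglyMeasurable _
      (ae_of_all _ fun ω => hK.abs_kernelAt_le h x _)
  calc ∫ ω, kernelAt K h x (X 0 ω) ^ 2 ∂μ ≤ ∫ ω, κ / h * kernelAt K h x (X 0 ω) ∂μ := by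
        refine integral_mono_of_nonneg (ae_of_all _ fun _ => sq_nonneg _) (hi.const_mul _)
          (ae_of_all _ fun ω => ?_)
        simp only [sq]
        exact mul_le_mul_of_nonneg_right (hK.kernelAt_le hh x _) (hK.kernelAt_nonneg hh x _)
    _ = κ / h * ∫ ω, kernelAt K h x (X 0 ω) ∂μ := integral_const_mul _ _
    _ ≤ κ / h * (|C| * ∫ u, K u) :=
        mul_le_mul_of_nonneg_left h1 (div_nonneg hK.pos.le hh.le)
    _ = _ := by ring

lemma abs_le_of_ofReal_le {x y : ℝ} (hy : 0 ≤ y)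
    (h : ENNReal.ofReal |x| ≤ ENNReal.ofReal y) : |x| ≤ y :=
  (ENNReal.ofReal_le_ofReal_iff hy).mp h

/-- The responses of a sample of size `n` agree with the stationary sequence `Y` at the times in
`(a n, e n]`, and the sample mixes at the rate `R`. -/
structure MixingStretch (μ : Measure Ω) (X Y : ℕ → Ω → ℝ) (W : ℕ → ℕ → Ω → ℝ × ℝ)
    (a e : ℕ → ℕ) (R : MixingRegime) : Prop where
  measurable : ∀ n s, Measurable (W n s)
  le : ∀ n, e n ≤ n
  eq : ∀ n, ∀ s ∈ Finset.Ioc (a n) (e n), W n s = fun ω => (X s ω, Y s ω)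
  mixing : ∃ C₁ : ℝ, 0 < C₁ ∧ ∀ n τ : ℕ, 1 ≤ τ → mixingCoeff μ (W n) n τ ≤ C₁ * R.rate τ

lemma MixingStretch.exists_rpow {X Y : ℕ → Ω → ℝ} {W : ℕ → ℕ → Ω → ℝ × ℝ} {a e : ℕ → ℕ}
    {R : MixingRegime} (hW : MixingStretch μ X Y W a e R) {C γ : ℝ} (hC : 0 < C)
    (hR : ∀ τ : ℕ, 1 ≤ τ → R.rate τ ≤ C * (τ : ℝ) ^ (-γ)) :
    ∃ C₁ : ℝ, 0 < C₁ ∧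
      ∀ n τ : ℕ, 1 ≤ τ → mixingCoeff μ (W n) n τ ≤ C₁ * (τ : ℝ) ^ (-γ) := by
  obtain ⟨C₁, hC₁, hm⟩ := hW.mixing
  refine ⟨C₁ * C, by positivity, fun n τ hτ => (hm n τ hτ).trans ?_⟩
  rw [mul_assoc]
  exact mul_le_mul_of_nonneg_left (hR τ hτ) hC₁.le

theorem ae_eventually_abs_sum_kernelAt_le [IsProbabilityMeasure μ] {X Y : ℕ → Ω → ℝ}
    (H : StationaryPair μ X Y) {R : MixingRegime} {h : ℕ → ℝ} {K : ℝ → ℝ} {κ : ℝ}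
    (hK : BddKernel K κ) (hR : R.Admissible) (hb : BandwidthCondition h R)
    (hd : DensityCondition μ X Y R) {W : ℕ → ℕ → Ω → ℝ × ℝ} {a e : ℕ → ℕ}
    (hW : MixingStretch μ X Y W a e R) (x : ℝ) :
    ∃ C' : ℝ, 0 < C' ∧ ∀ᵐ ω ∂μ, ∀ᶠ n : ℕ in atTop, ∀ t ≤ e n,
      |∑ s ∈ Finset.Ioc (a n) t,
        (kernelAt K (h n) x (X s ω) - ∫ ω, kernelAt K (h n) x (X 0 ω) ∂μ)| ≤
        C' * (n * devRate h n) := by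
  obtain ⟨p, C₂, hp, hRp, hF⟩ := hd.lagF_bounded
  obtain ⟨Cf, hCf⟩ := hd.f_bounded
  obtain ⟨γ, w, c₁, c₂, C, hr, hC, hrate, hγ⟩ := exists_rateSetup hR hb hp hRp
  obtain ⟨C₁, hC₁, hmix⟩ := hW.exists_rpow hC hrate
  have hp' : 0 < 1 - 2 / p := by
    rw [sub_pos, div_lt_one (by linarith)]; exact hp
  have hp'' : 1 - 2 / p < 1 := by
    have : 0 < 2 / p := by positivity
    linarith
  have hI : 0 ≤ ∫ u, K u := integral_nonneg hK.nonneg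
  have hκ := hK.pos
  set A₁ := κ * (|Cf| * ∫ u, K u) with hA₁
  set A₂ := κ ^ (2 / p) * ((∫ u, K u) ^ 2) ^ (1 - 1 / p) * |C₂| with hA₂
  have hA₁0 : 0 ≤ A₁ := by positivity
  have hA₂0 : 0 ≤ A₂ := by positivity
  -- With β = 1 - 2/p the Hölder bound h^(-2/p) is h^(-(1-β)), and β(γ-1) > 1 is the exponent
  -- condition.
  refine H.ae_eventually_abs_sum_Ioc_le hW.measurable hW.le hW.eq hC₁ hmix hr hp' hp'' hγ
    (q := fun n z => kernelAt K (h n) x z.1)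
    (fun n => (hK.measurable_kernelAt _ x).comp measurable_fst) (C := κ + A₁ + A₂)
    (by positivity) ?_ (fun n => ⟨_, fun z => hK.abs_kernelAt_le _ _ _⟩) ?_ ?_
  · filter_upwards [hr.h_pos, eventually_ge_atTop 3] with n hh hn3 z
    have hn : (3 : ℝ) ≤ n := by exact_mod_cast hn3
    have hL1 : 1 ≤ Real.log n := by
      rw [Real.le_log_iff_exp_le (by linarith)]
      linarith [Real.exp_one_lt_d9]
    rw [abs_of_nonneg (hK.kernelAt_nonneg hh _ _)]
    refine (hK.kernelAt_le hh _ _).trans ?_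
    rw [mul_div_assoc']
    gcongr
    nlinarith
  · filter_upwards [hr.h_pos] with n hh
    refine (hK.integral_sq_kernelAt_comp_le (H.measurable_X 0) hd.hasPDF_X hCf hh x).trans ?_
    gcongr
    linarith
  · filter_upwards [hr.h_pos] with n hh d hd1
    have h1 := ofReal_abs_covariance_kernel_le H.measurable_X hd.hasPDF_X (hd.hasPDF_lag d hd1)
      (hK.measurable_kernelAt (h n) x) (hK.kernelAt_nonneg hh x) (hK.kernelAt_le hh x)
    have h2 := hK.lintegral_kernelAt_mul_le hh x (P := p) (C := C₂) (by linarith)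
      (measurable_lagF (μ := μ) (X := X) d).enorm (by
        have := hF d hd1
        rwa [eLpNorm_eq_lintegral_rpow_enorm_toReal (by simp; linarith) ENNReal.ofReal_ne_top,
          ENNReal.toReal_ofReal (by linarith)] at this)
    have h3 := abs_le_of_ofReal_le (by positivity) (h1.trans h2)
    refine h3.trans ?_
    rw [show -(1 - (1 - 2 / p)) = -(2 / p) by ring]
    gcongr
    linarith

/-- Truncation of the responses at the level `L`. -/
noncomputable def truncate (L y : ℝ) : ℝ := if |y| ≤ L then y else 0

lemma measurable_truncate (L : ℝ) : Measurable (truncate L) :=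
  Measurable.ite (measurableSet_le measurable_norm measurable_const) measurable_id measurable_const

lemma abs_truncate_le {L : ℝ} (hL : 0 ≤ L) (y : ℝ) : |truncate L y| ≤ L := by
  unfold truncate; split_ifs with h
  · exact h
  · simpa using hL

lemma abs_truncate_le_abs (L y : ℝ) : |truncate L y| ≤ |y| := by
  unfold truncate; split_ifs
  · exact le_rfl
  · simp

/-- Beyond the level L, half of the exponent c|y| dominates |y| and the other half is at least cL/2.
-/
lemma abs_sub_truncate_le {c L : ℝ} (hc : 0 < c) (y : ℝ) :
    |y - truncate L y| ≤ (2 / c) * Real.exp (-(c / 2 * L)) * Real.exp (c * |y|) := by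
  unfold truncate; split_ifs with h
  · simp; positivity
  · rw [sub_zero, mul_assoc, ← Real.exp_add]
    have h1 := abs_rpow_le_exp (y := y) (half_pos hc)
    push Not at h
    calc |y| ≤ 1 / (c / 2) * Real.exp (c / 2 * |y|) := h1
      _ = 2 / c * Real.exp (c / 2 * |y|) := by congr 1; field_simp
      _ ≤ _ := by
        gcongr
        nlinarith

/-- Truncation at a multiple of log n makes the summands O(log n / h_n), the size the block
inequality tolerates. The bounded conditional second moment keeps their second moment O(1/h_n),
without a logarithm. -/
theorem ae_eventually_abs_sum_truncate_mul_kernelAt_le [IsProbabilityMeasure μ] {X Y : ℕ → Ω → ℝ}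
    (H : StationaryPair μ X Y) {R : MixingRegime} {h : ℕ → ℝ} {K : ℝ → ℝ} {κ : ℝ}
    (hK : BddKernel K κ) (hR : R.Admissible) (hb : BandwidthCondition h R)
    (hd : DensityCondition μ X Y R) (hm : MomentCondition μ X Y)
    {W : ℕ → ℕ → Ω → ℝ × ℝ} {a e : ℕ → ℕ}
    (hW : MixingStretch μ X Y W a e R) (x : ℝ) {c : ℝ} (hc : 0 < c) :
    ∃ C' : ℝ, 0 < C' ∧ ∀ᵐ ω ∂μ, ∀ᶠ n : ℕ in atTop, ∀ t ≤ e n,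
      |∑ s ∈ Finset.Ioc (a n) t,
        (truncate (c * Real.log n) (Y s ω) * kernelAt K (h n) x (X s ω) -
          ∫ ω, truncate (c * Real.log n) (Y 0 ω) * kernelAt K (h n) x (X 0 ω) ∂μ)| ≤
        C' * (n * devRate h n) := by
  obtain ⟨p, C₃, hp, hRp, hG⟩ := hd.lagG_bounded
  obtain ⟨Cf, hCf⟩ := hd.f_bounded
  obtain ⟨C₄, hC₄⟩ := hm.condSecondMoment
  obtain ⟨γ, w, c₁, c₂, C, hr, hC, hrate, hγ⟩ := exists_rateSetup hR hb hp hRp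
  obtain ⟨C₁, hC₁, hmix⟩ := hW.exists_rpow hC hrate
  have hp' : 0 < 1 - 2 / p := by
    rw [sub_pos, div_lt_one (by linarith)]; exact hp
  have hp'' : 1 - 2 / p < 1 := by
    have : 0 < 2 / p := by positivity
    linarith
  have hI : 0 ≤ ∫ u, K u := integral_nonneg hK.nonneg
  have hκ := hK.pos
  have hL0 : ∀ n : ℕ, 0 ≤ c * Real.log n := fun n =>
    mul_nonneg hc.le (Real.log_natCast_nonneg n)
  set A₁ := |C₄| * (κ * (|Cf| * ∫ u, K u)) with hA₁
  set A₂ := κ ^ (2 / p) * ((∫ u, K u) ^ 2) ^ (1 - 1 / p) * |C₃| with hA₂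
  have hA₁0 : 0 ≤ A₁ := by positivity
  have hA₂0 : 0 ≤ A₂ := by positivity
  have hkm : ∀ n, Measurable (kernelAt K (h n) x) := fun n => hK.measurable_kernelAt _ x
  refine H.ae_eventually_abs_sum_Ioc_le hW.measurable hW.le hW.eq hC₁ hmix hr hp' hp'' hγ
    (q := fun n z => truncate (c * Real.log n) z.2 * kernelAt K (h n) x z.1)
    (fun n => ((measurable_truncate _).comp measurable_snd).mul ((hkm n).comp measurable_fst))
    (C := c * κ + A₁ + A₂)
    (by positivity) ?_ (fun n => ⟨(c * Real.log n) * (|1 / h n| * κ), fun z => ?_⟩) ?_ ?_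
  · filter_upwards [hr.h_pos] with n hh z
    rw [abs_mul, abs_of_nonneg (hK.kernelAt_nonneg hh _ _)]
    calc _ ≤ (c * Real.log n) * (κ / h n) :=
          mul_le_mul (abs_truncate_le (hL0 n) _) (hK.kernelAt_le hh _ _)
            (hK.kernelAt_nonneg hh _ _) (hL0 n)
      _ = (c * κ) * (Real.log n / h n) := by ring
      _ ≤ _ := by
        have : 0 ≤ Real.log n / h n := div_nonneg (Real.log_natCast_nonneg n) hh.le
        gcongr
        linarith
  · rw [abs_mul]
    exact mul_le_mul (abs_truncate_le (hL0 n) _) (hK.abs_kernelAt_le _ _ _) (abs_nonneg _) (hL0 n)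
  · filter_upwards [hr.h_pos] with n hh
    have hk2m : Measurable fun u => kernelAt K (h n) x u ^ 2 := (hkm n).pow_const 2
    have hk2b : ∀ u, kernelAt K (h n) x u ^ 2 ≤ (κ / h n) ^ 2 := fun u =>
      pow_le_pow_left₀ (hK.kernelAt_nonneg hh x u) (hK.kernelAt_le hh x u) 2
    have h1 := integral_sq_mul_comp_le (H.measurable_X 0) (hm.integrable_sq (H.measurable_Y 0)) hC₄
      hk2m (fun u => sq_nonneg _) hk2b
    have h2 := hK.integral_sq_kernelAt_comp_le (H.measurable_X 0) hd.hasPDF_X hCf hh x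
    have h3 : 0 ≤ ∫ ω, kernelAt K (h n) x (X 0 ω) ^ 2 ∂μ := integral_nonneg fun _ => sq_nonneg _
    calc _ ≤ ∫ ω, Y 0 ω ^ 2 * kernelAt K (h n) x (X 0 ω) ^ 2 ∂μ := by
          refine integral_mono_of_nonneg (ae_of_all _ fun _ => sq_nonneg _) ?_
            (ae_of_all _ fun ω => ?_)
          · simp only [mul_comm (Y 0 _ ^ 2)]
            refine (hm.integrable_sq (H.measurable_Y 0)).bdd_mul (c := (κ / h n) ^ 2)
              (hk2m.comp (H.measurable_X 0)).aestronglyMeasurable (ae_of_all _ fun ω => ?_)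
            rw [Real.norm_eq_abs, abs_of_nonneg (sq_nonneg _)]
            exact hk2b _
          · simp only [mul_pow]
            exact mul_le_mul_of_nonneg_right (sq_le_sq.mpr (abs_truncate_le_abs _ _))
              (sq_nonneg _)
      _ ≤ |C₄| * ((κ * (|Cf| * ∫ u, K u)) / h n) :=
          h1.trans (mul_le_mul (le_abs_self _) h2 h3 (abs_nonneg _))
      _ = A₁ / h n := by rw [hA₁]; ring
      _ ≤ _ := by gcongr; nlinarith [mul_pos hc hκ]
  · filter_upwards [hr.h_pos] with n hh d hd1
    have h1 := ofReal_abs_covariance_response_le H.measurable_X H.measurable_Y hd.hasPDF_XY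
      (hd.hasPDF_four d hd1) (hkm n) (hK.kernelAt_nonneg hh x) (hK.kernelAt_le hh x)
      (measurable_truncate (c * Real.log n)) (abs_truncate_le (hL0 n)) (abs_truncate_le_abs _)
    have h2 := hK.lintegral_kernelAt_mul_le hh x (P := p) (C := C₃) (by linarith)
      (measurable_lagG (μ := μ) (X := X) (Y := Y) d) (by
        have := hG d hd1
        rwa [eLpNorm_eq_lintegral_rpow_enorm_toReal (by simp; linarith) ENNReal.ofReal_ne_top,
          ENNReal.toReal_ofReal (by linarith)] at this)
    have h3 := abs_le_of_ofReal_le (by positivity) (h1.trans h2)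
    refine h3.trans ?_
    rw [show -(1 - (1 - 2 / p)) = -(2 / p) by ring]
    gcongr
    nlinarith [mul_pos hc hκ]

end

/-! ### From capped kernels and truncated responses back to the sums in the estimators -/

section

variable {Ω : Type*} [m0 : MeasurableSpace Ω] {μ : Measure Ω}

lemma StationaryPair.ae_kernelAt_eq {X Y : ℕ → Ω → ℝ} (H : StationaryPair μ X Y)
    (hX : HasPDF (X 0) μ volume) {K K' : ℝ → ℝ} (hKK : K =ᵐ[volume] K') (h : ℕ → ℝ) (x : ℝ) :
    ∀ᵐ ω ∂μ, ∀ n s, h n ≠ 0 → kernelAt K (h n) x (X s ω) = kernelAt K' (h n) x (X s ω) := by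
  rw [ae_all_iff]; intro n
  rw [ae_all_iff]; intro s
  by_cases hn : h n = 0
  · exact ae_of_all _ fun ω h => absurd hn h
  have hac : μ.map (X s) ≪ volume := by
    have : μ.map (X s) = μ.map (X 0) :=
      ((H.identDistrib_pair s).comp measurable_fst).map_eq
    rw [this]
    exact hX.absolutelyContinuous'
  filter_upwards [ae_of_ae_map (H.measurable_X s).aemeasurable
    (hac.ae_le (NWChange.ae_kernelAt_eq hKK hn x))] with ω hω _
  exact hω

/-- At the level (4/c) log n the exponential moment gives probability O(n⁻⁴) for each time, hence
O(n⁻³) for the whole sample, which is summable. The truncation is thus eventually inactive at all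
times s ≤ n. -/
lemma ae_eventually_abs_le_log [IsProbabilityMeasure μ] {X Y : ℕ → Ω → ℝ}
    (H : StationaryPair μ X Y) {c : ℝ} (hc : 0 < c)
    (hi : Integrable (fun ω => Real.exp (c * |Y 0 ω|)) μ) :
    ∀ᵐ ω ∂μ, ∀ᶠ n : ℕ in atTop, ∀ s ≤ n, |Y s ω| ≤ 4 / c * Real.log n := by
  set E := ∫ ω, Real.exp (c * |Y 0 ω|) ∂μ with hE
  have hE0 : 0 ≤ E := integral_nonneg fun _ => (Real.exp_pos _).le
  have key : ∀ n s : ℕ, 1 ≤ n →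
      μ.real {ω | 4 / c * Real.log n < |Y s ω|} ≤ E * (n : ℝ) ^ (-4 : ℝ) := by
    intro n s hn
    have hn0 : (0 : ℝ) < n := by exact_mod_cast hn
    have e1 : μ {ω | 4 / c * Real.log n < |Y s ω|} = μ {ω | 4 / c * Real.log n < |Y 0 ω|} :=
      ((H.identDistrib_pair s).comp measurable_snd).measure_mem_eq
        (s := {y : ℝ | 4 / c * Real.log n < |y|})
        (measurableSet_lt measurable_const measurable_norm)
    have e2 := mul_meas_ge_le_integral_of_nonneg (ae_of_all μ fun ω => (Real.exp_pos _).le) hi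
      ((n : ℝ) ^ (4 : ℝ))
    rw [measureReal_def, e1, ← measureReal_def, Real.rpow_neg hn0.le, ← div_eq_mul_inv,
      le_div_iff₀ (by positivity), mul_comm]
    refine le_trans (mul_le_mul_of_nonneg_left (measureReal_mono fun ω hω => ?_)
      (by positivity)) e2
    simp only [Set.mem_ofPred_eq] at hω ⊢
    rw [Real.rpow_def_of_pos hn0]
    refine Real.exp_le_exp.mpr ?_
    rw [div_mul_eq_mul_div, div_lt_iff₀ hc] at hω
    linarith
  have hsum : Summable fun n : ℕ => 2 * E * (n : ℝ) ^ (-3 : ℝ) :=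
    (Real.summable_nat_rpow.mpr (by norm_num)).mul_left _
  have := ae_eventually_notMem_of_summable (μ := μ) (s := fun n : ℕ =>
    ⋃ s ∈ Finset.range (n + 1), {ω | 4 / c * Real.log n < |Y s ω|}) hsum (by
      filter_upwards [eventually_ge_atTop 1] with n hn
      have hn0 : (1 : ℝ) ≤ n := by exact_mod_cast hn
      calc _ ≤ ∑ s ∈ Finset.range (n + 1), μ.real {ω | 4 / c * Real.log n < |Y s ω|} :=
            measureReal_biUnion_finset_le _ _
        _ ≤ ∑ s ∈ Finset.range (n + 1), E * (n : ℝ) ^ (-4 : ℝ) :=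
            Finset.sum_le_sum fun s _ => key n s hn
        _ = (n + 1) * (E * (n : ℝ) ^ (-4 : ℝ)) := by simp
        _ ≤ (2 * n) * (E * (n : ℝ) ^ (-4 : ℝ)) := by gcongr; linarith
        _ = 2 * E * ((n : ℝ) ^ (-4 : ℝ) * n) := by ring
        _ = _ := by
            rw [← Real.rpow_add_one (by linarith)]
            norm_num)
  filter_upwards [this] with ω hω
  filter_upwards [hω] with n hn s hs
  simp only [Set.mem_iUnion, not_exists, Set.mem_ofPred_eq, not_lt] at hn
  exact hn s (Finset.mem_range.mpr (by omega))

/-- Uniform deviations of the sums in the kernel density estimator. -/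
theorem ae_eventually_abs_sum_kernel_le [IsProbabilityMeasure μ] {X Y : ℕ → Ω → ℝ}
    (H : StationaryPair μ X Y) {R : MixingRegime} {h : ℕ → ℝ} {K : ℝ → ℝ}
    (hK : KernelCondition K) (hR : R.Admissible) (hb : BandwidthCondition h R)
    (hd : DensityCondition μ X Y R) {W : ℕ → ℕ → Ω → ℝ × ℝ} {a e : ℕ → ℕ}
    (hW : MixingStretch μ X Y W a e R) (x : ℝ) :
    ∃ C' : ℝ, 0 < C' ∧ ∀ᵐ ω ∂μ, ∀ᶠ n : ℕ in atTop, ∀ t ≤ e n,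
      |∑ s ∈ Finset.Ioc (a n) t,
        (kernelAt K (h n) x (X s ω) - ∫ ω, kernelAt K (h n) x (X 0 ω) ∂μ)| ≤
        C' * (n * devRate h n) := by
  obtain ⟨κ, hK', hKK, -⟩ := hK.exists_bddKernel
  obtain ⟨p, -, hp, hRp, -⟩ := hd.lagF_bounded
  obtain ⟨γ, w, c₁, c₂, C, hr, -, -, -⟩ := exists_rateSetup hR hb hp hRp
  obtain ⟨C', hC', hdev⟩ := ae_eventually_abs_sum_kernelAt_le H hK' hR hb hd hW x
  refine ⟨C', hC', ?_⟩
  have hae := H.ae_kernelAt_eq hd.hasPDF_X hKK h x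
  filter_upwards [hdev, hae] with ω h1 h2
  filter_upwards [h1, hr.h_pos] with n hn hpos t ht
  have e1 : ∫ ω, kernelAt K (h n) x (X 0 ω) ∂μ =
      ∫ ω, kernelAt (cappedKernel K κ) (h n) x (X 0 ω) ∂μ :=
    integral_congr_ae (hae.mono fun ω hω => hω n 0 hpos.ne')
  simp only [e1, h2 n _ hpos.ne']
  exact hn t ht

/-- Uniform deviations of the sums in the numerator of the Nadaraya-Watson estimator. -/
theorem ae_eventually_abs_sum_response_mul_kernel_le [IsProbabilityMeasure μ] {X Y : ℕ → Ω → ℝ}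
    (H : StationaryPair μ X Y) {R : MixingRegime} {h : ℕ → ℝ} {K : ℝ → ℝ}
    (hK : KernelCondition K) (hR : R.Admissible) (hb : BandwidthCondition h R)
    (hd : DensityCondition μ X Y R) (hm : MomentCondition μ X Y)
    {W : ℕ → ℕ → Ω → ℝ × ℝ} {a e : ℕ → ℕ} (hW : MixingStretch μ X Y W a e R) (x : ℝ) :
    ∃ C' : ℝ, 0 < C' ∧ ∀ᵐ ω ∂μ, ∀ᶠ n : ℕ in atTop, ∀ t ≤ e n,
      |∑ s ∈ Finset.Ioc (a n) t,
        (Y s ω * kernelAt K (h n) x (X s ω) -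
          ∫ ω, Y 0 ω * kernelAt K (h n) x (X 0 ω) ∂μ)| ≤ C' * (n * devRate h n) := by
  obtain ⟨κ, hK', hKK, -⟩ := hK.exists_bddKernel
  obtain ⟨p, -, hp, hRp, -⟩ := hd.lagF_bounded
  obtain ⟨γ, w, c₁, c₂, C, hr, -, -, -⟩ := exists_rateSetup hR hb hp hRp
  obtain ⟨c, hc, hi⟩ := hm.expMoment
  set E := ∫ ω, Real.exp (c * |Y 0 ω|) ∂μ with hE
  have hE0 : 0 ≤ E := integral_nonneg fun _ => (Real.exp_pos _).le
  have hκ := hK'.pos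
  obtain ⟨C', hC', hdev⟩ := ae_eventually_abs_sum_truncate_mul_kernelAt_le H hK' hR hb hd hm hW x
    (show 0 < 4 / c by positivity)
  set B := κ * (2 / c) * E with hB
  have hB0 : 0 ≤ B := by positivity
  refine ⟨C' + B, by positivity, ?_⟩
  have hae := H.ae_kernelAt_eq hd.hasPDF_X hKK h x
  have hYi := hm.integrable (H.measurable_Y 0)
  filter_upwards [hdev, hae, ae_eventually_abs_le_log H hc hi] with ω h1 h2 h3
  filter_upwards [h1, h3, hr.h_pos, hr.one_le_mul_h, hr.one_le_mul_devRate, eventually_ge_atTop 1]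
    with n hn hYn hpos hnh hdr hn1 t ht
  have hn0 : (0 : ℝ) < n := by exact_mod_cast hn1
  have htn := ht.trans (hW.le n)
  set k := kernelAt (cappedKernel K κ) (h n) x with hk
  have hkm : Measurable k := hK'.measurable_kernelAt _ _
  have hkb : ∀ u, |k u| ≤ κ / h n := fun u => by
    rw [abs_of_nonneg (hK'.kernelAt_nonneg hpos x u)]
    exact hK'.kernelAt_le hpos x u
  set L := 4 / c * Real.log n with hL
  have hL0 : 0 ≤ L := mul_nonneg (by positivity) (Real.log_natCast_nonneg n)
  have e1 : ∫ ω, Y 0 ω * kernelAt K (h n) x (X 0 ω) ∂μ = ∫ ω, Y 0 ω * k (X 0 ω) ∂μ :=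
    integral_congr_ae (hae.mono fun ω hω => by simp only [hω n 0 hpos.ne', hk])
  have hki : ∀ {f : Ω → ℝ}, Integrable f μ → Integrable (fun ω => f ω * k (X 0 ω)) μ := by
    intro f hf
    simp only [mul_comm (f _)]
    exact hf.bdd_mul (hkm.comp (H.measurable_X 0)).aestronglyMeasurable
      (ae_of_all _ fun ω => hkb _)
  have htr : Integrable (fun ω => truncate L (Y 0 ω)) μ :=
    .of_bound ((measurable_truncate L).comp (H.measurable_Y 0)).aestronglyMeasurable L
      (ae_of_all _ fun ω => abs_truncate_le hL0 _)
  -- The bias of the mean caused by truncation.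
  set b := ∫ ω, truncate L (Y 0 ω) * k (X 0 ω) ∂μ - ∫ ω, Y 0 ω * k (X 0 ω) ∂μ with hb
  have hbias : |b| ≤ κ / h n * ((2 / c) * Real.exp (-(c / 2 * L)) * E) := by
    rw [hb, ← integral_sub (hki htr) (hki hYi), ← integral_const_mul, ← integral_const_mul]
    refine abs_integral_le_integral_abs.trans (integral_mono_of_nonneg
      (ae_of_all _ fun _ => abs_nonneg _) ((hi.const_mul _).const_mul _) (ae_of_all _ fun ω => ?_))
    simp only [← sub_mul, abs_mul]
    rw [mul_comm]
    refine mul_le_mul (hkb _) ?_ (abs_nonneg _) (by positivity)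
    rw [abs_sub_comm]
    exact abs_sub_truncate_le hc _
  -- The level (4/c) log n makes the bias O(n⁻² / h_n), so that n such terms add up to O(1/(n h_n)),
  -- which is bounded.
  have hexp : Real.exp (-(c / 2 * L)) = 1 / (n : ℝ) ^ 2 := by
    rw [hL, show -(c / 2 * (4 / c * Real.log n)) = -(2 * Real.log n) by field_simp; norm_num,
      Real.exp_neg, ← Real.log_rpow hn0, Real.exp_log (by positivity), Real.rpow_two, one_div]
  have hsum : ∑ s ∈ Finset.Ioc (a n) t, (Y s ω * kernelAt K (h n) x (X s ω) -
      ∫ ω, Y 0 ω * kernelAt K (h n) x (X 0 ω) ∂μ) =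
      ∑ s ∈ Finset.Ioc (a n) t, (truncate L (Y s ω) * k (X s ω) -
        ∫ ω, truncate L (Y 0 ω) * k (X 0 ω) ∂μ) + (Finset.Ioc (a n) t).card * b := by
    rw [← nsmul_eq_mul, ← Finset.sum_const, ← Finset.sum_add_distrib]
    refine Finset.sum_congr rfl fun s hs => ?_
    have hs' := Finset.mem_Ioc.mp hs
    rw [e1, h2 n s hpos.ne', ← hk, hb, truncate, if_pos (hYn s (by omega))]
    ring
  rw [hsum]
  have hcard : ((Finset.Ioc (a n) t).card : ℝ) ≤ n := by
    rw [Nat.card_Ioc]; exact_mod_cast (by omega : t - a n ≤ n)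
  have hfin : ((Finset.Ioc (a n) t).card : ℝ) * |b| ≤ B * (n * devRate h n) := by
    calc ((Finset.Ioc (a n) t).card : ℝ) * |b|
        ≤ n * (κ / h n * ((2 / c) * (1 / (n : ℝ) ^ 2) * E)) := by
          rw [← hexp]
          exact mul_le_mul hcard hbias (abs_nonneg _) hn0.le
      _ = B / (n * h n) := by rw [hB]; field_simp
      _ ≤ B := div_le_self hB0 hnh
      _ ≤ B * (n * devRate h n) := le_mul_of_one_le_right hB0 hdr
  calc _ ≤ _ := abs_add_le _ _
    _ ≤ C' * (n * devRate h n) + B * (n * devRate h n) := by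
        refine add_le_add (hn t ht) ?_
        rw [abs_mul, abs_of_nonneg (Nat.cast_nonneg _)]
        exact hfin
    _ = _ := by ring

end

section

variable {Ω : Type*} [m0 : MeasurableSpace Ω] {μ : Measure Ω}

/-! ### Expectations of kernel averages -/

/-- After the substitution v = (u - x)/h the mass outside the ball is the mass of K where h|v| ≥ r,
which vanishes by dominated convergence. -/
lemma BddKernel.tendsto_integral_kernelAt_compl_ball {K : ℝ → ℝ} {κ : ℝ} (hK : BddKernel K κ)
    {h : ℕ → ℝ} (hh : Tendsto h atTop (𝓝 0)) (hpos : ∀ᶠ n in atTop, 0 < h n) (x : ℝ) {r : ℝ}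
    (hr : 0 < r) :
    Tendsto (fun n => ∫ u in (Metric.ball x r)ᶜ, kernelAt K (h n) x u) atTop (𝓝 0) := by
  have h1 : Tendsto (fun n => ∫ v, {v : ℝ | r ≤ h n * |v|}.indicator K v) atTop
      (𝓝 (∫ _ : ℝ, (0 : ℝ))) := by
    refine tendsto_integral_of_dominated_convergence K (fun n => ?_) hK.integrable
      (fun n => ae_of_all _ fun v => ?_) (ae_of_all _ fun v => ?_)
    · exact hK.measurable.aestronglyMeasurable.indicator
        (measurableSet_le measurable_const (measurable_norm.const_mul _))
    · rw [Real.norm_eq_abs, abs_of_nonneg (Set.indicator_nonneg (fun _ _ => hK.nonneg _) _)]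
      exact Set.indicator_le_self' (fun _ _ => hK.nonneg _) _
    · have h2 : Tendsto (fun n => h n * |v|) atTop (𝓝 0) := by simpa using hh.mul_const |v|
      refine tendsto_const_nhds.congr' ?_
      filter_upwards [h2.eventually (gt_mem_nhds hr)] with n hn
      rw [Set.indicator_of_notMem (by simpa using hn)]
  rw [integral_zero] at h1
  refine h1.congr' ?_
  filter_upwards [hpos] with n hn
  rw [← integral_kernelAt _ hn x, ← integral_indicator Metric.isOpen_ball.measurableSet.compl]
  congr 1
  ext u
  have e : u ∈ (Metric.ball x r)ᶜ ↔ (u - x) / h n ∈ {v : ℝ | r ≤ h n * |v|} := by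
    simp only [Set.mem_compl_iff, Metric.mem_ball, not_lt, Set.mem_ofPred_eq, Real.dist_eq, abs_div,
      abs_of_pos hn]
    rw [mul_div_cancel₀ _ hn.ne']
  by_cases hu : u ∈ (Metric.ball x r)ᶜ
  · rw [Set.indicator_of_mem hu, kernelAt, scaledKernel, kernelAt, scaledKernel,
      Set.indicator_of_mem (e.mp hu)]
  · rw [Set.indicator_of_notMem hu, kernelAt, scaledKernel,
      Set.indicator_of_notMem (fun h => hu (e.mpr h)), mul_zero]

/-- Eventually at least half of the kernel mass lies in the ball on which the density is bounded
below. -/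
lemma BddKernel.eventually_le_integral_kernelAt_comp [IsProbabilityMeasure μ] {K : ℝ → ℝ} {κ : ℝ}
    (hK : BddKernel K κ) (hI : 0 < ∫ u, K u) {X : ℕ → Ω → ℝ} (hXm : Measurable (X 0))
    (hX : HasPDF (X 0) μ volume) {x : ℝ} (hx : DensityPositiveNear μ X x)
    {h : ℕ → ℝ} (hh : Tendsto h atTop (𝓝 0)) (hpos : ∀ᶠ n in atTop, 0 < h n) :
    ∃ c₀ : ℝ, 0 < c₀ ∧ ∀ᶠ n in atTop, c₀ ≤ ∫ ω, kernelAt K (h n) x (X 0 ω) ∂μ := by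
  obtain ⟨c, r, hc, hr, hcr⟩ := hx
  refine ⟨c * ((∫ u, K u) / 2), by positivity, ?_⟩
  filter_upwards [hpos, (hK.tendsto_integral_kernelAt_compl_ball hh hpos x hr).eventually
    (gt_mem_nhds (half_pos hI))] with n hn htail
  have hball := Metric.isOpen_ball (x := x) (ε := r) |>.measurableSet
  have hki := hK.integrable_kernelAt hn x
  have h1 : ∫ u in Metric.ball x r, kernelAt K (h n) x u ≥ (∫ u, K u) / 2 := by
    have := integral_add_compl hball hki
    rw [integral_kernelAt K hn x] at this
    linarith
  have hdi := integrable_mul_toReal_pdf hX hXm (hK.measurable_kernelAt (h n) x)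
    (fun u => hK.abs_kernelAt_le (h n) x u)
  rw [← integral_mul_toReal_pdf hX (hK.measurable_kernelAt (h n) x)]
  calc c * ((∫ u, K u) / 2) ≤ c * ∫ u in Metric.ball x r, kernelAt K (h n) x u := by gcongr
    _ = ∫ u in Metric.ball x r, c * kernelAt K (h n) x u := (integral_const_mul _ _).symm
    _ ≤ ∫ u in Metric.ball x r, kernelAt K (h n) x u * (pdf (X 0) μ volume u).toReal := by
        refine integral_mono_ae (hki.integrableOn.const_mul c) hdi.integrableOn ?_
        filter_upwards [hcr] with u hu
        rw [mul_comm]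
        exact mul_le_mul_of_nonneg_left hu (hK.kernelAt_nonneg hn x u)
    _ ≤ _ := setIntegral_le_integral hdi
        (ae_of_all _ fun u => mul_nonneg (hK.kernelAt_nonneg hn x u) ENNReal.toReal_nonneg)

lemma integral_congr_kernelAt {X : ℕ → Ω → ℝ} (hXm : Measurable (X 0))
    (hX : HasPDF (X 0) μ volume) {K K' : ℝ → ℝ} (hKK : K =ᵐ[volume] K') {h : ℝ} (hh : h ≠ 0)
    (x : ℝ) (Y : Ω → ℝ) :
    ∫ ω, Y ω * kernelAt K h x (X 0 ω) ∂μ = ∫ ω, Y ω * kernelAt K' h x (X 0 ω) ∂μ := by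
  refine integral_congr_ae ?_
  filter_upwards [ae_of_ae_map hXm.aemeasurable
    (hX.absolutelyContinuous'.ae_le (ae_kernelAt_eq hKK hh x))] with ω hω
  rw [hω]

/-- The expectation `E K_h(X_0 - x)`. -/
noncomputable def meanKernel (μ : Measure Ω) (X : ℕ → Ω → ℝ) (K : ℝ → ℝ) (h x : ℝ) : ℝ :=
  ∫ ω, kernelAt K h x (X 0 ω) ∂μ

/-- The expectation `E Y_0 K_h(X_0 - x)`. -/
noncomputable def meanResponse (μ : Measure Ω) (X Y : ℕ → Ω → ℝ) (K : ℝ → ℝ) (h x : ℝ) : ℝ :=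
  ∫ ω, Y 0 ω * kernelAt K h x (X 0 ω) ∂μ

lemma meanKernel_congr {X : ℕ → Ω → ℝ} (hXm : Measurable (X 0))
    (hX : HasPDF (X 0) μ volume) {K K' : ℝ → ℝ} (hKK : K =ᵐ[volume] K') {h : ℝ} (hh : h ≠ 0)
    (x : ℝ) : meanKernel μ X K h x = meanKernel μ X K' h x := by
  simpa [meanKernel] using integral_congr_kernelAt hXm hX hKK hh x (fun _ => 1)

lemma KernelCondition.eventually_le_meanKernel [IsProbabilityMeasure μ] {K : ℝ → ℝ}
    (hK : KernelCondition K) {X : ℕ → Ω → ℝ} (hXm : Measurable (X 0))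
    (hX : HasPDF (X 0) μ volume) {x : ℝ} (hx : DensityPositiveNear μ X x)
    {h : ℕ → ℝ} (hh : Tendsto h atTop (𝓝 0)) (hpos : ∀ᶠ n in atTop, 0 < h n) :
    ∃ c₀ : ℝ, 0 < c₀ ∧ ∀ᶠ n in atTop, c₀ ≤ meanKernel μ X K (h n) x := by
  obtain ⟨κ, hK', hKK, hI⟩ := hK.exists_bddKernel
  obtain ⟨c₀, hc₀, h1⟩ := hK'.eventually_le_integral_kernelAt_comp (by rw [hI]; exact hK.integral_pos)
    hXm hX hx hh hpos
  refine ⟨c₀, hc₀, ?_⟩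
  filter_upwards [h1, hpos] with n hn hn0
  rw [meanKernel_congr hXm hX hKK hn0.ne' x]
  exact hn

/-- From |Y| ≤ 1 + Y² and the bounded conditional second moment, the mean response is controlled by
the mean kernel, which is bounded uniformly in h because the density is. -/
lemma KernelCondition.abs_meanResponse_le [IsProbabilityMeasure μ] {K : ℝ → ℝ}
    (hK : KernelCondition K) {X Y : ℕ → Ω → ℝ} (hXm : Measurable (X 0)) (hYm : Measurable (Y 0))
    {R : MixingRegime} (hd : DensityCondition μ X Y R) (hm : MomentCondition μ X Y) (x : ℝ) :
    ∃ C : ℝ, 0 < C ∧ ∀ h, 0 < h → |meanResponse μ X Y K h x| ≤ C := by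
  obtain ⟨κ, hK', hKK, hI⟩ := hK.exists_bddKernel
  obtain ⟨Cf, hCf⟩ := hd.f_bounded
  obtain ⟨C₄, hC₄⟩ := hm.condSecondMoment
  have hI0 := hK.integral_pos
  refine ⟨(1 + |C₄|) * (|Cf| * ∫ u, K u) + 1, by positivity, fun h hh => ?_⟩
  set k := kernelAt (cappedKernel K κ) h x with hk
  have hkm : Measurable k := hK'.measurable_kernelAt _ _
  have hk0 : ∀ u, 0 ≤ k u := hK'.kernelAt_nonneg hh x
  have hkle : ∀ u, k u ≤ κ / h := hK'.kernelAt_le hh x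
  have hkb : ∀ᵐ ω ∂μ, ‖k (X 0 ω)‖ ≤ κ / h := ae_of_all _ fun ω => by
    rw [Real.norm_eq_abs, abs_of_nonneg (hk0 _)]; exact hkle _
  have hkX : AEStronglyMeasurable (fun ω => k (X 0 ω)) μ := (hkm.comp hXm).aestronglyMeasurable
  have hki : Integrable (fun ω => k (X 0 ω)) μ := .of_bound hkX _ hkb
  have hY2 := hm.integrable_sq hYm
  have hY2k : Integrable (fun ω => Y 0 ω ^ 2 * k (X 0 ω)) μ := by
    simp only [mul_comm (Y 0 _ ^ 2)]
    exact hY2.bdd_mul hkX hkb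
  have hf : ∫ ω, k (X 0 ω) ∂μ ≤ |Cf| * ∫ u, K u := by
    have := integral_comp_le_of_densX_le hXm hd.hasPDF_X hCf hkm hk0 hkle
      (hK'.integrable_kernelAt hh x)
    rw [integral_kernelAt _ hh x, hI] at this
    exact this.trans (mul_le_mul_of_nonneg_right (le_abs_self Cf) hI0.le)
  have hf0 : 0 ≤ ∫ ω, k (X 0 ω) ∂μ := integral_nonneg fun _ => hk0 _
  have h2 := integral_sq_mul_comp_le hXm hY2 hC₄ hkm hk0 hkle
  rw [meanResponse, integral_congr_kernelAt hXm hd.hasPDF_X hKK hh.ne' x]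
  calc _ ≤ ∫ ω, |Y 0 ω * k (X 0 ω)| ∂μ := abs_integral_le_integral_abs
    _ ≤ ∫ ω, (k (X 0 ω) + Y 0 ω ^ 2 * k (X 0 ω)) ∂μ := by
        refine integral_mono_of_nonneg (ae_of_all _ fun _ => abs_nonneg _) (hki.add hY2k)
          (ae_of_all _ fun ω => ?_)
        simp only [abs_mul, abs_of_nonneg (hk0 _)]
        have : |Y 0 ω| ≤ 1 + Y 0 ω ^ 2 := by
          rw [← sq_abs]; nlinarith [sq_nonneg (|Y 0 ω| - 1)]
        nlinarith [hk0 (X 0 ω)]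
    _ = ∫ ω, k (X 0 ω) ∂μ + ∫ ω, Y 0 ω ^ 2 * k (X 0 ω) ∂μ := integral_add hki hY2k
    _ ≤ (1 + |C₄|) * ∫ ω, k (X 0 ω) ∂μ := by
        have := mul_le_mul_of_nonneg_right (le_abs_self C₄) hf0
        linarith
    _ ≤ (1 + |C₄|) * (|Cf| * ∫ u, K u) := by gcongr
    _ ≤ _ := by linarith

/-- At time k the array follows the first regime and at time k + 1 the second. Stationarity of each
regime moves both expectations to time 0, where they share the same denominator. -/
lemma StationaryPair.smoothedJump_eq {X : ℕ → Ω → ℝ} {ε : ℕ → Ω → ℝ} {φ₁ φ₂ : ℝ → ℝ}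
    (H₁ : StationaryPair μ X (response φ₁ X ε)) (H₂ : StationaryPair μ X (response φ₂ X ε))
    {K : ℝ → ℝ} (hK : Measurable K) (h θ x : ℝ) (n : ℕ) :
    smoothedJump μ K h X (changeArray φ₁ φ₂ X ε θ n) (changeTime θ n) x =
      (meanResponse μ X (response φ₁ X ε) K h x - meanResponse μ X (response φ₂ X ε) K h x) /
        meanKernel μ X K h x := by
  have hkm : Measurable (kernelAt K h x) := by
    unfold kernelAt scaledKernel
    exact (hK.comp ((measurable_id.sub_const x).div_const h)).const_mul _
  have e0 : ∀ s, ∫ ω, scaledKernel K h (X s ω - x) ∂μ = meanKernel μ X K h x := fun s =>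
    H₁.integral_comp (q := fun z => kernelAt K h x z.1) (hkm.comp measurable_fst) s
  have e1 : ∫ ω, changeArray φ₁ φ₂ X ε θ n (changeTime θ n) ω *
      scaledKernel K h (X (changeTime θ n) ω - x) ∂μ =
        meanResponse μ X (response φ₁ X ε) K h x := by
    simp only [changeArray, responseChange, le_refl, if_true]
    exact H₁.integral_comp (q := fun z => z.2 * kernelAt K h x z.1)
      (measurable_snd.mul (hkm.comp measurable_fst)) _
  have e2 : ∫ ω, changeArray φ₁ φ₂ X ε θ n (changeTime θ n + 1) ω *
      scaledKernel K h (X (changeTime θ n + 1) ω - x) ∂μ =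
        meanResponse μ X (response φ₂ X ε) K h x := by
    simp only [changeArray, responseChange, show ¬ changeTime θ n + 1 ≤ changeTime θ n by omega,
      if_false]
    exact H₂.integral_comp (q := fun z => z.2 * kernelAt K h x z.1)
      (measurable_snd.mul (hkm.comp measurable_fst)) _
  rw [smoothedJump, e0, e0, e1, e2, sub_div]

/-- The smoothed jump of bounded regression functions that are separated near `x`, up to sign. -/
lemma KernelCondition.eventually_le_meanResponse_sub [IsProbabilityMeasure μ] {K : ℝ → ℝ}
    (hK : KernelCondition K) {X ε : ℕ → Ω → ℝ} (hXm : Measurable (X 0))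
    (hε : Integrable (ε 0) μ) {φ₁ φ₂ : ℝ → ℝ}
    (hφ₁ : Measurable φ₁) (hφ₂ : Measurable φ₂) {B₁ B₂ : ℝ} (hB₁ : ∀ u, |φ₁ u| ≤ B₁)
    (hB₂ : ∀ u, |φ₂ u| ≤ B₂) (hX : HasPDF (X 0) μ volume) {Cf : ℝ}
    (hCf : ∀ᵐ u ∂(volume : Measure ℝ), densX μ X u ≤ Cf) {x : ℝ}
    (hx : DensityPositiveNear μ X x) {h : ℕ → ℝ} (hh : Tendsto h atTop (𝓝 0))
    (hpos : ∀ᶠ n in atTop, 0 < h n) {c : ℝ} (hc : 0 < c)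
    (hsep : ∀ᶠ u in 𝓝 x, c ≤ φ₁ u - φ₂ u) :
    ∀ᶠ n in atTop, c / 2 ≤ (meanResponse μ X (response φ₁ X ε) K (h n) x -
      meanResponse μ X (response φ₂ X ε) K (h n) x) / meanKernel μ X K (h n) x := by
  obtain ⟨c₀, hc₀, hmk⟩ := hK.eventually_le_meanKernel hXm hX hx hh hpos
  obtain ⟨κ, hK', hKK, hI⟩ := hK.exists_bddKernel
  obtain ⟨r, hr, hball⟩ := Metric.eventually_nhds_iff_ball.mp hsep
  have hB₁0 : 0 ≤ B₁ := (abs_nonneg _).trans (hB₁ 0)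
  have hB₂0 : 0 ≤ B₂ := (abs_nonneg _).trans (hB₂ 0)
  have htend := ((hK'.tendsto_integral_kernelAt_compl_ball hh hpos x hr).const_mul
    ((c + B₁ + B₂) * |Cf|))
  rw [mul_zero] at htend
  filter_upwards [hmk, hpos, htend.eventually (gt_mem_nhds (show 0 < c / 2 * c₀ by positivity))]
    with n hn hn0 htail
  set k := kernelAt (cappedKernel K κ) (h n) x with hk
  have hkm : Measurable k := hK'.measurable_kernelAt _ _
  have hk0 : ∀ u, 0 ≤ k u := hK'.kernelAt_nonneg hn0 x
  have hkle : ∀ u, k u ≤ κ / h n := hK'.kernelAt_le hn0 x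
  have hkb : ∀ᵐ ω ∂μ, ‖k (X 0 ω)‖ ≤ κ / h n := ae_of_all _ fun ω => by
    rw [Real.norm_eq_abs, abs_of_nonneg (hk0 _)]; exact hkle _
  have hkX : AEStronglyMeasurable (fun ω => k (X 0 ω)) μ := (hkm.comp hXm).aestronglyMeasurable
  have hki : Integrable (fun ω => k (X 0 ω)) μ := .of_bound hkX _ hkb
  have hmul : ∀ {f : Ω → ℝ}, Integrable f μ → Integrable (fun ω => f ω * k (X 0 ω)) μ := by
    intro f hf
    simp only [mul_comm (f _)]
    exact hf.bdd_mul hkX hkb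
  have hφi : ∀ {φ : ℝ → ℝ} {B : ℝ}, Measurable φ → (∀ u, |φ u| ≤ B) →
      Integrable (response φ X ε 0) μ := fun hφ hB =>
    (Integrable.of_bound (hφ.comp hXm).aestronglyMeasurable _ (ae_of_all _ fun ω => hB _)).add hε
  set S : Set ℝ := (Metric.ball x r)ᶜ with hS
  have hSm : MeasurableSet S := Metric.isOpen_ball.measurableSet.compl
  set g : ℝ → ℝ := S.indicator k with hg
  have hgm : Measurable g := hkm.indicator hSm
  have hg0 : ∀ u, 0 ≤ g u := fun u => Set.indicator_nonneg (fun _ _ => hk0 _) u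
  have hgle : ∀ u, g u ≤ κ / h n := fun u =>
    (Set.indicator_le_self' (fun _ _ => hk0 _) u).trans (hkle u)
  have hgi : Integrable (fun ω => g (X 0 ω)) μ :=
    .of_bound (hgm.comp hXm).aestronglyMeasurable (κ / h n) (ae_of_all _ fun ω => by
      rw [Real.norm_eq_abs, abs_of_nonneg (hg0 _)]; exact hgle _)
  have hgint : ∫ ω, g (X 0 ω) ∂μ ≤ |Cf| * ∫ u in S, k u := by
    have := integral_comp_le_of_densX_le hXm hX hCf hgm hg0 hgle
      ((hK'.integrable_kernelAt hn0 x).indicator hSm)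
    rw [hg, integral_indicator hSm] at this
    exact this.trans (mul_le_mul_of_nonneg_right (le_abs_self Cf)
      (integral_nonneg fun _ => hk0 _))
  have hmk0 : 0 < meanKernel μ X K (h n) x := hc₀.trans_le hn
  rw [le_div_iff₀ hmk0]
  have e1 : meanKernel μ X K (h n) x = ∫ ω, k (X 0 ω) ∂μ :=
    meanKernel_congr hXm hX hKK hn0.ne' x
  have hdiff : meanResponse μ X (response φ₁ X ε) K (h n) x -
      meanResponse μ X (response φ₂ X ε) K (h n) x =
        ∫ ω, (φ₁ (X 0 ω) - φ₂ (X 0 ω)) * k (X 0 ω) ∂μ := by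
    rw [meanResponse, meanResponse, integral_congr_kernelAt hXm hX hKK hn0.ne' x,
      integral_congr_kernelAt hXm hX hKK hn0.ne' x,
      ← integral_sub (hmul (hφi hφ₁ hB₁)) (hmul (hφi hφ₂ hB₂))]
    congr 1; ext ω
    simp only [response]; ring
  -- Inside the ball φ₁ - φ₂ ≥ c. Outside it is at least -(B₁ + B₂), so subtracting (c + B₁ + B₂)
  -- times the kernel there restores the inequality.
  have hlow : c * ∫ ω, k (X 0 ω) ∂μ - (c + B₁ + B₂) * ∫ ω, g (X 0 ω) ∂μ ≤
      ∫ ω, (φ₁ (X 0 ω) - φ₂ (X 0 ω)) * k (X 0 ω) ∂μ := by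
    rw [← integral_const_mul, ← integral_const_mul, ← integral_sub (hki.const_mul _)
      (hgi.const_mul _)]
    refine integral_mono ((hki.const_mul _).sub (hgi.const_mul _)) (hmul ?_) fun ω => ?_
    · exact (Integrable.of_bound (hφ₁.comp hXm).aestronglyMeasurable _
        (ae_of_all _ fun ω => hB₁ _)).sub (Integrable.of_bound
          (hφ₂.comp hXm).aestronglyMeasurable _ (ae_of_all _ fun ω => hB₂ _))
    · have hkω := hk0 (X 0 ω)
      simp only []
      by_cases hω : X 0 ω ∈ S
      · rw [hg, Set.indicator_of_mem hω]
        have h1 := (abs_le.mp (hB₁ (X 0 ω))).1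
        have h2 := (abs_le.mp (hB₂ (X 0 ω))).2
        nlinarith
      · rw [hg, Set.indicator_of_notMem hω, mul_zero, sub_zero]
        have h1 := hball (X 0 ω) (not_not.mp hω)
        nlinarith
  have h3 := mul_le_mul_of_nonneg_left hgint (show 0 ≤ c + B₁ + B₂ by positivity)
  rw [hdiff]
  rw [e1] at hn ⊢
  nlinarith

end

section

/-! ### Deterministic bounds for the CUSUM statistic -/

/-- The mean of a sum of `t` terms whose expectations are `p₁` up to the time `k` and `p₂` later. -/
noncomputable def meanSum (k : ℕ) (p₁ p₂ : ℝ) (t : ℕ) : ℝ :=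
  (min t k : ℕ) * p₁ + ((t : ℝ) - (min t k : ℕ)) * p₂

/-- The factor by which the jump between the means before and after `t` shrinks when the change
happens at `k`. -/
noncomputable def jumpFactor (n k t : ℕ) : ℝ :=
  if t ≤ k then ((n : ℝ) - k) / (n - t) else (k : ℝ) / t

/-- The smallness of e keeps the random denominator above half of its mean; the numerator and
denominator errors then enter linearly. -/
lemma abs_div_sub_div_le {A B N a b e c C : ℝ} (hN : 0 < N) (hc : 0 < c) (hb : c ≤ b)
    (hA : |A - N * a| ≤ e) (hB : |B - N * b| ≤ e) (ha : |a| ≤ C) (he : e ≤ N * c / 2) :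
    |A / B - a / b| ≤ e / N * (2 / c * (1 + C / c)) := by
  have hb0 : 0 < b := hc.trans_le hb
  have he0 : 0 ≤ e := (abs_nonneg _).trans hA
  have hC0 : 0 ≤ C := (abs_nonneg _).trans ha
  have hBl : N * c / 2 ≤ B := by
    have h1 := (abs_le.mp hB).1
    have h2 : N * c ≤ N * b := by gcongr
    linarith
  have hB0 : 0 < B := lt_of_lt_of_le (by positivity) hBl
  have e1 : A / B - a / b = ((A - N * a) - a / b * (B - N * b)) / B := by
    field_simp
    ring
  rw [e1, abs_div, abs_of_pos hB0]
  have h3 : |a / b| ≤ C / c := by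
    rw [abs_div, abs_of_pos hb0]
    gcongr
  calc _ ≤ (e + C / c * e) / B := by
        refine div_le_div_of_nonneg_right ((abs_sub _ _).trans ?_) hB0.le
        rw [abs_mul]
        gcongr
    _ ≤ (e + C / c * e) / (N * c / 2) := by gcongr
    _ = _ := by field_simp

/-- A sum up to t is cut at k into two stretches, each with its own regime and error e. Control of
stretches beginning after 0 or after k is therefore enough. -/
lemma abs_sum_sub_meanSum_le {k n : ℕ} {u : ℕ → ℝ} {p₁ p₂ e : ℝ}
    (h₁ : ∀ t ≤ k, |∑ s ∈ Finset.Ioc 0 t, (u s - p₁)| ≤ e)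
    (h₂ : ∀ t ≤ n, |∑ s ∈ Finset.Ioc k t, (u s - p₂)| ≤ e) {t : ℕ} (ht : t ≤ n) :
    |∑ s ∈ Finset.Ioc 0 t, u s - meanSum k p₁ p₂ t| ≤ 2 * e := by
  have he : 0 ≤ e := (abs_nonneg _).trans (h₁ 0 (Nat.zero_le _))
  rcases le_total t k with htk | hkt
  · have := h₁ t htk
    rw [Finset.sum_sub_distrib, Finset.sum_const, Nat.card_Ioc, nsmul_eq_mul] at this
    rw [meanSum, min_eq_left htk]
    simp only [Nat.sub_zero, sub_self, zero_mul, add_zero] at this ⊢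
    linarith
  · have h3 := h₁ k le_rfl
    have h4 := h₂ t ht
    rw [Finset.sum_sub_distrib, Finset.sum_const, Nat.card_Ioc, nsmul_eq_mul] at h3 h4
    rw [Nat.cast_sub hkt] at h4
    rw [meanSum, min_eq_right hkt, ← Finset.sum_Ioc_consecutive u (Nat.zero_le k) hkt]
    rw [Nat.sub_zero] at h3
    have := abs_add_le (∑ s ∈ Finset.Ioc 0 k, u s - k * p₁)
      (∑ s ∈ Finset.Ioc k t, u s - (t - k) * p₂)
    calc _ = |(∑ s ∈ Finset.Ioc 0 k, u s - k * p₁) +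
          (∑ s ∈ Finset.Ioc k t, u s - (t - k) * p₂)| := by congr 1; ring
      _ ≤ _ := by linarith

lemma abs_sum_sub_meanSum_sub_le {k n : ℕ} {u : ℕ → ℝ} {p₁ p₂ e : ℝ}
    (h₁ : ∀ t ≤ k, |∑ s ∈ Finset.Ioc 0 t, (u s - p₁)| ≤ e)
    (h₂ : ∀ t ≤ n, |∑ s ∈ Finset.Ioc k t, (u s - p₂)| ≤ e) {t : ℕ} (ht : t ≤ n) :
    |∑ s ∈ Finset.Ioc t n, u s - (meanSum k p₁ p₂ n - meanSum k p₁ p₂ t)| ≤ 4 * e := by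
  have h3 := abs_sum_sub_meanSum_le h₁ h₂ ht
  have h4 := abs_sum_sub_meanSum_le h₁ h₂ le_rfl
  rw [← Finset.sum_Ioc_consecutive u (Nat.zero_le t) ht] at h4
  rw [abs_le] at *
  constructor <;> linarith

lemma meanSum_self (k : ℕ) (p : ℝ) (t : ℕ) : meanSum k p p t = t * p := by
  rw [meanSum]; ring

lemma abs_meanSum_le (k : ℕ) {p₁ p₂ C : ℝ} (h₁ : |p₁| ≤ C) (h₂ : |p₂| ≤ C) (t : ℕ) :
    |meanSum k p₁ p₂ t| ≤ t * C := by
  have h3 : ((min t k : ℕ) : ℝ) ≤ t := by exact_mod_cast min_le_left t k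
  refine (abs_add_le _ _).trans ?_
  rw [abs_mul, abs_mul, abs_of_nonneg (Nat.cast_nonneg _), abs_of_nonneg (sub_nonneg.mpr h3)]
  calc _ ≤ ((min t k : ℕ) : ℝ) * C + ((t : ℝ) - (min t k : ℕ)) * C := by
        have := sub_nonneg.mpr h3
        gcongr
    _ = _ := by ring

lemma abs_meanSum_sub_le {k n t : ℕ} {p₁ p₂ C : ℝ} (h₁ : |p₁| ≤ C) (h₂ : |p₂| ≤ C)
    (ht : t ≤ n) : |meanSum k p₁ p₂ n - meanSum k p₁ p₂ t| ≤ (n - t) * C := by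
  have h3 : ((min t k : ℕ) : ℝ) ≤ (min n k : ℕ) := by
    exact_mod_cast min_le_min_right k ht
  have h4 : ((min n k : ℕ) : ℝ) - (min t k : ℕ) ≤ n - t := by
    have : min n k + t ≤ n + min t k := by omega
    have : ((min n k : ℕ) : ℝ) + t ≤ n + (min t k : ℕ) := by exact_mod_cast this
    linarith
  have e : meanSum k p₁ p₂ n - meanSum k p₁ p₂ t =
      (((min n k : ℕ) : ℝ) - (min t k : ℕ)) * p₁ +
        ((n - t : ℝ) - (((min n k : ℕ) : ℝ) - (min t k : ℕ))) * p₂ := by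
    rw [meanSum, meanSum]; ring
  rw [e]
  refine (abs_add_le _ _).trans ?_
  rw [abs_mul, abs_mul, abs_of_nonneg (sub_nonneg.mpr h3), abs_of_nonneg (sub_nonneg.mpr h4)]
  calc _ ≤ (((min n k : ℕ) : ℝ) - (min t k : ℕ)) * C +
        ((n - t : ℝ) - (((min n k : ℕ) : ℝ) - (min t k : ℕ))) * C := by
        have := sub_nonneg.mpr h3
        have := sub_nonneg.mpr h4
        gcongr
    _ = _ := by ring

/-- One of the two averages is pure and the other mixes both regimes. For t ≤ k the right one has
the share (n-k)/(n-t) of the second regime, for t > k the left one has the share k/t of the first.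
-/
lemma meanSum_div_sub_eq {k n t : ℕ} (hkn : k ≤ n) (ht : 0 < t) (htn : t < n) (p₁ p₂ : ℝ) :
    meanSum k p₁ p₂ t / t - (meanSum k p₁ p₂ n - meanSum k p₁ p₂ t) / (n - t) =
      jumpFactor n k t * (p₁ - p₂) := by
  have h0 : (t : ℝ) ≠ 0 := by exact_mod_cast ht.ne'
  have h1 : (n : ℝ) - t ≠ 0 := sub_ne_zero.mpr (by exact_mod_cast htn.ne')
  rw [meanSum, meanSum, min_eq_right hkn, jumpFactor]
  split_ifs with htk
  · rw [min_eq_left htk]; field_simp; ring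
  · rw [min_eq_right (not_le.mp htk).le]; field_simp; ring

lemma jumpFactor_nonneg {n k t : ℕ} (hkn : k ≤ n) (htn : t ≤ n) : 0 ≤ jumpFactor n k t := by
  have h1 : (k : ℝ) ≤ n := by exact_mod_cast hkn
  have h2 : (t : ℝ) ≤ n := by exact_mod_cast htn
  rw [jumpFactor]
  split_ifs
  · exact div_nonneg (by linarith) (by linarith)
  · positivity

lemma jumpFactor_le_one {n k t : ℕ} (htn : t ≤ n) : jumpFactor n k t ≤ 1 := by
  have h2 : (t : ℝ) ≤ n := by exact_mod_cast htn
  rw [jumpFactor]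
  split_ifs with h
  · have : (t : ℝ) ≤ k := by exact_mod_cast h
    exact div_le_one_of_le₀ (by linarith) (by linarith)
  · have : (k : ℝ) ≤ t := by exact_mod_cast (not_le.mp h).le
    exact div_le_one_of_le₀ this (by positivity)

lemma jumpFactor_self {n k : ℕ} (hkn : k < n) : jumpFactor n k k = 1 := by
  have h1 : (n : ℝ) - k ≠ 0 := sub_ne_zero.mpr (by exact_mod_cast hkn.ne')
  rw [jumpFactor, if_pos le_rfl, div_self h1]

/-- The population version of the CUSUM statistic has a sharp peak at the change point. -/
lemma mul_abs_sub_le_popCusum {n k t : ℕ} {η : ℝ} (ht : 0 < t) (htn : t < n)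
    (hk₁ : η * n ≤ k) (hk₂ : η * n ≤ n - k) (hkn : k < n) :
    η * (|(k : ℝ) - t| / n) ≤ (k : ℝ) * (n - k) / (n : ℝ) ^ 2 -
      (t : ℝ) * (n - t) / (n : ℝ) ^ 2 * jumpFactor n k t ^ 2 := by
  have ht0 : (0 : ℝ) < t := by exact_mod_cast ht
  have hn0 : (0 : ℝ) < n := by exact_mod_cast ht.trans htn
  have htn0 : (0 : ℝ) < (n : ℝ) - t := sub_pos.mpr (by exact_mod_cast htn)
  have hkn0 : (0 : ℝ) < (n : ℝ) - k := sub_pos.mpr (by exact_mod_cast hkn)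
  have hk0 : (0 : ℝ) ≤ k := Nat.cast_nonneg _
  rw [jumpFactor]
  split_ifs with h
  · have h' : (t : ℝ) ≤ k := by exact_mod_cast h
    -- The drop is computed exactly: (n-k)(k-t)/(n(n-t)) before the change, and symmetrically
    -- k(t-k)/(nt) after it.
    have e : (k : ℝ) * (n - k) / (n : ℝ) ^ 2 -
        (t : ℝ) * (n - t) / (n : ℝ) ^ 2 * (((n : ℝ) - k) / (n - t)) ^ 2 =
        (n - k) * (((k : ℝ) - t) / n) * (1 / (n - t)) := by
      field_simp; ring
    rw [e, abs_of_nonneg (sub_nonneg.mpr h')]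
    have h3 : 0 ≤ ((k : ℝ) - t) / n := div_nonneg (by linarith) hn0.le
    calc η * (((k : ℝ) - t) / n) = (η * n) * (((k : ℝ) - t) / n) * (1 / n) := by field_simp
      _ ≤ (n - k) * (((k : ℝ) - t) / n) * (1 / (n - t)) := by
          gcongr
          linarith
  · have h' : (k : ℝ) ≤ t := by exact_mod_cast (not_le.mp h).le
    have e : (k : ℝ) * (n - k) / (n : ℝ) ^ 2 -
        (t : ℝ) * (n - t) / (n : ℝ) ^ 2 * ((k : ℝ) / t) ^ 2 =
        k * (((t : ℝ) - k) / n) * (1 / t) := by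
      field_simp; ring
    rw [e, abs_sub_comm, abs_of_nonneg (sub_nonneg.mpr h')]
    have h3 : 0 ≤ ((t : ℝ) - k) / n := div_nonneg (by linarith) hn0.le
    calc η * (((t : ℝ) - k) / n) = (η * n) * (((t : ℝ) - k) / n) * (1 / n) := by field_simp
      _ ≤ k * (((t : ℝ) - k) / n) * (1 / t) := by
          gcongr

/-! ### The estimators before and after a candidate time -/

section Estimators

variable {Ω : Type*}

lemma phiHat_eq_sum_div_sum (K : ℝ → ℝ) (h : ℝ) (X Y : ℕ → Ω → ℝ) {s u : ℕ} (hsu : s ≤ u)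
    (x : ℝ) (ω : Ω) :
    phiHat K h X Y (s + 1) u x ω =
      (∑ t ∈ Finset.Ioc s u, Y t ω * kernelAt K h x (X t ω)) /
        ∑ t ∈ Finset.Ioc s u, kernelAt K h x (X t ω) := by
  rcases hsu.eq_or_lt with rfl | hsu
  -- For an empty stretch both sides are 0, by the convention for division by zero.
  · simp [phiHat, gHat, fHat]
  have h1 : (1 : ℝ) / ((u : ℝ) - (s + 1 : ℕ) + 1) ≠ 0 := by
    have : (s : ℝ) < u := by exact_mod_cast hsu
    push_cast
    exact one_div_ne_zero (by linarith)
  have e : Finset.Icc (s + 1) u = Finset.Ioc s u := by ext; simp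
  rw [phiHat, gHat, fHat, mul_div_mul_left _ _ h1, e]
  rfl

/-- The difference of the two estimators at a time `t` follows the jump of the means. -/
lemma abs_phiHat_sub_sub_jumpFactor_le {K : ℝ → ℝ} {h : ℝ} {X Y : ℕ → Ω → ℝ} {x : ℝ} {ω : Ω}
    {k n t : ℕ} (hkn : k ≤ n) {f₀ g₁ g₂ c C e η : ℝ} (hc : 0 < c) (hf₀ : c ≤ f₀)
    (hg₁ : |g₁| ≤ C) (hg₂ : |g₂| ≤ C) (hη : 0 < η) (hn : 0 < n)
    (ht₁ : η * n ≤ t) (ht₂ : η * n ≤ n - t) (he : 4 * e ≤ η * n * c / 2)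
    (hF₁ : ∀ t ≤ k, |∑ s ∈ Finset.Ioc 0 t, (kernelAt K h x (X s ω) - f₀)| ≤ e)
    (hF₂ : ∀ t ≤ n, |∑ s ∈ Finset.Ioc k t, (kernelAt K h x (X s ω) - f₀)| ≤ e)
    (hG₁ : ∀ t ≤ k, |∑ s ∈ Finset.Ioc 0 t, (Y s ω * kernelAt K h x (X s ω) - g₁)| ≤ e)
    (hG₂ : ∀ t ≤ n, |∑ s ∈ Finset.Ioc k t, (Y s ω * kernelAt K h x (X s ω) - g₂)| ≤ e) :
    |phiHat K h X Y 1 t x ω - phiHat K h X Y (t + 1) n x ω -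
        jumpFactor n k t * ((g₁ - g₂) / f₀)| ≤
      16 / (η * c) * (1 + C / c) * (e / n) := by
  have hn0 : (0 : ℝ) < n := by exact_mod_cast hn
  have hηn : 0 < η * n := by positivity
  have ht0 : (0 : ℝ) < t := hηn.trans_le ht₁
  have htn0 : (0 : ℝ) < (n : ℝ) - t := hηn.trans_le ht₂
  have htn : t < n := by exact_mod_cast sub_pos.mp htn0
  have he0 : 0 ≤ e := (abs_nonneg _).trans (hF₁ 0 (Nat.zero_le _))
  have hC0 : 0 ≤ C := (abs_nonneg _).trans hg₁
  have hF := abs_sum_sub_meanSum_le hF₁ hF₂ htn.le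
  have hF' := abs_sum_sub_meanSum_sub_le hF₁ hF₂ htn.le
  have hG := abs_sum_sub_meanSum_le hG₁ hG₂ htn.le
  have hG' := abs_sum_sub_meanSum_sub_le hG₁ hG₂ htn.le
  rw [meanSum_self] at hF
  rw [meanSum_self, meanSum_self, ← sub_mul] at hF'
  have key : ∀ {N : ℝ}, η * n ≤ N → 4 * e ≤ N * c / 2 := fun hN => he.trans (by gcongr)
  have h1 := abs_div_sub_div_le (a := meanSum k g₁ g₂ t / t) (e := 4 * e) (C := C) ht0 hc hf₀
    (by rw [mul_div_cancel₀ _ ht0.ne']; exact hG.trans (by linarith))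
    (hF.trans (by linarith))
    (by rw [abs_div, abs_of_pos ht0, div_le_iff₀ ht0, mul_comm]; exact abs_meanSum_le k hg₁ hg₂ t)
    (key ht₁)
  have h2 := abs_div_sub_div_le (a := (meanSum k g₁ g₂ n - meanSum k g₁ g₂ t) / (n - t))
    (e := 4 * e) (C := C) htn0 hc hf₀ (by rw [mul_div_cancel₀ _ htn0.ne']; exact hG') hF'
    (by rw [abs_div, abs_of_pos htn0, div_le_iff₀ htn0, mul_comm]
        exact abs_meanSum_sub_le hg₁ hg₂ htn.le)
    (key ht₂)
  have e0 : phiHat K h X Y 1 t x ω = _ := phiHat_eq_sum_div_sum K h X Y (Nat.zero_le t) x ω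
  rw [e0, phiHat_eq_sum_div_sum K h X Y htn.le, ← mul_div_assoc,
    ← meanSum_div_sub_eq hkn (by exact_mod_cast ht0) htn, sub_div]
  -- Each side has an error of at most 4e over a stretch of length at least ηn; the two sides
  -- together give the constant 16.
  have h3 : ∀ {N : ℝ}, η * n ≤ N → 4 * e / N * (2 / c * (1 + C / c)) ≤
      8 / (η * c) * (1 + C / c) * (e / n) := by
    intro N hN
    calc 4 * e / N * (2 / c * (1 + C / c)) ≤ 4 * e / (η * n) * (2 / c * (1 + C / c)) := by
          gcongr
      _ = _ := by field_simp; ring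
  have h4 := h1.trans (h3 ht₁)
  have h5 := h2.trans (h3 ht₂)
  have e6 : 16 / (η * c) * (1 + C / c) * (e / n) = 8 / (η * c) * (1 + C / c) * (e / n) +
    8 / (η * c) * (1 + C / c) * (e / n) := by ring
  rw [e6, abs_le]
  rw [abs_le] at h4 h5
  constructor <;> linarith

end Estimators

/-- Factor d² - a²J² = (d - aJ)(2aJ + (d - aJ)). Keeping √(∑J²) in the error, instead of a constant
bound, makes the relative error depend only on ρ²/∑J². -/
lemma abs_sum_sq_sub_le {m : ℕ} {d J : Fin m → ℝ} {ρ a : ℝ} (ha0 : 0 ≤ a) (ha : a ≤ 1)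
    (hd : ∀ i, |d i - a * J i| ≤ ρ) :
    |∑ i, |d i| ^ 2 - a ^ 2 * ∑ i, J i ^ 2| ≤ m * (2 * ρ * √(∑ i, J i ^ 2) + ρ ^ 2) := by
  rw [Finset.mul_sum, ← Finset.sum_sub_distrib]
  refine (Finset.abs_sum_le_sum_abs _ _).trans ?_
  calc _ ≤ ∑ _i : Fin m, (2 * ρ * √(∑ i, J i ^ 2) + ρ ^ 2) := Finset.sum_le_sum fun i _ => ?_
    _ = _ := by simp [mul_add]
  have hρ : 0 ≤ ρ := (abs_nonneg _).trans (hd i)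
  have hJ : |J i| ≤ √(∑ i, J i ^ 2) :=
    Real.abs_le_sqrt (Finset.single_le_sum (f := fun i => J i ^ 2) (fun _ _ => sq_nonneg _)
      (Finset.mem_univ i))
  have e : |d i| ^ 2 - a ^ 2 * J i ^ 2 = (d i - a * J i) * (2 * (a * J i) + (d i - a * J i)) := by
    rw [sq_abs]; ring
  have haJ : |a * J i| ≤ √(∑ i, J i ^ 2) := by
    rw [abs_mul, abs_of_nonneg ha0]
    exact (mul_le_of_le_one_left (abs_nonneg _) ha).trans hJ
  rw [e, abs_mul]
  calc _ ≤ ρ * (2 * √(∑ i, J i ^ 2) + ρ) := by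
        refine mul_le_mul (hd i) ((abs_add_le _ _).trans ?_) (abs_nonneg _) hρ
        rw [abs_mul, abs_two]
        gcongr
        exact hd i
    _ = _ := by ring

/-- The CUSUM statistic is close to its population version. -/
lemma abs_cusum_sub_le {Ω : Type*} {K : ℝ → ℝ} {h : ℝ} {m : ℕ} {x : Fin m → ℝ}
    {X Y : ℕ → Ω → ℝ} {k n t : ℕ} {ω : Ω} {ρ : ℝ} {J : Fin m → ℝ} (hkn : k ≤ n) (htn : t ≤ n)
    (hd : ∀ i, |phiHat K h X Y 1 t (x i) ω - phiHat K h X Y (t + 1) n (x i) ω -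
        jumpFactor n k t * J i| ≤ ρ) :
    |cusum K h x X Y n t ω -
        (t : ℝ) * (n - t) / (n : ℝ) ^ 2 * jumpFactor n k t ^ 2 * ∑ i, J i ^ 2| ≤
      m * (2 * ρ * √(∑ i, J i ^ 2) + ρ ^ 2) := by
  have h2 : (t : ℝ) ≤ n := by exact_mod_cast htn
  have hw0 : 0 ≤ (t : ℝ) * (n - t) / (n : ℝ) ^ 2 :=
    div_nonneg (mul_nonneg (Nat.cast_nonneg _) (by linarith)) (sq_nonneg _)
  have hw1 : (t : ℝ) * (n - t) / (n : ℝ) ^ 2 ≤ 1 := by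
    refine div_le_one_of_le₀ ?_ (sq_nonneg _)
    rw [sq]
    have := Nat.cast_nonneg (α := ℝ) t
    exact mul_le_mul h2 (by linarith) (by linarith) (by linarith)
  rw [cusum, mul_assoc _ (jumpFactor n k t ^ 2), ← mul_sub, abs_mul, abs_of_nonneg hw0]
  refine (mul_le_of_le_one_left (abs_nonneg _) hw1).trans ?_
  exact abs_sum_sq_sub_le (jumpFactor_nonneg hkn htn) (jumpFactor_le_one htn) hd

/-! ### Candidate times and the position of the peak -/

lemma candidates_finite (δ : ℝ) (n : ℕ) : (candidates δ n).Finite := Set.finite_Icc _ _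

lemma le_of_mem_candidates {δ : ℝ} {n t : ℕ} (ht : t ∈ candidates δ n) : t ≤ n :=
  ht.2.trans (Nat.sub_le _ _)

lemma candidates_nonempty {δ : ℝ} (hδ : δ ≤ 1 / 2) (n : ℕ) : (candidates δ n).Nonempty := by
  refine Set.nonempty_Icc.mpr ?_
  have h1 : 2 * ⌊(n : ℝ) * δ⌋₊ ≤ n := by
    have h2 : ((2 * ⌊(n : ℝ) * δ⌋₊ : ℕ) : ℝ) ≤ n := by
      have hn : (0 : ℝ) ≤ n := Nat.cast_nonneg n
      rcases le_total 0 δ with h | h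
      · have := Nat.floor_le (mul_nonneg hn h)
        push_cast
        nlinarith
      · rw [Nat.floor_of_nonpos (mul_nonpos_of_nonneg_of_nonpos hn h)]
        simp
    exact_mod_cast h2
  omega

/-- Candidate times stay away from both ends of the sample. -/
lemma eventually_mul_le_of_mem_candidates {δ : ℝ} (hδ : 0 < δ) (hδ' : δ ≤ 1 / 2) :
    ∀ᶠ n : ℕ in atTop, ∀ t ∈ candidates δ n, δ / 2 * n ≤ t ∧ δ / 2 * n ≤ n - t := by
  -- For nδ ≥ 2 the floor of nδ is still at least nδ/2.
  filter_upwards [eventually_ge_atTop ⌈2 / δ⌉₊] with n hn t ht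
  have h1 : 2 / δ ≤ n := Nat.ceil_le.mp hn
  rw [div_le_iff₀ hδ] at h1
  have h2 := Nat.lt_floor_add_one ((n : ℝ) * δ)
  have h3 : ((⌊(n : ℝ) * δ⌋₊ : ℕ) : ℝ) ≤ t := by exact_mod_cast ht.1
  have h4 : t + ⌊(n : ℝ) * δ⌋₊ ≤ n := by
    have := ht.2
    have hne := Set.nonempty_Icc.mp (candidates_nonempty hδ' n)
    omega
  have h5 : (t : ℝ) + (⌊(n : ℝ) * δ⌋₊ : ℕ) ≤ n := by exact_mod_cast h4
  constructor <;> linarith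

lemma changeTime_mem_candidates {δ θ : ℝ} (hδ : 0 < δ) (h₁ : δ ≤ θ) (h₂ : θ ≤ 1 - δ) (n : ℕ) :
    changeTime θ n ∈ candidates δ n := by
  have hn : (0 : ℝ) ≤ n := Nat.cast_nonneg n
  have hθ : 0 < θ := hδ.trans_le h₁
  refine ⟨Nat.floor_le_floor (by rw [mul_comm]; gcongr), ?_⟩
  refine Nat.le_sub_of_add_le ?_
  have h3 : ((changeTime θ n + ⌊(n : ℝ) * δ⌋₊ : ℕ) : ℝ) ≤ n := by
    push_cast
    have a := Nat.floor_le (show 0 ≤ θ * n by positivity)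
    have b := Nat.floor_le (show 0 ≤ (n : ℝ) * δ by positivity)
    rw [changeTime]
    nlinarith
  exact_mod_cast h3

lemma changeTime_le {θ : ℝ} (hθ : θ ≤ 1) (n : ℕ) : changeTime θ n ≤ n :=
  Nat.floor_le_of_le (mul_le_of_le_one_left (Nat.cast_nonneg n) hθ)

lemma tendsto_changeTime_div {θ : ℝ} (hθ : 0 ≤ θ) :
    Tendsto (fun n : ℕ => (changeTime θ n : ℝ) / n) atTop (𝓝 θ) :=
  (tendsto_nat_floor_mul_div_atTop hθ).comp tendsto_natCast_atTop_atTop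

/-- A maximizer of the CUSUM statistic is close to the change point. -/
lemma mul_abs_sub_le_of_isMaxOn {Ω : Type*} {K : ℝ → ℝ} {h : ℝ} {m : ℕ} {x : Fin m → ℝ}
    {X Y : ℕ → Ω → ℝ} {δ : ℝ} {k n t : ℕ} {ω : Ω} {ρ η : ℝ} {J : Fin m → ℝ} (hη : 0 < η)
    (hn : 0 < n) (hcand : ∀ t ∈ candidates δ n, η * n ≤ t ∧ η * n ≤ n - t)
    (hk : k ∈ candidates δ n)
    (hd : ∀ i, ∀ t ∈ candidates δ n,
      |phiHat K h X Y 1 t (x i) ω - phiHat K h X Y (t + 1) n (x i) ω -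
        jumpFactor n k t * J i| ≤ ρ)
    (ht : t ∈ candidates δ n)
    (hmax : IsMaxOn (fun t => cusum K h x X Y n t ω) (candidates δ n) t) :
    η * (|(k : ℝ) - t| / n) * ∑ i, J i ^ 2 ≤
      2 * (m * (2 * ρ * √(∑ i, J i ^ 2) + ρ ^ 2)) := by
  have hn0 : (0 : ℝ) < n := by exact_mod_cast hn
  have hηn : 0 < η * n := by positivity
  have hpos : ∀ t ∈ candidates δ n, 0 < t ∧ t < n := fun t ht =>
    ⟨by exact_mod_cast hηn.trans_le (hcand t ht).1,
      by exact_mod_cast sub_pos.mp (hηn.trans_le (hcand t ht).2)⟩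
  have h1 := abs_cusum_sub_le (hpos k hk).2.le (hpos t ht).2.le (fun i => hd i t ht)
  have h2 := abs_cusum_sub_le (hpos k hk).2.le (hpos k hk).2.le (fun i => hd i k hk)
  rw [jumpFactor_self (hpos k hk).2, one_pow, mul_one] at h2
  -- The maximizer does at least as well as k, so the population drop between them is at most two
  -- approximation errors.
  have h3 : cusum K h x X Y n k ω ≤ cusum K h x X Y n t ω := hmax hk
  have h4 := mul_le_mul_of_nonneg_right (mul_abs_sub_le_popCusum (hpos t ht).1 (hpos t ht).2
    (hcand k hk).1 (hcand k hk).2 (hpos k hk).2) (show 0 ≤ ∑ i, J i ^ 2 from Finset.sum_nonneg fun i _ => sq_nonneg (J i))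
  rw [sub_mul] at h4
  rw [abs_le] at h1 h2
  linarith [h1.2, h2.1]

end

section

lemma changeArray_self {Ω : Type*} (φ : ℝ → ℝ) (X ε : ℕ → Ω → ℝ) (θ : ℝ) (n : ℕ) :
    changeArray φ φ X ε θ n = response φ X ε := by
  funext t ω
  simp [changeArray, responseChange]

variable {Ω : Type*} [m0 : MeasurableSpace Ω] {μ : Measure Ω}

/-! ### Consistency of the change-point estimators -/

/-- A sample whose regression function is `φ₁` up to the time `⌊θ n⌋` and `φ₂` later, where `φ₁`
and `φ₂` may be equal. -/
structure PiecewiseModel (μ : Measure Ω) (X ε : ℕ → Ω → ℝ) (K : ℝ → ℝ) (h : ℕ → ℝ)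
    (R : MixingRegime) {m : ℕ} (x : Fin m → ℝ) (φ₁ φ₂ : ℝ → ℝ) (θ : ℝ) : Prop where
  common : CommonAssumptions μ X ε K h R x
  measurable_φ₁ : Measurable φ₁
  measurable_φ₂ : Measurable φ₂
  mixing : MixesAtRate μ X (changeArray φ₁ φ₂ X ε θ) R
  density₁ : DensityCondition μ X (response φ₁ X ε) R
  density₂ : DensityCondition μ X (response φ₂ X ε) R
  moment₁ : MomentCondition μ X (response φ₁ X ε)
  moment₂ : MomentCondition μ X (response φ₂ X ε)
  θ_le_one : θ ≤ 1

section Model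

variable {X ε : ℕ → Ω → ℝ} {K : ℝ → ℝ} {h : ℕ → ℝ} {R : MixingRegime} {m : ℕ} {x : Fin m → ℝ}

/-- Absence of a change is treated as a change between equal regression functions at an arbitrary
position, so both cases share the same deviation analysis. -/
lemma NoChange.piecewiseModel {φ : ℝ → ℝ} (H : NoChange μ X ε K h R x φ) {θ : ℝ} (hθ : θ ≤ 1) :
    PiecewiseModel μ X ε K h R x φ φ θ where
  common := H.common
  measurable_φ₁ := H.measurable_φ
  measurable_φ₂ := H.measurable_φ
  mixing := by
    rw [show changeArray φ φ X ε θ = fun _ => response φ X ε from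
      funext (changeArray_self φ X ε θ)]
    exact H.mixing
  density₁ := H.density
  density₂ := H.density
  moment₁ := H.moment
  moment₂ := H.moment
  θ_le_one := hθ

variable {φ₁ φ₂ : ℝ → ℝ} {θ δ : ℝ}

lemma OneChange.piecewiseModel (H : OneChange μ X ε K h R x δ φ₁ φ₂ θ) (hδ : 0 < δ) :
    PiecewiseModel μ X ε K h R x φ₁ φ₂ θ where
  common := H.common
  measurable_φ₁ := H.measurable_φ₁
  measurable_φ₂ := H.measurable_φ₂
  mixing := H.mixing
  density₁ := H.density₁
  density₂ := H.density₂
  moment₁ := H.moment₁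
  moment₂ := H.moment₂
  θ_le_one := by linarith [H.θ_le]

namespace PiecewiseModel

lemma exists_rateSetup (H : PiecewiseModel μ X ε K h R x φ₁ φ₂ θ) :
    ∃ γ w c₁ c₂, RateSetup h γ w c₁ c₂ := by
  obtain ⟨p, -, hp, hRp, -⟩ := H.density₁.lagF_bounded
  obtain ⟨γ, w, c₁, c₂, C, hr, -⟩ :=
    NWChange.exists_rateSetup H.common.regime H.common.bandwidth hp hRp
  exact ⟨γ, w, c₁, c₂, hr⟩

lemma stationaryPair₁ (H : PiecewiseModel μ X ε K h R x φ₁ φ₂ θ) :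
    StationaryPair μ X (response φ₁ X ε) :=
  H.common.stationary.stationaryPair H.common.measurable_X H.common.measurable_ε H.measurable_φ₁

lemma stationaryPair₂ (H : PiecewiseModel μ X ε K h R x φ₁ φ₂ θ) :
    StationaryPair μ X (response φ₂ X ε) :=
  H.common.stationary.stationaryPair H.common.measurable_X H.common.measurable_ε H.measurable_φ₂

lemma measurable_changeArray (H : PiecewiseModel μ X ε K h R x φ₁ φ₂ θ) (n t : ℕ) :
    Measurable (changeArray φ₁ φ₂ X ε θ n t) := by
  by_cases ht : t ≤ changeTime θ n
  · have : changeArray φ₁ φ₂ X ε θ n t = response φ₁ X ε t := by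
      funext ω; simp [changeArray, responseChange, ht]
    rw [this]
    exact H.stationaryPair₁.measurable_Y t
  · have : changeArray φ₁ φ₂ X ε θ n t = response φ₂ X ε t := by
      funext ω; simp [changeArray, responseChange, ht]
    rw [this]
    exact H.stationaryPair₂.measurable_Y t

/-- Only the sample containing the change is assumed to mix, with its own coefficients. It coincides
with the first stationary regime on (0, k] and with the second on (k, n], which is all the deviation
bounds require. -/
lemma mixingStretch₁ (H : PiecewiseModel μ X ε K h R x φ₁ φ₂ θ) :
    MixingStretch μ X (response φ₁ X ε) (fun n t ω => (X t ω, changeArray φ₁ φ₂ X ε θ n t ω))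
      (fun _ => 0) (changeTime θ) R where
  measurable n s := (H.common.measurable_X s).prodMk (H.measurable_changeArray n s)
  le n := changeTime_le H.θ_le_one n
  eq n s hs := by
    funext ω
    simp [changeArray, responseChange, (Finset.mem_Ioc.mp hs).2]
  mixing := H.mixing

lemma mixingStretch₂ (H : PiecewiseModel μ X ε K h R x φ₁ φ₂ θ) :
    MixingStretch μ X (response φ₂ X ε) (fun n t ω => (X t ω, changeArray φ₁ φ₂ X ε θ n t ω))
      (changeTime θ) id R where
  measurable n s := (H.common.measurable_X s).prodMk (H.measurable_changeArray n s)
  le n := le_rfl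
  eq n s hs := by
    funext ω
    simp [changeArray, responseChange, not_le.mpr (Finset.mem_Ioc.mp hs).1]
  mixing := H.mixing

lemma exists_mean_bounds [IsProbabilityMeasure μ] (H : PiecewiseModel μ X ε K h R x φ₁ φ₂ θ)
    (i : Fin m) : ∃ c C : ℝ, 0 < c ∧ ∀ᶠ n in atTop, c ≤ meanKernel μ X K (h n) (x i) ∧
      |meanResponse μ X (response φ₁ X ε) K (h n) (x i)| ≤ C ∧
      |meanResponse μ X (response φ₂ X ε) K (h n) (x i)| ≤ C := by
  obtain ⟨γ, w, c₁, c₂, hr⟩ := H.exists_rateSetup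
  have hX := H.common.measurable_X 0
  obtain ⟨c, hc, h0⟩ := H.common.kernel.eventually_le_meanKernel hX H.density₁.hasPDF_X
    (H.common.density_pos i) hr.tendsto_h hr.h_pos
  obtain ⟨C₁, -, hC₁⟩ := H.common.kernel.abs_meanResponse_le hX (H.stationaryPair₁.measurable_Y 0)
    H.density₁ H.moment₁ (x i)
  obtain ⟨C₂, -, hC₂⟩ := H.common.kernel.abs_meanResponse_le hX (H.stationaryPair₂.measurable_Y 0)
    H.density₂ H.moment₂ (x i)
  refine ⟨c, max C₁ C₂, hc, ?_⟩
  filter_upwards [h0, hr.h_pos] with n hn hpos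
  exact ⟨hn, (hC₁ _ hpos).trans (le_max_left _ _), (hC₂ _ hpos).trans (le_max_right _ _)⟩

lemma ae_eventually_abs_phiHat_sub_le_aux [IsProbabilityMeasure μ]
    (H : PiecewiseModel μ X ε K h R x φ₁ φ₂ θ) (hδ : 0 < δ) (hδ' : δ ≤ 1 / 2) (i : Fin m) :
    ∃ D : ℝ, 0 ≤ D ∧ ∀ᵐ ω ∂μ, ∀ᶠ n : ℕ in atTop, ∀ t ∈ candidates δ n,
      |phiHat K (h n) X (changeArray φ₁ φ₂ X ε θ n) 1 t (x i) ω -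
        phiHat K (h n) X (changeArray φ₁ φ₂ X ε θ n) (t + 1) n (x i) ω -
        jumpFactor n (changeTime θ n) t *
          smoothedJump μ K (h n) X (changeArray φ₁ φ₂ X ε θ n) (changeTime θ n) (x i)| ≤
        D * devRate h n := by
  obtain ⟨γ, w, c₁, c₂, hr⟩ := H.exists_rateSetup
  have hK := H.common.kernel
  have hR := H.common.regime
  have hb := H.common.bandwidth
  obtain ⟨c, C, hc, hmean⟩ := H.exists_mean_bounds i
  obtain ⟨A₁, hA₁, hF₁⟩ := ae_eventually_abs_sum_kernel_le H.stationaryPair₁ hK hR hb H.density₁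
    H.mixingStretch₁ (x i)
  obtain ⟨A₂, hA₂, hF₂⟩ := ae_eventually_abs_sum_kernel_le H.stationaryPair₂ hK hR hb H.density₂
    H.mixingStretch₂ (x i)
  obtain ⟨B₁, hB₁, hG₁⟩ := ae_eventually_abs_sum_response_mul_kernel_le H.stationaryPair₁ hK hR hb
    H.density₁ H.moment₁ H.mixingStretch₁ (x i)
  obtain ⟨B₂, hB₂, hG₂⟩ := ae_eventually_abs_sum_response_mul_kernel_le H.stationaryPair₂ hK hR hb
    H.density₂ H.moment₂ H.mixingStretch₂ (x i)
  obtain ⟨A, hA⟩ : ∃ A, A = A₁ + A₂ + B₁ + B₂ := ⟨_, rfl⟩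
  have hC : 0 ≤ C := by
    obtain ⟨n, hn⟩ := hmean.exists
    exact (abs_nonneg _).trans hn.2.1
  refine ⟨16 / (δ / 2 * c) * (1 + C / c) * A, by rw [hA]; positivity, ?_⟩
  filter_upwards [hF₁, hF₂, hG₁, hG₂] with ω hF₁ hF₂ hG₁ hG₂
  -- This is the requirement 4e ≤ ηnc/2 for e = A n r_n and η = δ/2.
  have hsmall : ∀ᶠ n in atTop, devRate h n < δ * c / (16 * A) :=
    hr.tendsto_devRate.eventually (gt_mem_nhds (by rw [hA]; positivity))
  filter_upwards [hF₁, hF₂, hG₁, hG₂, hmean, hsmall, hr.one_le_mul_devRate,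
    eventually_gt_atTop 0, eventually_mul_le_of_mem_candidates hδ hδ']
    with n hF₁ hF₂ hG₁ hG₂ hmean hsmall h1 hn hcand t ht
  have hn0 : (0 : ℝ) < n := by exact_mod_cast hn
  have hA0 : 0 < A := by rw [hA]; positivity
  have hr0 : 0 ≤ n * devRate h n := by linarith
  have hle : ∀ {B : ℝ}, B ≤ A → B * (n * devRate h n) ≤ A * (n * devRate h n) := fun hB =>
    mul_le_mul_of_nonneg_right hB hr0
  rw [H.stationaryPair₁.smoothedJump_eq H.stationaryPair₂ hK.measurable]
  have key := abs_phiHat_sub_sub_jumpFactor_le (Y := changeArray φ₁ φ₂ X ε θ n)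
    (changeTime_le H.θ_le_one n) (e := A * (n * devRate h n)) hc hmean.1 hmean.2.1 hmean.2.2
    (half_pos hδ) hn (hcand t ht).1 (hcand t ht).2 ?_
    (fun t ht => (hF₁ t ht).trans (hle (by linarith)))
    (fun t ht => (hF₂ t ht).trans (hle (by linarith))) ?_ ?_
  · refine key.trans_eq ?_
    field_simp
  · rw [lt_div_iff₀ (by positivity)] at hsmall
    have := mul_le_mul_of_nonneg_left hsmall.le hn0.le
    linarith
  · intro t ht
    refine le_trans (le_of_eq ?_) ((hG₁ t ht).trans (hle (by linarith)))
    congr 1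
    refine Finset.sum_congr rfl fun s hs => ?_
    rw [changeArray, responseChange, if_pos ((Finset.mem_Ioc.mp hs).2.trans ht)]
    rfl
  · intro t ht
    refine le_trans (le_of_eq ?_) ((hG₂ t ht).trans (hle (by linarith)))
    congr 1
    refine Finset.sum_congr rfl fun s hs => ?_
    rw [changeArray, responseChange, if_neg (not_le.mpr (Finset.mem_Ioc.mp hs).1)]
    rfl

/-- Uniformly over the candidate times, the difference of the two estimators is the smoothed jump
times the factor `jumpFactor`, up to an error of the order `devRate`. -/
theorem ae_eventually_abs_phiHat_sub_le [IsProbabilityMeasure μ]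
    (H : PiecewiseModel μ X ε K h R x φ₁ φ₂ θ) (hδ : 0 < δ) (hδ' : δ ≤ 1 / 2) :
    ∃ D : ℝ, 0 ≤ D ∧ ∀ᵐ ω ∂μ, ∀ᶠ n : ℕ in atTop, ∀ i, ∀ t ∈ candidates δ n,
      |phiHat K (h n) X (changeArray φ₁ φ₂ X ε θ n) 1 t (x i) ω -
        phiHat K (h n) X (changeArray φ₁ φ₂ X ε θ n) (t + 1) n (x i) ω -
        jumpFactor n (changeTime θ n) t *
          smoothedJump μ K (h n) X (changeArray φ₁ φ₂ X ε θ n) (changeTime θ n) (x i)| ≤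
        D * devRate h n := by
  obtain ⟨γ, w, c₁, c₂, hr⟩ := H.exists_rateSetup
  choose D hD0 hD using H.ae_eventually_abs_phiHat_sub_le_aux hδ hδ'
  refine ⟨∑ i, D i, Finset.sum_nonneg fun i _ => hD0 i, ?_⟩
  filter_upwards [ae_all_iff.mpr hD] with ω hω
  filter_upwards [eventually_all.mpr hω, hr.one_le_mul_devRate] with n hn h1 i t ht
  have hr0 : 0 ≤ devRate h n := by
    by_contra hneg
    have := mul_nonpos_of_nonneg_of_nonpos (Nat.cast_nonneg (α := ℝ) n) (not_le.mp hneg).le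
    linarith
  refine (hn i t ht).trans (mul_le_mul_of_nonneg_right ?_ hr0)
  exact Finset.single_le_sum (fun i _ => hD0 i) (Finset.mem_univ i)

lemma eventually_devRate_pos (H : PiecewiseModel μ X ε K h R x φ₁ φ₂ θ) :
    ∀ᶠ n in atTop, 0 < devRate h n := by
  obtain ⟨γ, w, c₁, c₂, hr⟩ := H.exists_rateSetup
  filter_upwards [hr.one_le_mul_devRate] with n h1
  exact pos_of_mul_pos_right (zero_lt_one.trans_le h1) (Nat.cast_nonneg n)

/-- The smoothed jumps are ratios of bounded means to a mean bounded below. Their boundedness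
reduces all errors in the rejection argument to multiples of r_n. -/
lemma exists_sum_sq_smoothedJump_le [IsProbabilityMeasure μ]
    (H : PiecewiseModel μ X ε K h R x φ₁ φ₂ θ) :
    ∃ B : ℝ, ∀ᶠ n in atTop,
      ∑ i, smoothedJump μ K (h n) X (changeArray φ₁ φ₂ X ε θ n) (changeTime θ n) (x i) ^ 2 ≤
        B := by
  choose c C hc hmean using H.exists_mean_bounds
  refine ⟨∑ i, (2 * C i / c i) ^ 2, ?_⟩
  filter_upwards [eventually_all.mpr hmean] with n hn
  refine Finset.sum_le_sum fun i _ => sq_le_sq' ?_ ?_ <;>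
    rw [H.stationaryPair₁.smoothedJump_eq H.stationaryPair₂ H.common.kernel.measurable]
  all_goals
    have hb : |(meanResponse μ X (response φ₁ X ε) K (h n) (x i) -
        meanResponse μ X (response φ₂ X ε) K (h n) (x i)) / meanKernel μ X K (h n) (x i)| ≤
        2 * C i / c i := by
      have hC : 0 ≤ C i := (abs_nonneg _).trans (hn i).2.1
      rw [abs_div, abs_of_pos ((hc i).trans_le (hn i).1)]
      refine div_le_div₀ (by positivity) ((abs_sub _ _).trans ?_) (hc i) (hn i).1
      linarith [(hn i).2.1, (hn i).2.2]
  · exact (abs_le.mp hb).1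
  · exact (abs_le.mp hb).2

/-- The maximizers of the CUSUM statistic are consistent if the jumps dominate the error. -/
theorem stronglyConsistent [IsProbabilityMeasure μ]
    (H : PiecewiseModel μ X ε K h R x φ₁ φ₂ θ) (hδ : 0 < δ) (hδ' : δ ≤ 1 / 2)
    (hθ : δ ≤ θ) (hθ' : θ ≤ 1 - δ) {S : ℕ → ℝ}
    (hS : ∀ n, S n = ∑ i, smoothedJump μ K (h n) X (changeArray φ₁ φ₂ X ε θ n)
      (changeTime θ n) (x i) ^ 2)
    (hS0 : ∀ᶠ n in atTop, 0 < S n)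
    (hq : Tendsto (fun n => devRate h n ^ 2 / S n) atTop (𝓝 0)) :
    StronglyConsistent μ K h x X (changeArray φ₁ φ₂ X ε θ) δ θ := by
  obtain ⟨D, hD0, hD⟩ := H.ae_eventually_abs_phiHat_sub_le hδ hδ'
  intro kHat hk
  filter_upwards [hD] with ω hω
  -- The first term is the rounding of the change time; the second is the peak inequality divided by
  -- S_n.
  have hlim : Tendsto (fun n : ℕ => |(changeTime θ n : ℝ) / n - θ| +
      2 / (δ / 2) * (m * (2 * D * √(devRate h n ^ 2 / S n) + D ^ 2 * (devRate h n ^ 2 / S n))))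
      atTop (𝓝 0) := by
    have h1 := ((tendsto_changeTime_div (hδ.le.trans hθ)).sub_const θ).abs
    have h2 := (((hq.sqrt.const_mul (2 * D)).add (hq.const_mul (D ^ 2))).const_mul
      (m : ℝ)).const_mul (2 / (δ / 2))
    simpa using h1.add h2
  refine squeeze_zero' (Eventually.of_forall fun _ => abs_nonneg _) ?_ hlim
  filter_upwards [hω, hS0, H.eventually_devRate_pos, eventually_gt_atTop 0,
    eventually_mul_le_of_mem_candidates hδ hδ'] with n hn hSn hrn hn1 hcand
  have hn0 : (0 : ℝ) < n := by exact_mod_cast hn1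
  have key := mul_abs_sub_le_of_isMaxOn (half_pos hδ) hn1 hcand
    (changeTime_mem_candidates hδ hθ hθ' n) hn (hk n ω).1 (hk n ω).2
  rw [← hS n] at key
  have e1 : √(devRate h n ^ 2 / S n) * S n = devRate h n * √(S n) := by
    rw [Real.sqrt_div (sq_nonneg _), Real.sqrt_sq hrn.le, div_mul_eq_mul_div, mul_div_assoc,
      Real.div_sqrt]
  have e2 : devRate h n ^ 2 / S n * S n = devRate h n ^ 2 := div_mul_cancel₀ _ hSn.ne'
  have h3 : |(changeTime θ n : ℝ) - kHat n ω| / n ≤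
      2 / (δ / 2) * (m * (2 * D * √(devRate h n ^ 2 / S n) +
        D ^ 2 * (devRate h n ^ 2 / S n))) := by
    rw [div_mul_eq_mul_div, le_div_iff₀ (half_pos hδ), mul_comm]
    refine le_of_mul_le_mul_right (key.trans_eq ?_) hSn
    linear_combination -(4 * m * D) * e1 - 2 * m * D ^ 2 * e2
  have e4 : (kHat n ω : ℝ) / n - θ =
      ((changeTime θ n : ℝ) / n - θ) - ((changeTime θ n : ℝ) - kHat n ω) / n := by ring
  rw [e4]
  refine (abs_sub _ _).trans (add_le_add le_rfl ?_)
  rwa [abs_div, abs_of_pos hn0]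

end PiecewiseModel

/-! ### Decisions of the test and consistency -/

lemma devRate_sq (h : ℕ → ℝ) {n : ℕ} (hn : 0 ≤ n * h n) :
    devRate h n ^ 2 = Real.log n ^ 4 / (n * h n) := by
  rw [devRate, div_pow, Real.sq_sqrt hn, ← pow_mul]

/-- Without a change, the CUSUM test eventually accepts. -/
theorem NoChange.ae_eventually_lHat_eq_zero [IsProbabilityMeasure μ] {φ : ℝ → ℝ}
    (H : NoChange μ X ε K h R x φ) (hδ : 0 < δ) (hδ' : δ ≤ 1 / 2) :
    ∃ M : ℝ, 0 < M ∧ ∀ ξ : ℕ → ℝ,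
      (∀ᶠ n : ℕ in atTop, M * (Real.log n ^ 4 / (n * h n)) ≤ ξ n) →
      ∀ᵐ ω ∂μ, ∀ᶠ n : ℕ in atTop, lHat K (h n) x X (response φ X ε) δ (ξ n) n ω = 0 := by
  -- The position 1/2 is a dummy.
  have P := H.piecewiseModel (show (1 : ℝ) / 2 ≤ 1 by norm_num)
  obtain ⟨γ, w, c₁, c₂, hr⟩ := P.exists_rateSetup
  obtain ⟨D, hD0, hD⟩ := P.ae_eventually_abs_phiHat_sub_le hδ hδ'
  -- With vanishing jumps only the quadratic error m D² r_n² survives; adding 1 keeps M positive.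
  refine ⟨m * D ^ 2 + 1, by positivity, fun ξ hξ => ?_⟩
  filter_upwards [hD] with ω hω
  filter_upwards [hω, hξ, hr.one_le_mul_h] with n hn hξ hnh
  rw [← devRate_sq h (zero_le_one.trans hnh)] at hξ
  rw [lHat, if_pos]
  refine csSup_le ((candidates_nonempty hδ' n).image _) ?_
  rintro _ ⟨t, ht, rfl⟩
  have hJ : ∀ i, smoothedJump μ K (h n) X (changeArray φ φ X ε (1 / 2) n)
      (changeTime (1 / 2) n) (x i) = 0 := fun i => by
    rw [P.stationaryPair₁.smoothedJump_eq P.stationaryPair₂ H.common.kernel.measurable, sub_self,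
      zero_div]
  have h1 := abs_cusum_sub_le (changeTime_le (by norm_num) n) (le_of_mem_candidates ht)
    (fun i => hn i t ht)
  simp only [hJ, ne_eq, OfNat.ofNat_ne_zero, not_false_eq_true, zero_pow, Finset.sum_const_zero,
    mul_zero, sub_zero, Real.sqrt_zero, zero_add] at h1
  rw [changeArray_self] at h1
  refine (le_abs_self _).trans (h1.trans (le_trans ?_ hξ))
  nlinarith [sq_nonneg (devRate h n)]

lemma abs_changeTime_mul_sub_le (hθ : 0 ≤ θ) (hθ' : θ ≤ 1) {n : ℕ} (hn : 0 < n) :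
    |(changeTime θ n : ℝ) * (n - changeTime θ n) / (n : ℝ) ^ 2 - θ * (1 - θ)| ≤ 1 / (n : ℝ) := by
  have hn0 : (0 : ℝ) < n := by exact_mod_cast hn
  have h1 : (changeTime θ n : ℝ) ≤ θ * n := Nat.floor_le (by positivity)
  have h2 : θ * n < changeTime θ n + 1 := Nat.lt_floor_add_one _
  obtain ⟨κ, hκ⟩ : ∃ κ : ℝ, κ = changeTime θ n / n := ⟨_, rfl⟩
  have h3 : κ ≤ θ := by rw [hκ, div_le_iff₀ hn0]; exact h1
  have h4 : θ - κ ≤ 1 / n := by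
    rw [hκ, le_div_iff₀ hn0, sub_mul, div_mul_cancel₀ _ hn0.ne']; linarith
  have h5 : 0 ≤ κ := by rw [hκ]; positivity
  have e : (changeTime θ n : ℝ) * (n - changeTime θ n) / (n : ℝ) ^ 2 - θ * (1 - θ) =
      (κ - θ) * (1 - κ - θ) := by
    rw [hκ]; field_simp; ring
  rw [e, abs_mul, abs_sub_comm, abs_of_nonneg (sub_nonneg.mpr h3)]
  calc (θ - κ) * |1 - κ - θ| ≤ 1 / n * 1 := by
        refine mul_le_mul h4 ?_ (abs_nonneg _) (by positivity)
        rw [abs_le]; constructor <;> linarith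
    _ = _ := mul_one _

/-- With a change, the CUSUM test eventually rejects and the maximizers are consistent, provided
that the threshold stays below the signal. -/
theorem OneChange.ae_eventually_lHat_eq_one [IsProbabilityMeasure μ]
    (H : OneChange μ X ε K h R x δ φ₁ φ₂ θ) (hδ : 0 < δ) (hδ' : δ ≤ 1 / 2) :
    ∃ M : ℝ, 0 < M ∧ ∀ ξ : ℕ → ℝ,
      (∀ᶠ n : ℕ in atTop, M * (Real.log n ^ 4 / (n * h n)) ≤ ξ n ∧
        ξ n ≤ signal μ K h x X (changeArray φ₁ φ₂ X ε θ) θ n -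
          M * (Real.log n ^ 2 / Real.sqrt (n * h n))) →
      (∀ᵐ ω ∂μ, ∀ᶠ n : ℕ in atTop,
        lHat K (h n) x X (changeArray φ₁ φ₂ X ε θ n) δ (ξ n) n ω = 1) ∧
      StronglyConsistent μ K h x X (changeArray φ₁ φ₂ X ε θ) δ θ := by
  have P := H.piecewiseModel hδ
  obtain ⟨γ, w, c₁, c₂, hr⟩ := P.exists_rateSetup
  obtain ⟨D, hD0, hD⟩ := P.ae_eventually_abs_phiHat_sub_le hδ hδ'
  obtain ⟨B, hB⟩ := P.exists_sum_sq_smoothedJump_le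
  obtain ⟨S, hS⟩ : ∃ S : ℕ → ℝ, ∀ n, S n = ∑ i, smoothedJump μ K (h n) X
    (changeArray φ₁ φ₂ X ε θ n) (changeTime θ n) (x i) ^ 2 := ⟨_, fun _ => rfl⟩
  have hSnn : ∀ n, 0 ≤ S n := fun n => by
    rw [hS]; exact Finset.sum_nonneg fun i _ => sq_nonneg _
  have hSB : ∀ᶠ n in atTop, S n ≤ B := hB.mono fun n hn => by rw [hS]; exact hn
  have hB0 : 0 ≤ B := by
    obtain ⟨n, hn⟩ := hSB.exists
    exact (hSnn n).trans hn
  have hθ0 : 0 ≤ θ := hδ.le.trans H.le_θ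
  have hθ1 : θ ≤ 1 := P.θ_le_one
  -- In multiples of r_n: B covers the effect of rounding the change time, the middle term the
  -- deviation of the statistic at k, and 1 makes the comparison with the threshold strict.
  refine ⟨B + m * (2 * D * √B + D ^ 2) + 1, by positivity, fun ξ hξ => ?_⟩
  obtain ⟨M, hM⟩ : ∃ M, M = B + m * (2 * D * √B + D ^ 2) + 1 := ⟨_, rfl⟩
  have hM0 : 0 < M := by rw [hM]; positivity
  rw [← hM] at hξ
  have hξ' : ∀ᶠ n in atTop, 0 ≤ ξ n ∧ ξ n ≤ θ * (1 - θ) * S n - M * devRate h n := by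
    filter_upwards [hξ, hr.one_le_mul_h] with n hn hnh
    refine ⟨le_trans ?_ hn.1, ?_⟩
    · have : (0 : ℝ) ≤ n * h n := by linarith
      positivity
    · rw [hS]; exact hn.2
  constructor
  · filter_upwards [hD] with ω hω
    filter_upwards [hω, hξ', hSB, P.eventually_devRate_pos, hr.one_le_mul_devRate,
      hr.tendsto_devRate.eventually (gt_mem_nhds zero_lt_one), eventually_gt_atTop 0,
      eventually_mul_le_of_mem_candidates hδ hδ']
      with n hn hξ hSB hrn h1 hr1 hn1 hcand
    have hn0 : (0 : ℝ) < n := by exact_mod_cast hn1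
    have hk := changeTime_mem_candidates hδ H.le_θ H.θ_le n
    have hkn : changeTime θ n < n := by
      have : 0 < (n : ℝ) - changeTime θ n := lt_of_lt_of_le (by positivity) (hcand _ hk).2
      exact_mod_cast sub_pos.mp this
    have h2 := abs_cusum_sub_le hkn.le hkn.le (fun i => hn i _ hk)
    rw [jumpFactor_self hkn, one_pow, mul_one, ← hS n] at h2
    have h3 : (θ * (1 - θ) - 1 / n) * S n ≤
        (changeTime θ n : ℝ) * (n - changeTime θ n) / (n : ℝ) ^ 2 * S n := by
      refine mul_le_mul_of_nonneg_right ?_ (hSnn n)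
      linarith [(abs_le.mp (abs_changeTime_mul_sub_le hθ0 hθ1 hn1)).1]
    have h4 : 1 / n * S n ≤ devRate h n * B := by
      refine mul_le_mul ?_ hSB (hSnn n) hrn.le
      rw [div_le_iff₀ hn0]; linarith
    have h5 : m * (2 * (D * devRate h n) * √(S n) + (D * devRate h n) ^ 2) ≤
        m * (2 * D * √B + D ^ 2) * devRate h n := by
      have h6 : devRate h n ^ 2 ≤ devRate h n := by nlinarith
      calc _ ≤ m * (2 * (D * devRate h n) * √B + D ^ 2 * devRate h n) := by
            rw [mul_pow]; gcongr
        _ = _ := by ring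
    have h7 : ξ n < cusum K (h n) x X (changeArray φ₁ φ₂ X ε θ n) n (changeTime θ n) ω := by
      have h8 := (abs_le.mp h2).1
      have h9 : M * devRate h n = devRate h n * B + m * (2 * D * √B + D ^ 2) * devRate h n +
        devRate h n := by rw [hM]; ring
      rw [sub_mul] at h3
      linarith [hξ.2]
    rw [lHat, if_neg]
    exact not_le.mpr (h7.trans_le (le_csSup ((candidates_finite δ n).image _).bddAbove
      ⟨_, hk, rfl⟩))
  -- The threshold is nonnegative and lies below θ(1-θ) S_n - M r_n, so the window itself forces the
  -- signal to be large. Then r_n²/S_n ≤ r_n/M tends to 0.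
  · have hlow : ∀ᶠ n in atTop, M * devRate h n ≤ S n := by
      filter_upwards [hξ'] with n hn
      have : θ * (1 - θ) * S n ≤ 1 * S n :=
        mul_le_mul_of_nonneg_right (by nlinarith) (hSnn n)
      linarith [hn.1, hn.2]
    refine P.stronglyConsistent hδ hδ' H.le_θ H.θ_le hS ?_ ?_
    · filter_upwards [hlow, P.eventually_devRate_pos] with n hn hrn
      exact lt_of_lt_of_le (by positivity) hn
    · refine squeeze_zero' (Eventually.of_forall fun n => div_nonneg (sq_nonneg _) (hSnn n)) ?_
        (by simpa using hr.tendsto_devRate.const_mul M⁻¹)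
      filter_upwards [hlow, P.eventually_devRate_pos] with n hn hrn
      rw [div_le_iff₀ (lt_of_lt_of_le (by positivity) hn)]
      calc devRate h n ^ 2 = M⁻¹ * devRate h n * (M * devRate h n) := by field_simp
        _ ≤ _ := by gcongr

/-- The maximizers of the CUSUM statistic are consistent if the change is separated at some grid
point. -/
theorem OneChange.stronglyConsistent_of_separatedNear [IsProbabilityMeasure μ]
    (H : OneChange μ X ε K h R x δ φ₁ φ₂ θ) (hδ : 0 < δ) (hδ' : δ ≤ 1 / 2) {i : Fin m}
    (hi : SeparatedNear φ₁ φ₂ (x i)) :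
    StronglyConsistent μ K h x X (changeArray φ₁ φ₂ X ε θ) δ θ := by
  have P := H.piecewiseModel hδ
  obtain ⟨γ, w, c₁, c₂, hr⟩ := P.exists_rateSetup
  obtain ⟨c, hc, hsep⟩ := hi
  obtain ⟨B₁, hB₁⟩ := H.bounded_φ₁
  obtain ⟨B₂, hB₂⟩ := H.bounded_φ₂
  obtain ⟨Cf, hCf⟩ := H.density₁.f_bounded
  have hX := H.common.measurable_X 0
  have hε := H.common.integrable_ε 0
  have hjump : ∀ᶠ n in atTop, c / 2 ≤ |smoothedJump μ K (h n) X (changeArray φ₁ φ₂ X ε θ n)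
      (changeTime θ n) (x i)| := by
    rcases hsep with hsep | hsep
    · filter_upwards [H.common.kernel.eventually_le_meanResponse_sub hX hε H.measurable_φ₁
        H.measurable_φ₂ hB₁ hB₂ H.density₁.hasPDF_X hCf (H.common.density_pos i) hr.tendsto_h
        hr.h_pos hc hsep] with n hn
      rw [P.stationaryPair₁.smoothedJump_eq P.stationaryPair₂ H.common.kernel.measurable]
      exact hn.trans (le_abs_self _)
    · filter_upwards [H.common.kernel.eventually_le_meanResponse_sub hX hε H.measurable_φ₂
        H.measurable_φ₁ hB₂ hB₁ H.density₁.hasPDF_X hCf (H.common.density_pos i) hr.tendsto_h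
        hr.h_pos hc hsep] with n hn
      rw [P.stationaryPair₁.smoothedJump_eq P.stationaryPair₂ H.common.kernel.measurable,
        ← abs_neg, ← neg_div, neg_sub]
      exact hn.trans (le_abs_self _)
  have hlow : ∀ᶠ n in atTop, (c / 2) ^ 2 ≤ ∑ i, smoothedJump μ K (h n) X
      (changeArray φ₁ φ₂ X ε θ n) (changeTime θ n) (x i) ^ 2 := by
    filter_upwards [hjump] with n hn
    refine le_trans ?_ (Finset.single_le_sum (f := fun i => smoothedJump μ K (h n) X
      (changeArray φ₁ φ₂ X ε θ n) (changeTime θ n) (x i) ^ 2) (fun i _ => sq_nonneg _)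
      (Finset.mem_univ i))
    rw [← sq_abs (smoothedJump _ _ _ _ _ _ _)]
    gcongr
  refine P.stronglyConsistent hδ hδ' H.le_θ H.θ_le (fun _ => rfl) ?_ ?_
  · exact hlow.mono fun n hn => lt_of_lt_of_le (by positivity) hn
  · refine squeeze_zero' (Eventually.of_forall fun n => div_nonneg (sq_nonneg _)
      (Finset.sum_nonneg fun i _ => sq_nonneg _)) ?_
      (by simpa using (hr.tendsto_devRate.pow 2).div_const ((c / 2) ^ 2))
    filter_upwards [hlow] with n hn
    gcongr

end Model

end

end NWChange

/-! ### The theorem -/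

theorem theorem3 {Ω : Type*} [MeasurableSpace Ω] (μ : Measure Ω) [IsProbabilityMeasure μ]
    (X ε : ℕ → Ω → ℝ) (K : ℝ → ℝ) (h : ℕ → ℝ) (R : MixingRegime)
    {m : ℕ} (x : Fin m → ℝ) (δ : ℝ) (hδ : 0 < δ) (hδ' : δ ≤ 1 / 2) :
    -- no change point
    (∀ φ : ℝ → ℝ, NoChange μ X ε K h R x φ →
      ∃ M : ℝ, 0 < M ∧ ∀ ξ : ℕ → ℝ,
        (∀ᶠ n : ℕ in atTop, M * (Real.log n ^ 4 / (n * h n)) ≤ ξ n) →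
        ∀ᵐ ω ∂μ, ∀ᶠ n : ℕ in atTop,
          lHat K (h n) x X (response φ X ε) δ (ξ n) n ω = 0) ∧
    -- one change point
    (∀ (φ₁ φ₂ : ℝ → ℝ) (θ : ℝ), OneChange μ X ε K h R x δ φ₁ φ₂ θ →
      (∃ M : ℝ, 0 < M ∧ ∀ ξ : ℕ → ℝ,
        (∀ᶠ n : ℕ in atTop, M * (Real.log n ^ 4 / (n * h n)) ≤ ξ n ∧
          ξ n ≤ signal μ K h x X (changeArray φ₁ φ₂ X ε θ) θ n -
            M * (Real.log n ^ 2 / Real.sqrt (n * h n))) →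
        (∀ᵐ ω ∂μ, ∀ᶠ n : ℕ in atTop,
          lHat K (h n) x X (changeArray φ₁ φ₂ X ε θ n) δ (ξ n) n ω = 1) ∧
        StronglyConsistent μ K h x X (changeArray φ₁ φ₂ X ε θ) δ θ) ∧
      ((∃ i, SeparatedNear φ₁ φ₂ (x i)) →
        StronglyConsistent μ K h x X (changeArray φ₁ φ₂ X ε θ) δ θ)) := by
  refine ⟨fun φ H => H.ae_eventually_lHat_eq_zero hδ hδ', fun φ₁ φ₂ θ H =>
    ⟨H.ae_eventually_lHat_eq_one hδ hδ', ?_⟩⟩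
  rintro ⟨i, hi⟩
  exact H.stronglyConsistent_of_separatedNear hδ hδ' hi
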